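/- **Setting.** Let $(Y,Z,W)$ be a random vector with values in $\mathbb R\times\mathbb R^{d_z}\times\mathbb R^{d_w}$ satisfying $Y=\varphi(Z)+U$ with $\mathbb E[U\mid W]=0$ and $\mathbb E|\varphi(Z)|^2<\infty$, and let $(Y_i,Z_i,W_i)_{i\ge1}$ be i.i.d. copies of it. Let $\mathcal Z,\mathcal W$ be the supports of $Z$ and $W$. Let $W$ have Lebesgue density $p_W$, let $\nu$ be a probability density on $\mathbb R^{d_w}$, and let $(f_l)_{l\ge1}$ be an orthonormal basis of $L^2_\nu(\mathbb R^{d_w})=\{\phi:\int\phi^2\nu<\infty\}$. Let $(e_j)_{j\ge1}$ be functions with $\mathbb E|e_j(Z)|^2<\infty$. Write $e_{\underline k}=(e_1,\dots,e_k)^t$. Let $\varphi_0(Z)=\mathbb E[Y\mid Z]$. Let $(k_n)$ and $(m_n)$ be sequences of integers tending to infinity. **Assumptions.** 1. There are constants $\eta_f,\eta_p\ge1$ with $\sup_{l\ge1}\int|f_l|^4\nu\le\eta_f$ and $\sup_{w\in\mathcal W}p_W(w)/\nu(w)\le\eta_p$, and $\nu>0$ on $\mathcal W$. 2. There is a constant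 $\sigma>0$ with $\mathbb E[U^4\mid W]\le\sigma^4$. 3. The operator $T\phi=\mathbb E[\phi(Z)\mid W]$ from $L^2_Z=\{\phi:\mathbb E|\phi(Z)|^2<\infty\}$ to $L^2_W$ is nonsingular (injective). 4. The sequence $(\tau_j)_{j\ge1}$ is positive and nonincreasing with $\tau_1=1$. 5. The sequence $(\varpi_j)_{j\ge1}$ is nondecreasing with $\varpi_1=1$ and $j^2=o(\varpi_j)$ as $j\to\infty$. Moreover: - $\varphi_0\in\mathcal F_\varpi$, where $\mathcal F_\varpi$ is the set of $\phi\in L^2_Z$ such that $\sup_{z\in\mathcal Z}|\phi(z)-e_{\underline{k_n}}(z)^t\beta_{k_n}|^2=O(\varpi_{k_n}^{-1})$ for some $\beta_{k_n}\in\mathbb R^{k_n}$; - for some $\eta_e\ge1$, $\sup_{z\in\mathcal Z}\|e_{\underline{k_n}}(z)\|^2\le\eta_ek_n$ for all $n\ge1$; - the smallest eigenvalue of $\mathbb E[e_{\underline k}(Z)e_{\underline k}(Z)^t]$ is bounded away from zero uniformly in $k\ge1$; - $\mathbb E[U^2\mid Z]$ is bounded. **Statistic.** Let $\mathbf Z$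 be the $n\times k_n$ matrix with entries $e_j(Z_i)$, let $\mathbf Y=(Y_1,\dots,Y_n)^t$, and let $\overline\varphi_{k_n}(z)=e_{\underline{k_n}}(z)^t(\mathbf Z^t\mathbf Z)^-\mathbf Z^t\mathbf Y$, where $A^-$ denotes an arbitrary generalized inverse ($AA^-A=A$). Put $$S_n^{e}=\sum_{j=1}^{m_n}\tau_j\Big|\frac1n\sum_{i=1}^n\big(Y_i-\overline\varphi_{k_n}(Z_i)\big)f_j(W_i)\Big|^2 .$$ With $s_{jl}=\mathbb E\big[U^2\sqrt{\tau_j}f_j(W)\sqrt{\tau_l}f_l(W)\big]$, put $\mu_m=\sum_{j=1}^ms_{jj}$ and $\varsigma_m=\big(\sum_{j,l=1}^ms_{jl}^2\big)^{1/2}$. **Theorem.** Suppose that, as $n\to\infty$, $$n=o(\varpi_{k_n}\varsigma_{m_n}),\qquad k_n=o(\varsigma_{m_n}),\qquad \Big(\sum_{j=1}^{m_n}\tau_j\Big)^3=o(n).$$ Then, under the hypothesis of exogeneity $H_e:\ \varphi=\varphi_0$ (that is, $\varphi(Z)=\mathbb E[Y\mid Z]$ almost surely), $$(\sqrt2\,\varsigma_{m_n})^{-1}\big(n\,S_n^{e}-\mu_{m_n}\big)\xrightarrow{\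 d\ }\mathcal N(0,1).$$ -/

import Mathlib

open MeasureTheory ProbabilityTheory Filter Topology Asymptotics
open scoped Matrix ENNReal

namespace ExogTest

noncomputable section

/-- `d`-dimensional Euclidean space. -/
abbrev Euc (d : ℕ) : Type := EuclideanSpace ℝ (Fin d)

/-- `p` is a probability density function with respect to Lebesgue measure on `ℝ^d`. -/
structure IsProbDensity {d : ℕ} (p : Euc d → ℝ) : Prop where
  measurable : Measurable p
  nonneg : ∀ x, 0 ≤ p x
  lintegral_eq_one : ∫⁻ x, ENNReal.ofReal (p x) = 1

/-- The measure `p(x) dx` on `ℝ^d`. -/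
def densityMeasure {d : ℕ} (p : Euc d → ℝ) : Measure (Euc d) :=
  volume.withDensity fun x => ENNReal.ofReal (p x)

/-- The functions `f 1, f 2, …` (the value `f 0` is never used) form an orthonormal basis of the
space `L²_ν(ℝ^d)` of functions that are square integrable with respect to `ν(s) ds`. -/
def IsOrthonormalBasisOfL2 {d : ℕ} (ν : Euc d → ℝ) (f : ℕ → Euc d → ℝ) : Prop :=
  (∀ l, 1 ≤ l → Measurable (f l)) ∧
  ∃ b : HilbertBasis ℕ+ ℝ (Lp ℝ 2 (densityMeasure ν)),
    ∀ l : ℕ+, (b l : Euc d → ℝ) =ᵐ[densityMeasure ν] f l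

section Probability

variable {Ω : Type*} [MeasurableSpace Ω]

/-- The conditional expectation `E[X | V]` given a Euclidean random vector `V`. -/
def condExpGiven {d : ℕ} (P : Measure Ω) (X : Ω → ℝ) (V : Ω → Euc d) : Ω → ℝ :=
  P[X | MeasurableSpace.comap V inferInstance]

/-- The random vectors `(Ys i, Zs i, Ws i)`, `i = 0, 1, 2, …`, are independent and distributed as
`(Y, Z, W)`; the sample of size `n` consists of those with `i < n`. -/
structure IsIIDSample {dz dw : ℕ} (P : Measure Ω) (Y : Ω → ℝ) (Z : Ω → Euc dz) (W : Ω → Euc dw)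
    (Ys : ℕ → Ω → ℝ) (Zs : ℕ → Ω → Euc dz) (Ws : ℕ → Ω → Euc dw) : Prop where
  indep : iIndepFun (fun i ω => (Ys i ω, Zs i ω, Ws i ω)) P
  identDistrib : ∀ i,
    IdentDistrib (fun ω => (Ys i ω, Zs i ω, Ws i ω)) (fun ω => (Y ω, Z ω, W ω)) P P

/-- The nonparametric instrumental regression model `Y = φ(Z) + U` with `E[U | W] = 0`, where
`φ(Z)` is square integrable. Here `U` is the error `Y - φ(Z)`. -/
structure IsIVModel {dz dw : ℕ} (P : Measure Ω) (Y : Ω → ℝ) (Z : Ω → Euc dz) (W : Ω → Euc dw)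
    (φ : Euc dz → ℝ) (U : Ω → ℝ) : Prop where
  measurable_φ : Measurable φ
  memLp_φ : MemLp (fun ω => φ (Z ω)) 2 P
  model : ∀ ω, Y ω = φ (Z ω) + U ω
  integrable_U : Integrable U P
  condExp_U : condExpGiven P U W =ᵐ[P] 0

/-- Uniform bounds on the fourth moments of the basis `f` with respect to `ν(s) ds` and on the
ratio `p_W / ν` over the support of `W`, where `ν` is strictly positive. -/
def BasisAndDensityBounds {dw : ℕ} (P : Measure Ω) (W : Ω → Euc dw)
    (f : ℕ → Euc dw → ℝ) (ν pW : Euc dw → ℝ) : Prop :=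
  ∃ ηf ηp : ℝ, 1 ≤ ηf ∧ 1 ≤ ηp ∧
    (∀ l, 1 ≤ l → Integrable (fun s => |f l s| ^ 4 * ν s) ∧ ∫ s, |f l s| ^ 4 * ν s ≤ ηf) ∧
    (∀ w ∈ (P.map W).support, 0 < ν w) ∧
    (∀ w ∈ (P.map W).support, pW w / ν w ≤ ηp)

/-- `E[U⁴ | W] ≤ σ⁴` almost surely for some constant `σ > 0`. -/
def CondFourthMomentBound {dw : ℕ} (P : Measure Ω) (U : Ω → ℝ) (W : Ω → Euc dw) : Prop :=
  ∃ σ : ℝ, 0 < σ ∧ Integrable (fun ω => U ω ^ 4) P ∧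
    ∀ᵐ ω ∂P, condExpGiven P (fun ω => U ω ^ 4) W ω ≤ σ ^ 4

/-- The conditional expectation operator `ψ ↦ E[ψ(Z) | W]` on `L²_Z` is nonsingular. -/
def CondExpOperatorNonsingular {dz dw : ℕ} (P : Measure Ω) (Z : Ω → Euc dz) (W : Ω → Euc dw) :
    Prop :=
  ∀ ψ : Euc dz → ℝ, Measurable ψ → MemLp (fun ω => ψ (Z ω)) 2 P →
    condExpGiven P (fun ω => ψ (Z ω)) W =ᵐ[P] 0 → (fun ω => ψ (Z ω)) =ᵐ[P] 0

/-- The weights `τ 1, τ 2, …` are positive and nonincreasing with `τ 1 = 1`. -/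
structure IsWeightSequence (τ : ℕ → ℝ) : Prop where
  pos : ∀ j, 1 ≤ j → 0 < τ j
  antitone : ∀ i j, 1 ≤ i → i ≤ j → τ j ≤ τ i
  one : τ 1 = 1

/-- The entries `s_{jl} = E[U² f_j^τ(W) f_l^τ(W)]` with `f_j^τ = √τ_j f_j`. -/
def covEntry {dw : ℕ} (P : Measure Ω) (U : Ω → ℝ) (W : Ω → Euc dw) (τ : ℕ → ℝ)
    (f : ℕ → Euc dw → ℝ) (j l : ℕ) : ℝ :=
  ∫ ω, U ω ^ 2 * (√(τ j) * f j (W ω)) * (√(τ l) * f l (W ω)) ∂P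

/-- The trace `μ_m` of the covariance matrix `(s_{jl})_{1 ≤ j,l ≤ m}`. -/
def covTrace {dw : ℕ} (P : Measure Ω) (U : Ω → ℝ) (W : Ω → Euc dw) (τ : ℕ → ℝ)
    (f : ℕ → Euc dw → ℝ) (m : ℕ) : ℝ :=
  ∑ j ∈ Finset.Icc 1 m, covEntry P U W τ f j j

/-- The Frobenius norm `ς_m` of the covariance matrix `(s_{jl})_{1 ≤ j,l ≤ m}`. -/
def covFrobenius {dw : ℕ} (P : Measure Ω) (U : Ω → ℝ) (W : Ω → Euc dw) (τ : ℕ → ℝ)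
    (f : ℕ → Euc dw → ℝ) (m : ℕ) : ℝ :=
  √(∑ j ∈ Finset.Icc 1 m, ∑ l ∈ Finset.Icc 1 m, covEntry P U W τ f j l ^ 2)

end Probability

section Series

/-- The linear combination `∑_{l = 1}^k β_l e_l(z)`. The coordinate of `β` with index `l : Fin k`
belongs to `e (l + 1)`, and `e 0` is never used. -/
def seriesEval {dz : ℕ} (e : ℕ → Euc dz → ℝ) (k : ℕ) (β : Fin k → ℝ) (z : Euc dz) : ℝ :=
  ∑ l : Fin k, β l * e (l + 1) z

/-- The `n × k` matrix with entries `e_j(z_i)`. -/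
def designMatrix {dz : ℕ} (e : ℕ → Euc dz → ℝ) (n k : ℕ) (z : ℕ → Euc dz) :
    Matrix (Fin n) (Fin k) ℝ :=
  Matrix.of fun i j => e (j + 1) (z i)

/-- `G` is a generalized inverse of the square matrix `A`. -/
def IsGeneralizedInverse {k : ℕ} (A G : Matrix (Fin k) (Fin k) ℝ) : Prop :=
  A * G * A = A

/-- The least squares coefficient `(𝐙ᵗ𝐙)⁻ 𝐙ᵗ 𝐘` with `(𝐙ᵗ𝐙)⁻ = G`. -/
def lsCoef {dz : ℕ} (e : ℕ → Euc dz → ℝ) (n k : ℕ) (G : Matrix (Fin k) (Fin k) ℝ)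
    (y : ℕ → ℝ) (z : ℕ → Euc dz) : Fin k → ℝ :=
  G *ᵥ ((designMatrix e n k z)ᵀ *ᵥ fun i : Fin n => y i)

/-- The test statistic
`∑_{j = 1}^m τ_j |n⁻¹ ∑_i (y_i - φ̄_k(z_i)) f_j(w_i)|²`, where `φ̄_k` is the least squares series
estimator with `k` terms and the generalized inverse `G`. -/
def exogStatistic {dz dw : ℕ} (τ : ℕ → ℝ) (f : ℕ → Euc dw → ℝ) (e : ℕ → Euc dz → ℝ)
    (n k m : ℕ) (G : Matrix (Fin k) (Fin k) ℝ)
    (y : ℕ → ℝ) (z : ℕ → Euc dz) (w : ℕ → Euc dw) : ℝ :=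
  ∑ j ∈ Finset.Icc 1 m, τ j *
    |(n : ℝ)⁻¹ * ∑ i : Fin n, (y i - seriesEval e k (lsCoef e n k G y z) (z i)) * f j (w i)| ^ 2

variable {Ω : Type*} [MeasurableSpace Ω]

/-- The class `F_ϖ` of square integrable functions of `Z` whose squared uniform distance, over the
support of `Z`, to some linear combination of `e_1, …, e_{k_n}` is `O(ϖ_{k_n}⁻¹)`. -/
def ApproxClass {dz : ℕ} (P : Measure Ω) (Z : Ω → Euc dz) (e : ℕ → Euc dz → ℝ) (ϖ : ℕ → ℝ)
    (k : ℕ → ℕ) : Set (Euc dz → ℝ) :=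
  {φ | Measurable φ ∧ MemLp (fun ω => φ (Z ω)) 2 P ∧
    ∃ β : (κ : ℕ) → Fin κ → ℝ, ∃ C : ℝ, ∀ᶠ n in atTop, ∀ z ∈ (P.map Z).support,
      |φ z - seriesEval e (k n) (β (k n)) z| ^ 2 ≤ C * (ϖ (k n))⁻¹}

/-- The second moment matrix `E[e_{1..k}(Z) e_{1..k}(Z)ᵗ]`. -/
def secondMoment {dz : ℕ} (P : Measure Ω) (Z : Ω → Euc dz) (e : ℕ → Euc dz → ℝ) (k : ℕ) :
    Matrix (Fin k) (Fin k) ℝ :=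
  Matrix.of fun i j => ∫ ω, e (i + 1) (Z ω) * e (j + 1) (Z ω) ∂P

/-- Conditions on the regression function `φ₀`, on the approximating functions `e_1, e_2, …` in
`L²_Z`, on the weights `ϖ_1, ϖ_2, …` and on the conditional variance of the error. -/
structure SeriesConditions {dz : ℕ} (P : Measure Ω) (Z : Ω → Euc dz) (U : Ω → ℝ)
    (φ₀ : Euc dz → ℝ) (e : ℕ → Euc dz → ℝ) (ϖ : ℕ → ℝ) (k : ℕ → ℕ) : Prop where
  measurable_e : ∀ j, 1 ≤ j → Measurable (e j)
  memLp_e : ∀ j, 1 ≤ j → MemLp (fun ω => e j (Z ω)) 2 P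
  ϖ_one : ϖ 1 = 1
  ϖ_mono : ∀ i j, 1 ≤ i → i ≤ j → ϖ i ≤ ϖ j
  ϖ_growth : (fun j : ℕ => (j : ℝ) ^ 2) =o[atTop] ϖ
  mem_approxClass : φ₀ ∈ ApproxClass P Z e ϖ k
  basis_bound : ∃ ηe : ℝ, 1 ≤ ηe ∧ ∀ n, 1 ≤ n → ∀ z ∈ (P.map Z).support,
    ∑ l ∈ Finset.Icc 1 (k n), e l z ^ 2 ≤ ηe * k n
  eigenvalue_bound : ∃ c : ℝ, 0 < c ∧ ∀ κ : ℕ, 1 ≤ κ →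
    ∀ x ∈ spectrum ℝ (secondMoment P Z e κ), c ≤ x
  condVar_bound : ∃ C : ℝ, Integrable (fun ω => U ω ^ 2) P ∧
    ∀ᵐ ω ∂P, condExpGiven P (fun ω => U ω ^ 2) Z ω ≤ C

end Series

end

end ExogTest

set_option linter.unusedSectionVars false

/-! Write `F` for the vector of the functions `√τ_j f_j(W)`, `j ≤ m`, put `X_i = u_i F_i`, `T = ∑
τ_j`, and let `C` be the covariance of `X_i`. Then `μ_m` is the trace of `C`, `ς_m²` is the trace of
`C²` (called `V` or `covEnergy` below), and `n S_n = n⁻¹ ‖∑ û_i F_i‖²` with `û_i` the least squares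
residuals. Orthonormality of the `f_j`, `τ_j ≤ 1`, `p_W ≤ η_p ν` and `E[U⁴ | W] ≤ σ⁴` bound the
operator norm of `C` by a constant `κ` independent of `m`, while the fourth moments of `‖F‖` and
`‖X‖` are `O(T²)`. Three replacements prove the theorem.

(1) Residuals by errors. Under exogeneity `E[U | Z] = 0`, and `û_i = u_i + r_i - ⟨e_i, θ⟩`, where
`r` is the bias of the series approximation, `r² = O(1/ϖ_k)`, and `θ` is the error of the
coefficients. A plain Cauchy-Schwarz bound on the cross term of the square would cost a factor `√T`.
Instead `∑ r_i F_i` and `∑ F_i e_iᵗ` are split into mean and fluctuation. The mean parts see `∑ X_i`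
only through fixed linear maps, so their variances involve `κ` and not the trace of `C`; the
fluctuations are small because `T² = o(n)`. The remainder is `O_P(k + n / ϖ_k) = o_P(ς_m)`: see
`abs_quadratic_remainder_le` and `RegressionBounds.measure_quadratic_remainder_ge_le`.

(2) Diagonal. `n⁻¹ ‖∑ X_i‖²` is `n⁻¹ ∑ ‖X_i‖²` plus `2/n` times the sum over pairs `⟨X_i, X_j⟩`, `i
< j`. The first has mean `μ_m` and variance `O(T²/n)` (`measure_empirical_norm_sq_ge_le`).

(3) Off-diagonal part. The sum over pairs is a martingale with increments `⟨X_k, S_k⟩`, `S_k = X_0 +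
⋯ + X_{k-1}`, whose conditional variance `⟨C S_k, S_k⟩` concentrates around `k V`. A second order
expansion of each increment shows that the characteristic function is multiplied by about `exp(-t² k
V / 2)` at each step. After normalization the fluctuation of the conditional variance leaves an
error governed by `κ / √V`, which vanishes because `k_n → ∞` and `k_n = o(ς_m)` force `V = ς_m² → ∞`
(`tendstoInDistribution_pairSum`). Slutsky's lemma combines the three. -/

namespace ExogTest

/-! ### Cauchy-Schwarz, fourth moments, and Fubini for independent pairs. -/

section MomentTools

variable {Ω 𝓧 𝓨 : Type*} [MeasurableSpace Ω] [MeasurableSpace 𝓧] [MeasurableSpace 𝓨]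
  {P : Measure Ω}

lemma integral_abs_mul_le_sqrt_mul_sqrt {f g : Ω → ℝ} (hf : MemLp f 2 P) (hg : MemLp g 2 P) :
    ∫ ω, |f ω| * |g ω| ∂P ≤ √(∫ ω, f ω ^ 2 ∂P) * √(∫ ω, g ω ^ 2 ∂P) := by
  have h := integral_mul_norm_le_Lp_mul_Lq (μ := P) (f := f) (g := g) (p := 2) (q := 2)
    ⟨by norm_num, by norm_num, by norm_num⟩ (by simpa using hf) (by simpa using hg)
  simpa [Real.sqrt_eq_rpow] using h

lemma abs_integral_mul_le_sqrt_mul_sqrt {f g : Ω → ℝ} (hf : MemLp f 2 P) (hg : MemLp g 2 P) :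
    |∫ ω, f ω * g ω ∂P| ≤ √(∫ ω, f ω ^ 2 ∂P) * √(∫ ω, g ω ^ 2 ∂P) := by
  refine (abs_integral_le_integral_abs).trans ?_
  simpa only [abs_mul] using integral_abs_mul_le_sqrt_mul_sqrt hf hg

lemma integral_abs_le_sqrt [IsProbabilityMeasure P] {f : Ω → ℝ} (hf : MemLp f 2 P) :
    ∫ ω, |f ω| ∂P ≤ √(∫ ω, f ω ^ 2 ∂P) := by
  simpa using integral_abs_mul_le_sqrt_mul_sqrt hf (memLp_const (1 : ℝ))

lemma memLp_four_iff {F : Type*} [NormedAddCommGroup F] {f : Ω → F}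
    (hf : AEStronglyMeasurable f P) : MemLp f 4 P ↔ Integrable (fun ω => ‖f ω‖ ^ 4) P := by
  rw [← integrable_norm_rpow_iff hf (by norm_num) (by norm_num)]
  norm_num

lemma _root_.MeasureTheory.MemLp.norm_sq_of_four {F : Type*} [NormedAddCommGroup F] {f : Ω → F}
    (hf : MemLp f 4 P) : MemLp (fun ω => ‖f ω‖ ^ 2) 2 P := by
  rw [memLp_two_iff_integrable_sq (by have := hf.1; fun_prop)]
  simpa only [← pow_mul] using (memLp_four_iff hf.1).1 hf

lemma _root_.MeasureTheory.MemLp.sq_of_four {f : Ω → ℝ}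
    (hf : MemLp f 4 P) : MemLp (fun ω => f ω ^ 2) 2 P := by
  simpa using hf.norm_sq_of_four

/-- The joint law is a product measure, so Fubini applies. This takes the place of conditioning on
the past in all martingale arguments below: `S` is the past and `X` the next observation. -/
lemma _root_.ProbabilityTheory.IndepFun.integral_comp_pair {F : Type*} [NormedAddCommGroup F]
    [NormedSpace ℝ F] [IsProbabilityMeasure P]
    {ρ : Measure 𝓨} [IsProbabilityMeasure ρ] {S : Ω → 𝓧} {X : Ω → 𝓨}
    (h : IndepFun S X P) (hS : AEMeasurable S P) (hX : HasLaw X ρ P) {g : 𝓧 → 𝓨 → F}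
    (hg : StronglyMeasurable (fun p : 𝓧 × 𝓨 => g p.1 p.2))
    (hint : Integrable (fun ω => g (S ω) (X ω)) P) :
    ∫ ω, g (S ω) (X ω) ∂P = ∫ ω, ∫ x, g (S ω) x ∂ρ ∂P := by
  have hlaw := h.map_prod_eq_prod_map_map hS hX.aemeasurable
  rw [hX.map_eq] at hlaw
  have : IsProbabilityMeasure (P.map S) := Measure.isProbabilityMeasure_map hS
  have hpair : AEMeasurable (fun ω => (S ω, X ω)) P := hS.prodMk hX.aemeasurable
  have hint' : Integrable (fun p : 𝓧 × 𝓨 => g p.1 p.2) ((P.map S).prod ρ) := by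
    rw [← hlaw, integrable_map_measure hg.aestronglyMeasurable hpair]
    exact hint
  calc ∫ ω, g (S ω) (X ω) ∂P = ∫ p, g p.1 p.2 ∂(P.map fun ω => (S ω, X ω)) :=
        (integral_map hpair hg.aestronglyMeasurable).symm
    _ = ∫ s, ∫ x, g s x ∂ρ ∂(P.map S) := by rw [hlaw, integral_prod _ hint']
    _ = _ := integral_map hS (hg.integral_prod_right').aestronglyMeasurable

end MomentTools

/-! ### Centered laws on a Hilbert space whose covariance operator has norm at most `κ`. -/

section CovarianceOperator

variable {E : Type*} [NormedAddCommGroup E] [InnerProductSpace ℝ E] [CompleteSpace E]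
  [MeasurableSpace E] [BorelSpace E] [SecondCountableTopology E]

local notation "⟪" x ", " y "⟫" => inner ℝ x y

/-- A centered law with finite fourth moment and covariance operator bounded by `κ`. -/
structure IsCenteredLaw (ρ : Measure E) (κ : ℝ) : Prop where
  memLp : MemLp id 4 ρ
  mean (s : E) : ∫ x, ⟪s, x⟫ ∂ρ = 0
  nonneg : 0 ≤ κ
  bound (s : E) : ∫ x, ⟪s, x⟫ ^ 2 ∂ρ ≤ κ * ‖s‖ ^ 2

namespace IsCenteredLaw

variable {ρ : Measure E} [IsProbabilityMeasure ρ] {κ : ℝ} (h : IsCenteredLaw ρ κ)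
include h

lemma memLp_two : MemLp id 2 ρ := h.memLp.mono_exponent (by norm_num)

lemma inner_eq (u v : E) : ⟪covarianceOperator ρ u, v⟫ = ∫ x, ⟪u, x⟫ * ⟪v, x⟫ ∂ρ :=
  covarianceOperator_inner h.memLp_two u v

lemma inner_self_eq (u : E) : ⟪covarianceOperator ρ u, u⟫ = ∫ x, ⟪u, x⟫ ^ 2 ∂ρ := by
  rw [h.inner_eq]; simp only [sq]

lemma inner_symm (u v : E) : ⟪covarianceOperator ρ u, v⟫ = ⟪covarianceOperator ρ v, u⟫ := by
  rw [h.inner_eq, h.inner_eq]; simp only [mul_comm]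

lemma inner_self_nonneg (u : E) : 0 ≤ ⟪covarianceOperator ρ u, u⟫ := by
  rw [h.inner_self_eq]; exact integral_nonneg fun _ => sq_nonneg _

lemma inner_self_le (u : E) : ⟪covarianceOperator ρ u, u⟫ ≤ κ * ‖u‖ ^ 2 := by
  rw [h.inner_self_eq]; exact h.bound u

lemma memLp_inner (s : E) : MemLp (fun x => ⟪s, x⟫) 4 ρ := h.memLp.const_inner s

lemma memLp_inner_two (s : E) : MemLp (fun x => ⟪s, x⟫) 2 ρ := h.memLp_two.const_inner s

/-- For a positive operator `C ≤ κ` one has `C² ≤ κ C`. The proof is Cauchy-Schwarz for the form of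
`C` at `u` and `C u`, followed by division by `‖C u‖`. -/
lemma norm_sq_le (u : E) :
    ‖covarianceOperator ρ u‖ ^ 2 ≤ κ * ⟪covarianceOperator ρ u, u⟫ := by
  set w := covarianceOperator ρ u with hw
  have h1 : ‖w‖ ^ 2 ≤ √⟪w, u⟫ * √⟪covarianceOperator ρ w, w⟫ := by
    rw [← real_inner_self_eq_norm_sq, hw, h.inner_eq, h.inner_self_eq, h.inner_self_eq]
    exact (le_abs_self _).trans
      (abs_integral_mul_le_sqrt_mul_sqrt (h.memLp_inner_two _) (h.memLp_inner_two _))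
  have h2 : √⟪covarianceOperator ρ w, w⟫ ≤ √κ * ‖w‖ := by
    rw [← Real.sqrt_sq (norm_nonneg w), ← Real.sqrt_mul h.nonneg]
    exact Real.sqrt_le_sqrt (by simpa [Real.sqrt_sq] using h.inner_self_le w)
  have h3 : ‖w‖ ^ 2 ≤ (√⟪w, u⟫ * √κ) * ‖w‖ := by
    rw [mul_assoc]; exact h1.trans (mul_le_mul_of_nonneg_left h2 (Real.sqrt_nonneg _))
  have h4 : ‖w‖ ≤ √⟪w, u⟫ * √κ := by
    rcases (norm_nonneg w).eq_or_lt with h0 | h0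
    · rw [← h0]; positivity
    · exact le_of_mul_le_mul_right (by rw [← sq]; exact h3) h0
  calc ‖w‖ ^ 2 ≤ (√⟪w, u⟫ * √κ) ^ 2 := by gcongr
    _ = κ * ⟪w, u⟫ := by
      rw [mul_pow, Real.sq_sqrt (h.inner_self_nonneg u), Real.sq_sqrt h.nonneg, mul_comm]

lemma measurable_inner_self : Measurable fun u : E => ⟪covarianceOperator ρ u, u⟫ := by
  have : Continuous fun u : E => ⟪covarianceOperator ρ u, u⟫ := by fun_prop
  exact this.measurable

end IsCenteredLaw

/-- The sum of the squared entries of the covariance of `ρ`. -/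
noncomputable def covEnergy (ρ : Measure E) : ℝ := ∫ x, ⟪covarianceOperator ρ x, x⟫ ∂ρ

end CovarianceOperator

/-! ### Sums over pairs of independent vectors; concentration of the conditional variance. -/

section QuadraticForm

variable {Ω : Type*} [MeasurableSpace Ω] {P : Measure Ω} [IsProbabilityMeasure P]
  {E : Type*} [NormedAddCommGroup E] [InnerProductSpace ℝ E] [CompleteSpace E]
  [MeasurableSpace E] [BorelSpace E] [SecondCountableTopology E]

local notation "⟪" x ", " y "⟫" => inner ℝ x y

/-- The sum of the first `k` terms of a sequence. -/
def partialSum (x : ℕ → E) (k : ℕ) : E := ∑ i ∈ Finset.range k, x i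

/-- The sum of the inner products of pairs of different terms among the first `k`. -/
noncomputable def pairSum (x : ℕ → E) (k : ℕ) : ℝ :=
  ∑ j ∈ Finset.range k, ⟪x j, partialSum x j⟫

lemma partialSum_succ (x : ℕ → E) (k : ℕ) : partialSum x (k + 1) = partialSum x k + x k :=
  Finset.sum_range_succ _ _

lemma pairSum_succ (x : ℕ → E) (k : ℕ) :
    pairSum x (k + 1) = pairSum x k + ⟪x k, partialSum x k⟫ :=
  Finset.sum_range_succ _ _

lemma partialSum_zero (x : ℕ → E) : partialSum x 0 = 0 := by simp [partialSum]

lemma pairSum_zero (x : ℕ → E) : pairSum x 0 = 0 := by simp [pairSum]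

lemma partialSum_congr {x y : ℕ → E} {k : ℕ} (h : ∀ i < k, x i = y i) :
    partialSum x k = partialSum y k :=
  Finset.sum_congr rfl fun i hi => h i (Finset.mem_range.1 hi)

lemma pairSum_congr {x y : ℕ → E} {k : ℕ} (h : ∀ i < k, x i = y i) :
    pairSum x k = pairSum y k :=
  Finset.sum_congr rfl fun i hi => by
    have hi := Finset.mem_range.1 hi
    rw [h i hi, partialSum_congr fun j hj => h j (hj.trans hi)]

lemma measurable_partialSum (k : ℕ) : Measurable fun x : ℕ → E => partialSum x k := by
  unfold partialSum; fun_prop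

lemma measurable_pairSum (k : ℕ) : Measurable fun x : ℕ → E => pairSum x k := by
  unfold pairSum
  refine Finset.measurable_sum _ fun j _ => ?_
  exact (measurable_pi_apply j).inner (measurable_partialSum j)

variable {X : ℕ → Ω → E} {ρ : Measure E} [IsProbabilityMeasure ρ] {κ : ℝ}

lemma indepFun_past (hind : iIndepFun X P) (hX : ∀ i, HasLaw (X i) ρ P) (k : ℕ) :
    IndepFun (fun ω => (pairSum (fun i => X i ω) k, partialSum (fun i => X i ω) k)) (X k) P := by
  have h := hind.indepFun_finset₀ (Finset.range k) {k} (by simp) fun i => (hX i).aemeasurable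
  -- A finite tuple is padded by zeros to a sequence, so that `pairSum · k` and `partialSum · k`
  -- become measurable functions of the first `k` observations alone.
  let ext : (Finset.range k → E) → ℕ → E := fun y i =>
    if hi : i ∈ Finset.range k then y ⟨i, hi⟩ else 0
  have hext : Measurable ext := by
    refine measurable_pi_lambda _ fun i => ?_
    by_cases hi : i ∈ Finset.range k
    · simpa only [ext, hi, dif_pos] using! measurable_pi_apply _
    · simpa only [ext, hi, dif_neg, not_false_iff] using! measurable_const
  have hlast : Measurable fun y : ({k} : Finset ℕ) → E => y ⟨k, Finset.mem_singleton_self k⟩ :=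
    measurable_pi_apply _
  have h2 := h.comp (φ := fun y => (pairSum (ext y) k, partialSum (ext y) k))
    (((measurable_pairSum k).comp hext).prodMk ((measurable_partialSum k).comp hext))
    hlast
  convert! h2 using 1
  funext ω
  have : ∀ i < k, (fun i => X i ω) i = ext (fun j => X j ω) i := fun i hi => by
    simp [ext, hi]
  simp only [Function.comp]
  rw [pairSum_congr this, partialSum_congr this]

lemma indepFun_partialSum (hind : iIndepFun X P) (hX : ∀ i, HasLaw (X i) ρ P) (k : ℕ) :
    IndepFun (fun ω => partialSum (fun i => X i ω) k) (X k) P :=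
  (indepFun_past hind hX k).comp measurable_snd measurable_id

namespace IsCenteredLaw

variable (h : IsCenteredLaw ρ κ) (hX : ∀ i, HasLaw (X i) ρ P)
include h

include hX in
lemma memLp_seq (i : ℕ) : MemLp (X i) 4 P := by
  have := h.memLp
  rw [← (hX i).map_eq, memLp_map_measure_iff (by fun_prop) (hX i).aemeasurable] at this
  exact this

include hX in
lemma memLp_partialSum (k : ℕ) : MemLp (fun ω => partialSum (fun i => X i ω) k) 4 P :=
  memLp_finsetSum _ fun i _ => h.memLp_seq hX i

omit h in
-- Independence is essential: the fourth power of the product factors into two integrable variables,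
-- whereas Hölder's inequality would only give a product in `L²`.
lemma memLp_four_norm_mul_norm {S Y : Ω → E} (hS : MemLp S 4 P) (hY : MemLp Y 4 P)
    (hSY : IndepFun S Y P) : MemLp (fun ω => ‖S ω‖ * ‖Y ω‖) 4 P := by
  have h1 := hS.1.norm
  have h2 := hY.1.norm
  rw [memLp_four_iff (by fun_prop)]
  have := (hSY.comp (φ := fun s => ‖s‖ ^ 4) (ψ := fun s => ‖s‖ ^ 4) (by fun_prop)
    (by fun_prop)).integrable_mul ((memLp_four_iff hS.1).1 hS) ((memLp_four_iff hY.1).1 hY)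
  refine this.congr (ae_of_all _ fun ω => ?_)
  simp [mul_pow]

omit h in
lemma memLp_four_inner {S Y : Ω → E} (hS : MemLp S 4 P) (hY : MemLp Y 4 P)
    (hSY : IndepFun S Y P) (T : E →L[ℝ] E) : MemLp (fun ω => ⟪T (S ω), Y ω⟫) 4 P := by
  refine ((memLp_four_norm_mul_norm hS hY hSY).const_mul ‖T‖).mono' ?_ (ae_of_all _ fun ω => ?_)
  · exact (T.continuous.comp_aestronglyMeasurable hS.1).inner hY.1
  · calc ‖⟪T (S ω), Y ω⟫‖ ≤ ‖T (S ω)‖ * ‖Y ω‖ := norm_inner_le_norm _ _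
      _ ≤ (‖T‖ * ‖S ω‖) * ‖Y ω‖ := by gcongr; exact T.le_opNorm _
      _ = _ := by ring

lemma memLp_inner_self {Q : Measure Ω} {S : Ω → E} (hS : MemLp S 4 Q) :
    MemLp (fun ω => ⟪covarianceOperator ρ (S ω), S ω⟫) 2 Q := by
  refine (hS.norm_sq_of_four.const_mul κ).mono' ?_ (ae_of_all _ fun ω => ?_)
  · exact ((covarianceOperator ρ).continuous.comp_aestronglyMeasurable hS.1).inner hS.1
  · rw [Real.norm_of_nonneg (h.inner_self_nonneg _)]
    exact h.inner_self_le _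

lemma energy_nonneg : 0 ≤ covEnergy ρ := integral_nonneg fun x => h.inner_self_nonneg x

lemma integral_inner_self_sq_le :
    ∫ x, ⟪covarianceOperator ρ x, x⟫ ^ 2 ∂ρ ≤ κ ^ 2 * ∫ x, ‖x‖ ^ 4 ∂ρ := by
  rw [← integral_const_mul]
  have h4 := (memLp_four_iff h.memLp.1).1 h.memLp
  refine integral_mono ?_ (h4.const_mul _) fun x => ?_
  · have := h.memLp.norm_sq_of_four
    refine (memLp_two_iff_integrable_sq ?_).1 ?_
    · exact h.measurable_inner_self.aestronglyMeasurable
    · refine (this.const_mul κ).mono' h.measurable_inner_self.aestronglyMeasurable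
        (ae_of_all _ fun x => ?_)
      rw [Real.norm_of_nonneg (h.inner_self_nonneg _)]
      exact h.inner_self_le _
  · calc _ ≤ (κ * ‖x‖ ^ 2) ^ 2 :=
          pow_le_pow_left₀ (h.inner_self_nonneg x) (h.inner_self_le x) 2
      _ = _ := by ring

lemma integrable_inner_pow (s : E) {p : ℕ} (hp : p ≤ 4) : Integrable (fun x => ⟪s, x⟫ ^ p) ρ := by
  have : MemLp (fun x => ⟪s, x⟫) p ρ := (h.memLp_inner s).mono_exponent (by exact_mod_cast hp)
  refine this.integrable_norm_pow'.mono' ?_ (ae_of_all _ fun x => ?_)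
  · exact (Continuous.aestronglyMeasurable (by fun_prop))
  · simp

variable (hind : iIndepFun X P)
include hX hind

/-- The second moment of the covariance form at a partial sum. -/
lemma integral_inner_self_partialSum (k : ℕ) :
    ∫ ω, ⟪covarianceOperator ρ (partialSum (fun i => X i ω) k), partialSum (fun i => X i ω) k⟫ ∂P
      = k * covEnergy ρ := by
  induction k with
  | zero => simp [partialSum_zero]
  | succ k ih =>
    have hS := h.memLp_partialSum hX k
    have hSX := indepFun_partialSum hind hX k
    have hq : Integrable (fun x => ⟪covarianceOperator ρ x, x⟫) ρ := by
      refine MemLp.integrable (q := 2) (by norm_num) ?_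
      refine (h.memLp.norm_sq_of_four.const_mul κ).mono'
        h.measurable_inner_self.aestronglyMeasurable (ae_of_all _ fun x => ?_)
      rw [Real.norm_of_nonneg (h.inner_self_nonneg _)]
      exact h.inner_self_le _
    have hS1 := h.memLp_partialSum hX (k + 1)
    simp only [partialSum_succ] at hS1 ⊢
    rw [hSX.integral_comp_pair hS.1.aemeasurable (hX k)
      (g := fun s x => ⟪covarianceOperator ρ (s + x), s + x⟫)
      (Continuous.stronglyMeasurable (by fun_prop))
      ((h.memLp_inner_self hS1).integrable (by norm_num))]
    have : ∀ s, ∫ x, ⟪covarianceOperator ρ (s + x), s + x⟫ ∂ρ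
        = ⟪covarianceOperator ρ s, s⟫ + covEnergy ρ := fun s => by
      have e : ∀ x, ⟪covarianceOperator ρ (s + x), s + x⟫ = ⟪covarianceOperator ρ s, s⟫
          + 2 * ⟪covarianceOperator ρ s, x⟫ + ⟪covarianceOperator ρ x, x⟫ := fun x => by
        rw [map_add, inner_add_left, inner_add_right, inner_add_right, h.inner_symm x s]; ring
      have hi := (h.memLp_inner (covarianceOperator ρ s)).integrable (by norm_num)
      have a1 : Integrable (fun x => ⟪covarianceOperator ρ s, s⟫
          + 2 * ⟪covarianceOperator ρ s, x⟫) ρ := (integrable_const _).add (hi.const_mul 2)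
      simp_rw [e]
      rw [integral_add a1 hq,
        integral_add (integrable_const _) (hi.const_mul 2), integral_const_mul, h.mean]
      simp [covEnergy]
    simp_rw [this]
    rw [integral_add ((h.memLp_inner_self hS).integrable (by norm_num)) (integrable_const _), ih]
    simp; ring

/-- The covariance form at a partial sum concentrates around its mean. -/
lemma integral_sq_inner_self_partialSum_sub_le (k : ℕ) :
    ∫ ω, (⟪covarianceOperator ρ (partialSum (fun i => X i ω) k), partialSum (fun i => X i ω) k⟫
      - k * covEnergy ρ) ^ 2 ∂P
      ≤ 4 * k ^ 2 * κ ^ 2 * covEnergy ρ + 2 * k * κ ^ 2 * ∫ x, ‖x‖ ^ 4 ∂ρ := by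
  have hV := h.energy_nonneg
  have hM : 0 ≤ ∫ x, ‖x‖ ^ 4 ∂ρ := integral_nonneg fun x => by positivity
  induction k with
  | zero => simp [partialSum_zero]
  | succ k ih =>
    set C := covarianceOperator ρ with hC
    set V := covEnergy ρ with hVdef
    have hS := h.memLp_partialSum hX k
    have hS1 := h.memLp_partialSum hX (k + 1)
    have hSX := indepFun_partialSum hind hX k
    have hq2 : MemLp (fun x => ⟪C x, x⟫) 2 ρ := by
      refine (h.memLp.norm_sq_of_four.const_mul κ).mono'
        h.measurable_inner_self.aestronglyMeasurable (ae_of_all _ fun x => ?_)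
      rw [Real.norm_of_nonneg (h.inner_self_nonneg _)]
      exact h.inner_self_le _
    have hint : Integrable (fun ω => (⟪C (partialSum (fun i => X i ω) (k + 1)),
        partialSum (fun i => X i ω) (k + 1)⟫ - ((k + 1 : ℕ) : ℝ) * V) ^ 2) P :=
      ((h.memLp_inner_self hS1).sub (memLp_const _)).integrable_sq
    have hintk : Integrable (fun ω => (⟪C (partialSum (fun i => X i ω) k),
        partialSum (fun i => X i ω) k⟫ - (k : ℝ) * V) ^ 2) P :=
      ((h.memLp_inner_self hS).sub (memLp_const _)).integrable_sq
    have hqS : Integrable (fun ω => ⟪C (partialSum (fun i => X i ω) k),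
        partialSum (fun i => X i ω) k⟫) P := (h.memLp_inner_self hS).integrable (by norm_num)
    simp only [partialSum_succ] at hint ⊢
    rw [hSX.integral_comp_pair hS.1.aemeasurable (hX k)
      (g := fun s x => (⟪C (s + x), s + x⟫ - ((k + 1 : ℕ) : ℝ) * V) ^ 2)
      (Continuous.stronglyMeasurable (by fun_prop)) hint]
    have key : ∀ s, ∫ x, (⟪C (s + x), s + x⟫ - ((k + 1 : ℕ) : ℝ) * V) ^ 2 ∂ρ
        ≤ (⟪C s, s⟫ - k * V) ^ 2 + 8 * κ ^ 2 * ⟪C s, s⟫ + 2 * κ ^ 2 * ∫ x, ‖x‖ ^ 4 ∂ρ := fun s => by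
      set R := ⟪C s, s⟫ - k * V with hR
      -- The new deviation is `R` plus the centered increment `2⟨C s, x⟩ + (⟨C x, x⟩ - V)`. The
      -- square of the increment is bounded by `(a + b)² ≤ 2a² + 2b²`, which gives the constants 8
      -- and 2; the terms linear in `R` integrate to zero.
      have e : ∀ x, (⟪C (s + x), s + x⟫ - ((k + 1 : ℕ) : ℝ) * V) ^ 2
          ≤ R ^ 2 + 4 * R * ⟪C s, x⟫ + 2 * R * (⟪C x, x⟫ - V)
            + (8 * ⟪C s, x⟫ ^ 2 + 2 * (⟪C x, x⟫ - V) ^ 2) := fun x => by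
        have : ⟪C (s + x), s + x⟫ - ((k + 1 : ℕ) : ℝ) * V
            = R + (2 * ⟪C s, x⟫ + (⟪C x, x⟫ - V)) := by
          rw [map_add, inner_add_left, inner_add_right, inner_add_right, h.inner_symm x s]
          push_cast; ring
        rw [this]
        nlinarith [sq_nonneg (2 * ⟪C s, x⟫ - (⟪C x, x⟫ - V))]
      have i1 := (h.memLp_inner (C s)).integrable (by norm_num)
      have i2 : Integrable (fun x => ⟪C x, x⟫ - V) ρ :=
        (hq2.integrable (by norm_num)).sub (integrable_const _)
      have i3 := h.integrable_inner_pow (C s) (p := 2) (by norm_num)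
      have i4 : Integrable (fun x => (⟪C x, x⟫ - V) ^ 2) ρ := (hq2.sub (memLp_const V)).integrable_sq
      have a1 : Integrable (fun x => R ^ 2 + 4 * R * ⟪C s, x⟫) ρ :=
        (integrable_const _).add (i1.const_mul _)
      have a2 : Integrable (fun x => R ^ 2 + 4 * R * ⟪C s, x⟫ + 2 * R * (⟪C x, x⟫ - V)) ρ :=
        a1.add (i2.const_mul _)
      have a3 : Integrable (fun x => 8 * ⟪C s, x⟫ ^ 2 + 2 * (⟪C x, x⟫ - V) ^ 2) ρ :=
        (i3.const_mul _).add (i4.const_mul _)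
      have mz : ∫ x, (⟪C x, x⟫ - V) ∂ρ = 0 := by
        rw [integral_sub (hq2.integrable (by norm_num)) (integrable_const _)]
        simp [hVdef, covEnergy, hC]
      have vle : ∫ x, (⟪C x, x⟫ - V) ^ 2 ∂ρ ≤ κ ^ 2 * ∫ x, ‖x‖ ^ 4 ∂ρ := by
        have := variance_eq_integral (μ := ρ) (X := fun x => ⟪C x, x⟫) hq2.1.aemeasurable
        have h2 := variance_le_expectation_sq (μ := ρ) (X := fun x => ⟪C x, x⟫) hq2.1
        rw [this] at h2
        exact h2.trans h.integral_inner_self_sq_le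
      -- Bounding by `⟨C s, s⟩`, and not by `‖s‖²`, keeps the mean at `k V`, with one power of `V`
      -- instead of the larger trace of `C`.
      have cle : ∫ x, ⟪C s, x⟫ ^ 2 ∂ρ ≤ κ ^ 2 * ⟪C s, s⟫ := by
        have h1 := h.bound (C s)
        have h2 := h.norm_sq_le s
        have := h.nonneg
        nlinarith
      calc _ ≤ ∫ x, (R ^ 2 + 4 * R * ⟪C s, x⟫ + 2 * R * (⟪C x, x⟫ - V)
            + (8 * ⟪C s, x⟫ ^ 2 + 2 * (⟪C x, x⟫ - V) ^ 2)) ∂ρ :=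
            integral_mono_of_nonneg (ae_of_all _ fun _ => sq_nonneg _) (a2.add a3)
              (ae_of_all _ e)
        _ = R ^ 2 + (8 * ∫ x, ⟪C s, x⟫ ^ 2 ∂ρ + 2 * ∫ x, (⟪C x, x⟫ - V) ^ 2 ∂ρ) := by
            rw [integral_add a2 a3, integral_add a1 (i2.const_mul _),
              integral_add (integrable_const _) (i1.const_mul _),
              integral_add (i3.const_mul _) (i4.const_mul _)]
            simp only [integral_const_mul]
            rw [h.mean, mz]; simp
        _ ≤ _ := by linarith
    have b1 : Integrable (fun ω => (⟪C (partialSum (fun i => X i ω) k),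
        partialSum (fun i => X i ω) k⟫ - (k : ℝ) * V) ^ 2 + 8 * κ ^ 2 *
          ⟪C (partialSum (fun i => X i ω) k), partialSum (fun i => X i ω) k⟫) P :=
      hintk.add (hqS.const_mul _)
    calc _ ≤ ∫ ω, ((⟪C (partialSum (fun i => X i ω) k), partialSum (fun i => X i ω) k⟫
          - k * V) ^ 2 + 8 * κ ^ 2 * ⟪C (partialSum (fun i => X i ω) k),
            partialSum (fun i => X i ω) k⟫ + 2 * κ ^ 2 * ∫ x, ‖x‖ ^ 4 ∂ρ) ∂P :=
          integral_mono_of_nonneg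
            (ae_of_all _ fun _ => integral_nonneg fun _ => sq_nonneg _)
            (b1.add (integrable_const _))
            (ae_of_all _ fun ω => key _)
      _ = ∫ ω, (⟪C (partialSum (fun i => X i ω) k), partialSum (fun i => X i ω) k⟫
          - k * V) ^ 2 ∂P + 8 * κ ^ 2 * (k * V) + 2 * κ ^ 2 * ∫ x, ‖x‖ ^ 4 ∂ρ := by
          rw [integral_add b1 (integrable_const _), integral_add hintk (hqS.const_mul _),
            integral_const_mul, h.integral_inner_self_partialSum hX hind k]
          simp [hVdef]
      -- The induction closes because `4k² + 8k ≤ 4(k + 1)²`.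
      _ ≤ _ := by
          push_cast
          nlinarith [ih, mul_nonneg (sq_nonneg κ) hV]

end IsCenteredLaw

end QuadraticForm

/-! ### Second and fourth moments of the martingale increments. -/

section QuadraticFormMoments

variable {Ω : Type*} [MeasurableSpace Ω] {P : Measure Ω} [IsProbabilityMeasure P]
  {E : Type*} [NormedAddCommGroup E] [InnerProductSpace ℝ E] [CompleteSpace E]
  [MeasurableSpace E] [BorelSpace E] [SecondCountableTopology E]

local notation "⟪" x ", " y "⟫" => inner ℝ x y

variable {X : ℕ → Ω → E} {ρ : Measure E} [IsProbabilityMeasure ρ] {κ : ℝ}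

/-- The fourth moment of the inner product of two independent vectors with law `ρ`. -/
noncomputable def pairFourthMoment (ρ : Measure E) : ℝ := ∫ y, ∫ x, ⟪y, x⟫ ^ 4 ∂ρ ∂ρ

lemma pairFourthMoment_nonneg : 0 ≤ pairFourthMoment ρ :=
  integral_nonneg fun _ => integral_nonneg fun _ => by positivity

lemma _root_.MeasureTheory.MemLp.integrable_pow_of_four {f : Ω → ℝ} (hf : MemLp f 4 P) {p : ℕ}
    (hp : p ≤ 4) : Integrable (fun ω => f ω ^ p) P := by
  have : MemLp f p P := hf.mono_exponent (by exact_mod_cast hp)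
  refine this.integrable_norm_pow'.mono' (hf.1.pow p) (ae_of_all _ fun x => ?_)
  simp

namespace IsCenteredLaw

variable (h : IsCenteredLaw ρ κ) (hX : ∀ i, HasLaw (X i) ρ P)
include h

lemma integrable_inner_self : Integrable (fun x => ⟪covarianceOperator ρ x, x⟫) ρ :=
  (h.memLp_inner_self h.memLp).integrable (by norm_num)

lemma stronglyMeasurable_integral_inner_pow :
    StronglyMeasurable fun y => ∫ x, ⟪y, x⟫ ^ 4 ∂ρ := by
  have : StronglyMeasurable fun p : E × E => ⟪p.1, p.2⟫ ^ 4 :=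
    Continuous.stronglyMeasurable (by fun_prop)
  exact this.integral_prod_right'

lemma integrable_integral_inner_pow : Integrable (fun y => ∫ x, ⟪y, x⟫ ^ 4 ∂ρ) ρ := by
  have h4 := (memLp_four_iff h.memLp.1).1 h.memLp
  refine (h4.mul_const (∫ x, ‖x‖ ^ 4 ∂ρ)).mono'
    h.stronglyMeasurable_integral_inner_pow.aestronglyMeasurable (ae_of_all _ fun y => ?_)
  rw [Real.norm_of_nonneg (integral_nonneg fun _ => by positivity), ← integral_const_mul]
  refine integral_mono (h.integrable_inner_pow y le_rfl) (h4.const_mul _) fun x => ?_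
  have : ⟪y, x⟫ ^ 4 = |⟪y, x⟫| ^ 4 := by rw [Even.pow_abs (by decide)]
  calc ⟪y, x⟫ ^ 4 = |⟪y, x⟫| ^ 4 := this
    _ ≤ (‖y‖ * ‖x‖) ^ 4 := by gcongr; exact abs_real_inner_le_norm y x
    _ = _ := by rw [mul_pow]; rfl

variable (hind : iIndepFun X P)
include hX

lemma memLp_inner_partialSum (v : E) (k : ℕ) :
    MemLp (fun ω => ⟪v, partialSum (fun i => X i ω) k⟫) 4 P :=
  (h.memLp_partialSum hX k).const_inner v

lemma integral_inner_partialSum (v : E) (k : ℕ) :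
    ∫ ω, ⟪v, partialSum (fun i => X i ω) k⟫ ∂P = 0 := by
  simp only [partialSum, inner_sum]
  rw [integral_finsetSum _ fun i _ =>
    ((h.memLp_seq hX i).const_inner v).integrable (by norm_num)]
  refine Finset.sum_eq_zero fun i _ => ?_
  rw [← h.mean v]
  exact (hX i).integral_comp (f := fun x => ⟪v, x⟫)
    (Continuous.aestronglyMeasurable (by fun_prop))

include hind

lemma integral_inner_partialSum_sq (v : E) (k : ℕ) :
    ∫ ω, ⟪v, partialSum (fun i => X i ω) k⟫ ^ 2 ∂P = k * ⟪covarianceOperator ρ v, v⟫ := by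
  induction k with
  | zero => simp [partialSum_zero]
  | succ k ih =>
    have hS := h.memLp_partialSum hX k
    have hint := (h.memLp_inner_partialSum hX v (k + 1)).integrable_pow_of_four (p := 2)
      (by norm_num)
    have hk := (h.memLp_inner_partialSum hX v k).integrable_pow_of_four (p := 2) (by norm_num)
    simp only [partialSum_succ] at hint ⊢
    rw [(indepFun_partialSum hind hX k).integral_comp_pair hS.1.aemeasurable (hX k)
      (g := fun s x => ⟪v, s + x⟫ ^ 2) (Continuous.stronglyMeasurable (by fun_prop)) hint]
    have key : ∀ s, ∫ x, ⟪v, s + x⟫ ^ 2 ∂ρ = ⟪v, s⟫ ^ 2 + ⟪covarianceOperator ρ v, v⟫ := by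
      intro s
      have e : ∀ x, ⟪v, s + x⟫ ^ 2 = ⟪v, s⟫ ^ 2 + 2 * ⟪v, s⟫ * ⟪v, x⟫ + ⟪v, x⟫ ^ 2 := fun x => by
        rw [inner_add_right]; ring
      have i1 := ((h.memLp_inner v).integrable (by norm_num)).const_mul (2 * ⟪v, s⟫)
      have i2 : Integrable (fun x => ⟪v, s⟫ ^ 2 + 2 * ⟪v, s⟫ * ⟪v, x⟫) ρ :=
        (integrable_const _).add i1
      simp_rw [e]
      rw [integral_add i2 (h.integrable_inner_pow v (by norm_num)),
        integral_add (integrable_const _) i1, integral_const_mul, h.mean, h.inner_self_eq]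
      simp
    simp_rw [key]
    rw [integral_add hk (integrable_const _), ih]
    simp; ring

lemma integral_inner_partialSum_pow_four_le (v : E) (k : ℕ) :
    ∫ ω, ⟪v, partialSum (fun i => X i ω) k⟫ ^ 4 ∂P
      ≤ 3 * k ^ 2 * ⟪covarianceOperator ρ v, v⟫ ^ 2 + k * ∫ x, ⟪v, x⟫ ^ 4 ∂ρ := by
  induction k with
  | zero => simp [partialSum_zero]
  | succ k ih =>
    have hS := h.memLp_partialSum hX k
    have hint := (h.memLp_inner_partialSum hX v (k + 1)).integrable_pow_of_four (p := 4) le_rfl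
    have hk4 := (h.memLp_inner_partialSum hX v k).integrable_pow_of_four (p := 4) le_rfl
    have hk2 := (h.memLp_inner_partialSum hX v k).integrable_pow_of_four (p := 2) (by norm_num)
    have hk1 := (h.memLp_inner_partialSum hX v k).integrable (by norm_num)
    simp only [partialSum_succ] at hint ⊢
    rw [(indepFun_partialSum hind hX k).integral_comp_pair hS.1.aemeasurable (hX k)
      (g := fun s x => ⟪v, s + x⟫ ^ 4) (Continuous.stronglyMeasurable (by fun_prop)) hint]
    set q := ⟪covarianceOperator ρ v, v⟫ with hq
    set c3 := ∫ x, ⟪v, x⟫ ^ 3 ∂ρ with hc3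
    set c4 := ∫ x, ⟪v, x⟫ ^ 4 ∂ρ with hc4
    have key : ∀ s, ∫ x, ⟪v, s + x⟫ ^ 4 ∂ρ
        = ⟪v, s⟫ ^ 4 + (6 * q) * ⟪v, s⟫ ^ 2 + (4 * c3) * ⟪v, s⟫ + c4 := by
      intro s
      have e : ∀ x, ⟪v, s + x⟫ ^ 4 = ⟪v, s⟫ ^ 4 + (4 * ⟪v, s⟫ ^ 3) * ⟪v, x⟫
          + (6 * ⟪v, s⟫ ^ 2) * ⟪v, x⟫ ^ 2 + (4 * ⟪v, s⟫) * ⟪v, x⟫ ^ 3 + ⟪v, x⟫ ^ 4 := fun x => by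
        rw [inner_add_right]; ring
      have i1 := ((h.memLp_inner v).integrable (by norm_num)).const_mul (4 * ⟪v, s⟫ ^ 3)
      have i2 := (h.integrable_inner_pow v (p := 2) (by norm_num)).const_mul (6 * ⟪v, s⟫ ^ 2)
      have i3 := (h.integrable_inner_pow v (p := 3) (by norm_num)).const_mul (4 * ⟪v, s⟫)
      have j1 : Integrable (fun x => ⟪v, s⟫ ^ 4 + (4 * ⟪v, s⟫ ^ 3) * ⟪v, x⟫) ρ :=
        (integrable_const _).add i1
      have j2 : Integrable (fun x => ⟪v, s⟫ ^ 4 + (4 * ⟪v, s⟫ ^ 3) * ⟪v, x⟫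
          + (6 * ⟪v, s⟫ ^ 2) * ⟪v, x⟫ ^ 2) ρ := j1.add i2
      have j3 : Integrable (fun x => ⟪v, s⟫ ^ 4 + (4 * ⟪v, s⟫ ^ 3) * ⟪v, x⟫
          + (6 * ⟪v, s⟫ ^ 2) * ⟪v, x⟫ ^ 2 + (4 * ⟪v, s⟫) * ⟪v, x⟫ ^ 3) ρ := j2.add i3
      simp_rw [e]
      rw [integral_add j3 (h.integrable_inner_pow v le_rfl), integral_add j2 i3,
        integral_add j1 i2, integral_add (integrable_const _) i1, integral_const_mul,
        integral_const_mul, integral_const_mul, h.mean, hq, h.inner_self_eq, ← hc3, ← hc4]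
      simp; ring
    simp_rw [key]
    have j1 : Integrable (fun ω => ⟪v, partialSum (fun i => X i ω) k⟫ ^ 4
        + (6 * q) * ⟪v, partialSum (fun i => X i ω) k⟫ ^ 2) P := hk4.add (hk2.const_mul _)
    have j2 : Integrable (fun ω => ⟪v, partialSum (fun i => X i ω) k⟫ ^ 4
        + (6 * q) * ⟪v, partialSum (fun i => X i ω) k⟫ ^ 2
        + (4 * c3) * ⟪v, partialSum (fun i => X i ω) k⟫) P := j1.add (hk1.const_mul _)
    rw [integral_add j2 (integrable_const _), integral_add j1 (hk1.const_mul _),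
      integral_add hk4 (hk2.const_mul _), integral_const_mul, integral_const_mul,
      h.integral_inner_partialSum hX, h.integral_inner_partialSum_sq hX hind, ← hq]
    simp only [integral_const, probReal_univ, smul_eq_mul]
    -- The induction closes because `3k² + 6k ≤ 3(k + 1)²`; the third moment has disappeared since
    -- it multiplies the vanishing mean of the partial sum.
    push_cast
    nlinarith [sq_nonneg q]

lemma memLp_inner_next (k : ℕ) :
    MemLp (fun ω => ⟪X k ω, partialSum (fun i => X i ω) k⟫) 4 P := by
  have := memLp_four_inner (h.memLp_partialSum hX k) (h.memLp_seq hX k)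
    (indepFun_partialSum hind hX k) (ContinuousLinearMap.id ℝ E)
  simpa [real_inner_comm] using this

lemma integral_inner_next_sq (k : ℕ) :
    ∫ ω, ⟪X k ω, partialSum (fun i => X i ω) k⟫ ^ 2 ∂P = k * covEnergy ρ := by
  have hS := h.memLp_partialSum hX k
  have hint := (h.memLp_inner_next hX hind k).integrable_pow_of_four (p := 2) (by norm_num)
  rw [(indepFun_partialSum hind hX k).integral_comp_pair hS.1.aemeasurable (hX k)
    (g := fun s x => ⟪x, s⟫ ^ 2) (Continuous.stronglyMeasurable (by fun_prop)) hint,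
    ← h.integral_inner_self_partialSum hX hind k]
  simp_rw [h.inner_self_eq, real_inner_comm]

/-- Here the new vector `X k` is frozen and the past is integrated out, so that the fourth moment
bound for a fixed direction `v` applies with `v = X k`. Then `⟨C v, v⟩² ≤ κ² ‖v‖⁴` is averaged over
`v`. -/
lemma integral_inner_next_pow_four_le (k : ℕ) :
    ∫ ω, ⟪X k ω, partialSum (fun i => X i ω) k⟫ ^ 4 ∂P
      ≤ 3 * k ^ 2 * (κ ^ 2 * ∫ x, ‖x‖ ^ 4 ∂ρ) + k * pairFourthMoment ρ := by
  have hS := h.memLp_partialSum hX k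
  have hint := (h.memLp_inner_next hX hind k).integrable_pow_of_four (p := 4) le_rfl
  have hlaw : HasLaw (fun ω => partialSum (fun i => X i ω) k)
    (P.map fun ω => partialSum (fun i => X i ω) k) P := ⟨hS.1.aemeasurable, rfl⟩
  have := Measure.isProbabilityMeasure_map (μ := P) hS.1.aemeasurable
  rw [(indepFun_partialSum hind hX k).symm.integral_comp_pair (hX k).aemeasurable hlaw
    (g := fun x s => ⟪x, s⟫ ^ 4) (Continuous.stronglyMeasurable (by fun_prop)) hint]
  have e : ∀ v, ∫ s, ⟪v, s⟫ ^ 4 ∂(P.map fun ω => partialSum (fun i => X i ω) k)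
      ≤ 3 * k ^ 2 * ⟪covarianceOperator ρ v, v⟫ ^ 2 + k * ∫ x, ⟪v, x⟫ ^ 4 ∂ρ := fun v => by
    rw [integral_map hS.1.aemeasurable (Continuous.aestronglyMeasurable (by fun_prop))]
    exact h.integral_inner_partialSum_pow_four_le hX hind v k
  have hq2 : Integrable (fun v => ⟪covarianceOperator ρ v, v⟫ ^ 2) ρ :=
    (h.memLp_inner_self h.memLp).integrable_sq
  have hi := h.integrable_integral_inner_pow
  have hint2 : Integrable (fun v => 3 * k ^ 2 * ⟪covarianceOperator ρ v, v⟫ ^ 2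
      + k * ∫ x, ⟪v, x⟫ ^ 4 ∂ρ) ρ := (hq2.const_mul _).add (hi.const_mul _)
  have hint3 : Integrable (fun ω => 3 * k ^ 2 * ⟪covarianceOperator ρ (X k ω), X k ω⟫ ^ 2
      + k * ∫ x, ⟪X k ω, x⟫ ^ 4 ∂ρ) P := by
    rw [← (hX k).map_eq] at hint2
    have := hint2.comp_aemeasurable (hX k).aemeasurable
    rw [(hX k).map_eq] at this
    exact this
  calc _ ≤ ∫ ω, (3 * k ^ 2 * ⟪covarianceOperator ρ (X k ω), X k ω⟫ ^ 2
        + k * ∫ x, ⟪X k ω, x⟫ ^ 4 ∂ρ) ∂P :=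
        integral_mono_of_nonneg (ae_of_all _ fun _ => integral_nonneg fun _ => by positivity)
          hint3 (ae_of_all _ fun ω => e _)
    _ = ∫ v, (3 * k ^ 2 * ⟪covarianceOperator ρ v, v⟫ ^ 2
        + k * ∫ x, ⟪v, x⟫ ^ 4 ∂ρ) ∂ρ := (hX k).integral_comp hint2.1
    _ = 3 * k ^ 2 * (∫ v, ⟪covarianceOperator ρ v, v⟫ ^ 2 ∂ρ) + k * pairFourthMoment ρ := by
        rw [integral_add (hq2.const_mul _) (hi.const_mul _), integral_const_mul,
          integral_const_mul]; rfl
    _ ≤ _ := by gcongr; exact h.integral_inner_self_sq_le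

end IsCenteredLaw

end QuadraticFormMoments

/-! ### Elementary expansions of the exponential. -/

section CharacteristicFunction

open Complex in
lemma norm_exp_I_mul_sub_taylor_le (x : ℝ) :
    ‖exp (I * x) - (1 + I * x - x ^ 2 / 2)‖ ≤ 4 * |x| ^ 3 := by
  rcases le_total |x| 1 with hx | hx
  · have h := exp_bound (x := I * x) (by simpa using hx) (n := 3) (by norm_num)
    have e : ∑ m ∈ Finset.range 3, (I * x) ^ m / (m.factorial : ℂ) = 1 + I * x - x ^ 2 / 2 := by
      simp [Finset.sum_range_succ, mul_pow]; ring
    rw [e] at h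
    refine h.trans ?_
    simp only [norm_mul, norm_I, one_mul, norm_real, Real.norm_eq_abs]
    have : 0 ≤ |x| ^ 3 := by positivity
    norm_num [Nat.factorial]
    nlinarith
  · have h1 : ‖exp (I * x)‖ = 1 := by rw [mul_comm]; exact norm_exp_ofReal_mul_I x
    calc _ ≤ ‖exp (I * x)‖ + (‖(1 : ℂ)‖ + ‖I * (x : ℂ)‖ + ‖(x : ℂ) ^ 2 / 2‖) := by
          refine (norm_sub_le _ _).trans ?_
          gcongr
          refine (norm_sub_le _ _).trans ?_
          gcongr
          exact norm_add_le _ _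
      _ = 1 + (1 + |x| + |x| ^ 2 / 2) := by rw [h1]; simp
      _ ≤ 4 * |x| ^ 3 := by
          nlinarith [mul_nonneg (sub_nonneg.2 hx) (abs_nonneg x),
            mul_nonneg (sub_nonneg.2 hx) (sq_nonneg |x|)]

lemma abs_exp_neg_sub_le {s : ℝ} (hs : 0 ≤ s) : |Real.exp (-s) - (1 - s)| ≤ s ^ 2 := by
  rcases le_total s 1 with h | h
  · have := Real.abs_exp_sub_one_sub_id_le (x := -s) (by rwa [abs_neg, abs_of_nonneg hs])
    simpa [sub_eq_add_neg, add_assoc, add_comm, add_left_comm] using this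
  · have h1 := Real.add_one_le_exp (-s)
    have h2 : Real.exp (-s) ≤ 1 := by simpa using hs
    rw [abs_of_nonneg (by linarith)]
    nlinarith

end CharacteristicFunction

/-! ### Recursion for the characteristic function of the sum over pairs. -/

section QuadraticFormCharFun

variable {Ω : Type*} [MeasurableSpace Ω] {P : Measure Ω} [IsProbabilityMeasure P]
  {E : Type*} [NormedAddCommGroup E] [InnerProductSpace ℝ E] [CompleteSpace E]
  [MeasurableSpace E] [BorelSpace E] [SecondCountableTopology E]

local notation "⟪" x ", " y "⟫" => inner ℝ x y

variable {X : ℕ → Ω → E} {ρ : Measure E} [IsProbabilityMeasure ρ] {κ : ℝ}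

namespace IsCenteredLaw

variable (h : IsCenteredLaw ρ κ) (hX : ∀ i, HasLaw (X i) ρ P) (hind : iIndepFun X P)
include h hX hind

/-- Cauchy-Schwarz applied to `|D|³ = |D| · D²` interpolates between the second and the fourth
moment. -/
lemma integral_abs_inner_next_pow_three_le (k : ℕ) :
    ∫ ω, |⟪X k ω, partialSum (fun i => X i ω) k⟫| ^ 3 ∂P
      ≤ √(k * covEnergy ρ)
        * √(3 * k ^ 2 * (κ ^ 2 * ∫ x, ‖x‖ ^ 4 ∂ρ) + k * pairFourthMoment ρ) := by
  have hD := h.memLp_inner_next hX hind k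
  have h1 := integral_abs_mul_le_sqrt_mul_sqrt (hD.mono_exponent (by norm_num)) hD.sq_of_four
  rw [h.integral_inner_next_sq hX hind] at h1
  have e : ∀ x : ℝ, |x| * |x ^ 2| = |x| ^ 3 := fun x => by rw [abs_pow]; ring
  simp only [e, ← pow_mul] at h1
  refine h1.trans ?_
  gcongr
  exact h.integral_inner_next_pow_four_le hX hind k

/-- One martingale step. The three error terms are, in order: the fluctuation of the conditional
variance around `k V`, the third order Taylor remainder of the increment, and the replacement of `1
- s` by `exp(-s)` for `s = t² k V / 2`. -/
lemma norm_charFun_pairSum_step (t : ℝ) (k : ℕ) :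
    ‖∫ ω, Complex.exp (Complex.I * (t * pairSum (fun i => X i ω) (k + 1) : ℝ)) ∂P
        - Real.exp (-(t ^ 2 / 2 * (k * covEnergy ρ)))
          * ∫ ω, Complex.exp (Complex.I * (t * pairSum (fun i => X i ω) k : ℝ)) ∂P‖
      ≤ t ^ 2 / 2 * √(4 * k ^ 2 * κ ^ 2 * covEnergy ρ + 2 * k * κ ^ 2 * ∫ x, ‖x‖ ^ 4 ∂ρ)
        + 4 * |t| ^ 3 * (√(k * covEnergy ρ)
          * √(3 * k ^ 2 * (κ ^ 2 * ∫ x, ‖x‖ ^ 4 ∂ρ) + k * pairFourthMoment ρ))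
        + (t ^ 2 / 2 * (k * covEnergy ρ)) ^ 2 := by
  have hV := h.energy_nonneg
  set V := covEnergy ρ with hVdef
  set s : ℝ := t ^ 2 / 2 * (k * V) with hs
  have hs0 : 0 ≤ s := by positivity
  set S : Ω → E := fun ω => partialSum (fun i => X i ω) k with hSdef
  set Q : Ω → ℝ := fun ω => pairSum (fun i => X i ω) k with hQdef
  set D : Ω → ℝ := fun ω => ⟪X k ω, S ω⟫ with hDdef
  have hS : MemLp S 4 P := h.memLp_partialSum hX k
  have hD : MemLp D 4 P := h.memLp_inner_next hX hind k
  have hQ : AEMeasurable Q P :=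
    (measurable_pairSum k).comp_aemeasurable (aemeasurable_pi_lambda _ fun i => (hX i).aemeasurable)
  have hpast : IndepFun (fun ω => (Q ω, S ω)) (X k) P := indepFun_past hind hX k
  have hpm : AEMeasurable (fun ω => (Q ω, S ω)) P := hQ.prodMk hS.1.aemeasurable
  set Z : Ω → ℂ := fun ω => Complex.exp (Complex.I * (t * Q ω : ℝ)) with hZ
  have hZm : AEStronglyMeasurable Z P := by
    have : Continuous fun x : ℝ => Complex.exp (Complex.I * (t * x : ℝ)) := by fun_prop
    exact (this.measurable.comp_aemeasurable hQ).aestronglyMeasurable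
  have hZn : ∀ ω, ‖Z ω‖ = 1 := fun ω => by
    simp only [hZ]; rw [mul_comm]; exact Complex.norm_exp_ofReal_mul_I _
  have hmul : ∀ {f : Ω → ℝ}, Integrable f P → Integrable (fun ω => Z ω * (f ω : ℂ)) P :=
    fun {f} hf => hf.ofReal.bdd_mul hZm (ae_of_all _ fun ω => (hZn ω).le)
  have hD1 : Integrable D P := hD.integrable (by norm_num)
  have hD2 : Integrable (fun ω => D ω ^ 2) P := hD.integrable_pow_of_four (by norm_num)
  have hq : MemLp (fun ω => ⟪covarianceOperator ρ (S ω), S ω⟫) 2 P := h.memLp_inner_self hS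
  have hR : MemLp (fun ω => ⟪covarianceOperator ρ (S ω), S ω⟫ - k * V) 2 P :=
    hq.sub (memLp_const _)
  -- `Z` depends on the past only, so averaging over the next observation annihilates the linear
  -- term and turns `D²` into the conditional variance `⟨C S, S⟩`.
  have hlin : ∫ ω, Z ω * (D ω : ℂ) ∂P = 0 := by
    have := hpast.integral_comp_pair hpm (hX k)
      (g := fun p x => Complex.exp (Complex.I * (t * p.1 : ℝ)) * ((⟪x, p.2⟫ : ℝ) : ℂ))
      (Continuous.stronglyMeasurable (by fun_prop)) (hmul hD1)
    refine this.trans (integral_eq_zero_of_ae (ae_of_all _ fun ω => ?_))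
    simp only [Pi.zero_apply]
    rw [integral_const_mul, integral_complex_ofReal]
    simp_rw [real_inner_comm (S ω)]
    rw [h.mean]; simp
  have hquad : ∫ ω, Z ω * ((D ω ^ 2 : ℝ) : ℂ) ∂P
      = ∫ ω, Z ω * ((⟪covarianceOperator ρ (S ω), S ω⟫ : ℝ) : ℂ) ∂P := by
    have := hpast.integral_comp_pair hpm (hX k)
      (g := fun p x => Complex.exp (Complex.I * (t * p.1 : ℝ)) * ((⟪x, p.2⟫ ^ 2 : ℝ) : ℂ))
      (Continuous.stronglyMeasurable (by fun_prop)) (hmul hD2)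
    refine this.trans (integral_congr_ae (ae_of_all _ fun ω => ?_))
    simp only
    rw [integral_const_mul, integral_complex_ofReal, h.inner_self_eq]
    simp_rw [real_inner_comm (S ω)]
    rfl
  set rem : Ω → ℂ := fun ω => Complex.exp (Complex.I * (t * D ω : ℝ))
    - (1 + Complex.I * (t * D ω : ℝ) - ((t * D ω : ℝ) : ℂ) ^ 2 / 2) with hrem
  have hremm : AEStronglyMeasurable rem P := by
    have : Continuous fun x : ℝ => Complex.exp (Complex.I * (t * x : ℝ))
      - (1 + Complex.I * (t * x : ℝ) - ((t * x : ℝ) : ℂ) ^ 2 / 2) := by fun_prop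
    exact this.comp_aestronglyMeasurable hD.1
  have hD3 : Integrable (fun ω => |D ω| ^ 3) P := by
    have := (hD.integrable_pow_of_four (p := 3) (by norm_num)).abs
    simpa only [abs_pow] using this
  have hremle : ∀ ω, ‖Z ω * rem ω‖ ≤ 4 * |t| ^ 3 * |D ω| ^ 3 := fun ω => by
    rw [norm_mul, hZn, one_mul]
    refine (norm_exp_I_mul_sub_taylor_le _).trans_eq ?_
    rw [abs_mul, mul_pow, mul_assoc]
  have hremi : Integrable (fun ω => Z ω * rem ω) P :=
    (hD3.const_mul (4 * |t| ^ 3)).mono' (hZm.mul hremm) (ae_of_all _ hremle)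
  have hZi : Integrable Z P := (integrable_const (1 : ℝ)).mono' hZm (ae_of_all _ fun ω => (hZn ω).le)
  have hdecomp : ∀ ω, Complex.exp (Complex.I * (t * pairSum (fun i => X i ω) (k + 1) : ℝ))
      = Z ω * rem ω + Complex.I * t * (Z ω * (D ω : ℂ))
        - (t : ℂ) ^ 2 / 2 * (Z ω * ((D ω ^ 2 : ℝ) : ℂ)) + Z ω := fun ω => by
    have e1 : pairSum (fun i => X i ω) (k + 1) = Q ω + D ω := pairSum_succ _ _
    have e2 : Complex.exp (Complex.I * (t * (Q ω + D ω) : ℝ))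
        = Z ω * Complex.exp (Complex.I * (t * D ω : ℝ)) := by
      simp only [hZ]; rw [← Complex.exp_add]; congr 1; push_cast; ring
    rw [e1, e2]
    simp only [hrem]; push_cast; ring
  have hI : ∫ ω, Complex.exp (Complex.I * (t * pairSum (fun i => X i ω) (k + 1) : ℝ)) ∂P
      = ∫ ω, Z ω * rem ω ∂P
        - (t : ℂ) ^ 2 / 2 * ∫ ω, Z ω * ((⟪covarianceOperator ρ (S ω), S ω⟫ : ℝ) : ℂ) ∂P
        + ∫ ω, Z ω ∂P := by
    have j1 : Integrable (fun ω => Z ω * rem ω + Complex.I * t * (Z ω * (D ω : ℂ))) P :=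
      hremi.add ((hmul hD1).const_mul _)
    have j2 : Integrable (fun ω => Z ω * rem ω + Complex.I * t * (Z ω * (D ω : ℂ))
        - (t : ℂ) ^ 2 / 2 * (Z ω * ((D ω ^ 2 : ℝ) : ℂ))) P := j1.sub ((hmul hD2).const_mul _)
    simp_rw [hdecomp]
    rw [integral_add j2 hZi, integral_sub j1 ((hmul hD2).const_mul _),
      integral_add hremi ((hmul hD1).const_mul _), integral_const_mul, integral_const_mul, hlin,
      hquad]
    ring
  have hR' : ∫ ω, Z ω * ((⟪covarianceOperator ρ (S ω), S ω⟫ - k * V : ℝ) : ℂ) ∂P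
      = ∫ ω, Z ω * ((⟪covarianceOperator ρ (S ω), S ω⟫ : ℝ) : ℂ) ∂P - (k * V) * ∫ ω, Z ω ∂P := by
    rw [← integral_const_mul, ← integral_sub (hmul (hq.integrable (by norm_num)))
      (hZi.const_mul _)]
    refine integral_congr_ae (ae_of_all _ fun ω => ?_)
    simp only; push_cast; ring
  have htotal : ∫ ω, Complex.exp (Complex.I * (t * pairSum (fun i => X i ω) (k + 1) : ℝ)) ∂P
        - Real.exp (-s) * ∫ ω, Z ω ∂P
      = ∫ ω, Z ω * rem ω ∂P
        - (t : ℂ) ^ 2 / 2 * ∫ ω, Z ω * ((⟪covarianceOperator ρ (S ω), S ω⟫ - k * V : ℝ) : ℂ) ∂P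
        - ((Real.exp (-s) - (1 - s) : ℝ) : ℂ) * ∫ ω, Z ω ∂P := by
    rw [hI, hR', hs]; push_cast; ring
  have b1 : ‖∫ ω, Z ω * rem ω ∂P‖ ≤ 4 * |t| ^ 3 * (√(k * V)
      * √(3 * k ^ 2 * (κ ^ 2 * ∫ x, ‖x‖ ^ 4 ∂ρ) + k * pairFourthMoment ρ)) := by
    refine (norm_integral_le_of_norm_le (hD3.const_mul (4 * |t| ^ 3)) (ae_of_all _ hremle)).trans ?_
    rw [integral_const_mul]
    gcongr
    exact h.integral_abs_inner_next_pow_three_le hX hind k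
  have b2 : ‖∫ ω, Z ω * ((⟪covarianceOperator ρ (S ω), S ω⟫ - k * V : ℝ) : ℂ) ∂P‖
      ≤ √(4 * k ^ 2 * κ ^ 2 * V + 2 * k * κ ^ 2 * ∫ x, ‖x‖ ^ 4 ∂ρ) := by
    refine (norm_integral_le_of_norm_le (hR.integrable (by norm_num)).abs
      (ae_of_all _ fun ω => ?_)).trans ((integral_abs_le_sqrt hR).trans ?_)
    · rw [norm_mul, hZn, one_mul, Complex.norm_real, Real.norm_eq_abs]
    · exact Real.sqrt_le_sqrt (h.integral_sq_inner_self_partialSum_sub_le hX hind k)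
  have b3 : ‖∫ ω, Z ω ∂P‖ ≤ 1 := by
    refine (norm_integral_le_integral_norm _).trans ?_
    simp [hZn]
  rw [htotal]
  refine (norm_sub_le _ _).trans (add_le_add ((norm_sub_le _ _).trans ?_) ?_)
  · rw [add_comm, norm_mul]
    refine add_le_add ?_ b1
    refine mul_le_mul (le_of_eq ?_) b2 (norm_nonneg _) (by positivity)
    simp
  · rw [norm_mul, Complex.norm_real, Real.norm_eq_abs]
    exact (mul_le_mul (abs_exp_neg_sub_le hs0) b3 (norm_nonneg _) (by positivity)).trans_eq
      (mul_one _)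

/-- The one-step errors add up: each later step multiplies the accumulated error by `exp(-t² k V /
2) ≤ 1`, and every one-step error with `k ≤ n` is bounded by the expression at `k = n`. -/
lemma norm_charFun_pairSum_sub_le (t : ℝ) (n : ℕ) :
    ‖∫ ω, Complex.exp (Complex.I * (t * pairSum (fun i => X i ω) n : ℝ)) ∂P
        - Real.exp (-(t ^ 2 / 2 * ((∑ k ∈ Finset.range n, (k : ℝ)) * covEnergy ρ)))‖
      ≤ n * (t ^ 2 / 2 * √(4 * n ^ 2 * κ ^ 2 * covEnergy ρ + 2 * n * κ ^ 2 * ∫ x, ‖x‖ ^ 4 ∂ρ)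
        + 4 * |t| ^ 3 * (√(n * covEnergy ρ)
          * √(3 * n ^ 2 * (κ ^ 2 * ∫ x, ‖x‖ ^ 4 ∂ρ) + n * pairFourthMoment ρ))
        + (t ^ 2 / 2 * (n * covEnergy ρ)) ^ 2) := by
  have hV := h.energy_nonneg
  have hL := pairFourthMoment_nonneg (ρ := ρ)
  have hM : 0 ≤ ∫ x, ‖x‖ ^ 4 ∂ρ := integral_nonneg fun x => by positivity
  set B := t ^ 2 / 2 * √(4 * n ^ 2 * κ ^ 2 * covEnergy ρ + 2 * n * κ ^ 2 * ∫ x, ‖x‖ ^ 4 ∂ρ)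
        + 4 * |t| ^ 3 * (√(n * covEnergy ρ)
          * √(3 * n ^ 2 * (κ ^ 2 * ∫ x, ‖x‖ ^ 4 ∂ρ) + n * pairFourthMoment ρ))
        + (t ^ 2 / 2 * (n * covEnergy ρ)) ^ 2 with hB
  suffices H : ∀ k ≤ n, ‖∫ ω, Complex.exp (Complex.I * (t * pairSum (fun i => X i ω) k : ℝ)) ∂P
        - Real.exp (-(t ^ 2 / 2 * ((∑ j ∈ Finset.range k, (j : ℝ)) * covEnergy ρ)))‖ ≤ k * B from
    H n le_rfl
  intro k
  induction k with
  | zero => intro _; simp [pairSum_zero]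
  | succ k ih =>
    intro hk
    have hkn : (k : ℝ) ≤ n := by exact_mod_cast (Nat.lt_of_succ_le hk).le
    have step := h.norm_charFun_pairSum_step hX hind t k
    have stepB := step.trans (b := _) (c := B) (by rw [hB]; gcongr)
    have ih := ih (by omega)
    set a := ∫ ω, Complex.exp (Complex.I * (t * pairSum (fun i => X i ω) k : ℝ)) ∂P
    set a' := ∫ ω, Complex.exp (Complex.I * (t * pairSum (fun i => X i ω) (k + 1) : ℝ)) ∂P
    have e : Real.exp (-(t ^ 2 / 2 * ((∑ j ∈ Finset.range (k + 1), (j : ℝ)) * covEnergy ρ)))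
        = Real.exp (-(t ^ 2 / 2 * (k * covEnergy ρ)))
          * Real.exp (-(t ^ 2 / 2 * ((∑ j ∈ Finset.range k, (j : ℝ)) * covEnergy ρ))) := by
      rw [← Real.exp_add, Finset.sum_range_succ]; congr 1; ring
    set w := Real.exp (-(t ^ 2 / 2 * (k * covEnergy ρ)))
    set b := Real.exp (-(t ^ 2 / 2 * ((∑ j ∈ Finset.range k, (j : ℝ)) * covEnergy ρ)))
    have hw : w ≤ 1 := Real.exp_le_one_iff.2 (by have : (0:ℝ) ≤ k := k.cast_nonneg; simp; positivity)
    have hw0 : 0 ≤ w := (Real.exp_pos _).le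
    rw [e]
    have : a' - ((w * b : ℝ) : ℂ) = (a' - w * a) + w * (a - b) := by push_cast; ring
    rw [this]
    refine (norm_add_le _ _).trans ?_
    rw [norm_mul, Complex.norm_real, Real.norm_of_nonneg hw0]
    have h3 : w * ‖a - b‖ ≤ k * B := (mul_le_of_le_one_left (norm_nonneg _) hw).trans ih
    push_cast
    linarith

end IsCenteredLaw

end QuadraticFormCharFun

/-! ### The central limit theorem for the sum over pairs. -/

section QuadraticFormCLT

variable {Ω : Type*} [MeasurableSpace Ω] {P : Measure Ω} [IsProbabilityMeasure P]

local notation "⟪" x ", " y "⟫" => inner ℝ x y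

/-- Since `0 + 1 + ⋯ + (n - 1) = n(n - 1)/2`, the scaling `√2 / (n √V)` gives variance `1 - 1/n`.
The leading error is of order `κ / √V`: the ratio `tr(C⁴) / tr(C²)²` familiar from such limit
theorems is replaced by its bound `κ² / V`. -/
lemma IsCenteredLaw.norm_charFun_scaled_pairSum_sub_le {E : Type*} [NormedAddCommGroup E]
    [InnerProductSpace ℝ E] [CompleteSpace E]
    [MeasurableSpace E] [BorelSpace E] [SecondCountableTopology E]
    {X : ℕ → Ω → E} {ρ : Measure E} [IsProbabilityMeasure ρ] {κ : ℝ}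
    (h : IsCenteredLaw ρ κ) (hX : ∀ i, HasLaw (X i) ρ P) (hind : iIndepFun X P)
    (t : ℝ) {n : ℕ} (hn : 0 < n) (hV : 0 < covEnergy ρ) :
    ‖∫ ω, Complex.exp (Complex.I *
          (t * (√2 / (n * √(covEnergy ρ)) * pairSum (fun i => X i ω) n) : ℝ)) ∂P
        - Real.exp (-(t ^ 2 / 2 * (1 - 1 / n)))‖
      ≤ t ^ 2 * √(4 * κ ^ 2 / covEnergy ρ
          + 2 * κ ^ 2 * ((∫ x, ‖x‖ ^ 4 ∂ρ) / n) / covEnergy ρ ^ 2)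
        + 4 * |t| ^ 3 * (√2) ^ 3 * √(3 * κ ^ 2 * ((∫ x, ‖x‖ ^ 4 ∂ρ) / n) / covEnergy ρ ^ 2
          + (pairFourthMoment ρ / n ^ 2) / covEnergy ρ ^ 2)
        + t ^ 4 * (1 / n) := by
  set V := covEnergy ρ with hVdef
  set M := ∫ x, ‖x‖ ^ 4 ∂ρ with hM
  set K := pairFourthMoment ρ with hK
  have hM0 : 0 ≤ M := integral_nonneg fun x => by positivity
  have hK0 : 0 ≤ K := pairFourthMoment_nonneg
  have hnpos : (0 : ℝ) < n := by exact_mod_cast hn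
  have hsV : 0 < √V := Real.sqrt_pos.2 hV
  have hsV2 : √V ^ 2 = V := Real.sq_sqrt hV.le
  have h2 : √2 ^ 2 = (2 : ℝ) := Real.sq_sqrt (by norm_num)
  have main := h.norm_charFun_pairSum_sub_le hX hind (t * (√2 / (n * √V))) n
  rw [← hVdef, ← hM, ← hK] at main
  have ht2 : (t * (√2 / (n * √V))) ^ 2 = 2 * t ^ 2 / (n ^ 2 * V) := by
    rw [mul_pow, div_pow, mul_pow, h2, hsV2]; ring
  have hsum : (∑ k ∈ Finset.range n, (k : ℝ)) = n * (n - 1) / 2 := by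
    have := Finset.sum_range_id_mul_two n
    have h' : ((∑ k ∈ Finset.range n, (k : ℝ)) * 2) = n * (n - 1) := by
      rw [← Nat.cast_pred hn, ← Nat.cast_sum]; exact_mod_cast this
    linarith
  have hexp : (t * (√2 / (n * √V))) ^ 2 / 2 * ((∑ k ∈ Finset.range n, (k : ℝ)) * V)
      = t ^ 2 / 2 * (1 - 1 / n) := by
    rw [ht2, hsum]; field_simp
  rw [hexp] at main
  simp only [mul_assoc t] at main
  refine main.trans (le_of_eq ?_)
  have e1 : √(4 * n ^ 2 * κ ^ 2 * V + 2 * n * κ ^ 2 * M)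
      = (n * V) * √(4 * κ ^ 2 / V + 2 * κ ^ 2 * (M / n) / V ^ 2) := by
    rw [← Real.sqrt_sq (by positivity : 0 ≤ n * V), ← Real.sqrt_mul (by positivity)]
    congr 1; field_simp
  have e2 : √(n * V) * √(3 * n ^ 2 * (κ ^ 2 * M) + n * K)
      = (n ^ 2 * √V ^ 3) * √(3 * κ ^ 2 * (M / n) / V ^ 2 + (K / n ^ 2) / V ^ 2) := by
    rw [← Real.sqrt_mul (by positivity), ← Real.sqrt_sq (by positivity : 0 ≤ n ^ 2 * √V ^ 3),
      ← Real.sqrt_mul (by positivity)]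
    congr 1
    have : (n ^ 2 * √V ^ 3) ^ 2 = (n : ℝ) ^ 4 * V ^ 3 := by
      rw [mul_pow, ← pow_mul, ← pow_mul, show 3 * 2 = 2 * 3 from rfl, pow_mul √V, hsV2]
    rw [this]; field_simp
  have e3 : |t * (√2 / (n * √V))| ^ 3 = |t| ^ 3 * √2 ^ 3 / (n ^ 3 * √V ^ 3) := by
    rw [abs_mul, abs_of_nonneg (by positivity : 0 ≤ √2 / (n * √V)), mul_pow, div_pow, mul_pow]
    ring
  rw [e1, e2, e3, ht2]
  set r1 := √(4 * κ ^ 2 / V + 2 * κ ^ 2 * (M / n) / V ^ 2)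
  set r2 := √(3 * κ ^ 2 * (M / n) / V ^ 2 + (K / n ^ 2) / V ^ 2)
  field_simp

/-- The central limit theorem for degenerate quadratic forms in triangular arrays of i.i.d.
random vectors of growing dimension. -/
theorem tendstoInDistribution_pairSum {E : ℕ → Type*} [∀ n, NormedAddCommGroup (E n)]
    [∀ n, InnerProductSpace ℝ (E n)] [∀ n, CompleteSpace (E n)]
    [∀ n, MeasurableSpace (E n)] [∀ n, BorelSpace (E n)] [∀ n, SecondCountableTopology (E n)]
    {X : ∀ n, ℕ → Ω → E n} {ρ : ∀ n, Measure (E n)} [∀ n, IsProbabilityMeasure (ρ n)] {κ : ℝ}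
    (h : ∀ n, IsCenteredLaw (ρ n) κ) (hX : ∀ n i, HasLaw (X n i) (ρ n) P)
    (hind : ∀ n, iIndepFun (X n) P)
    (hV : Tendsto (fun n => covEnergy (ρ n)) atTop atTop)
    (hM : Tendsto (fun n : ℕ => (∫ x, ‖x‖ ^ 4 ∂(ρ n)) / n) atTop (𝓝 0))
    (hK : Tendsto (fun n : ℕ => pairFourthMoment (ρ n) / (n : ℝ) ^ 2) atTop (𝓝 0)) :
    TendstoInDistribution
      (fun (n : ℕ) ω => √2 / (n * √(covEnergy (ρ n))) * pairSum (fun i => X n i ω) n)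
      atTop (id : ℝ → ℝ) (fun _ => P) (gaussianReal 0 1) := by
  have hmeas : ∀ n : ℕ, AEMeasurable
      (fun ω => √2 / (n * √(covEnergy (ρ n))) * pairSum (fun i => X n i ω) n) P := fun n =>
    ((measurable_pairSum n).comp_aemeasurable
      (aemeasurable_pi_lambda _ fun i => (hX n i).aemeasurable)).const_mul _
  refine ⟨hmeas, aemeasurable_id, ProbabilityMeasure.tendsto_iff_tendsto_charFun.2 fun t => ?_⟩
  simp only [ProbabilityMeasure.coe_mk, Measure.map_id, charFun_gaussianReal]
  have hlim : (Complex.exp (t * (0 : ℝ) * Complex.I - (1 : NNReal) * t ^ 2 / 2))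
      = ((Real.exp (-(t ^ 2 / 2 * (1 - 0))) : ℝ) : ℂ) := by
    push_cast; congr 1; simp
  have hinvV := hV.inv_tendsto_atTop
  have hinv : Tendsto (fun n : ℕ => 1 / (n : ℝ)) atTop (𝓝 0) := tendsto_one_div_atTop_nhds_zero_nat
  have hexp : Tendsto (fun n : ℕ => ((Real.exp (-(t ^ 2 / 2 * (1 - 1 / n))) : ℝ) : ℂ)) atTop
      (𝓝 ((Real.exp (-(t ^ 2 / 2 * (1 - 0))) : ℝ) : ℂ)) := by
    refine (Complex.continuous_ofReal.tendsto _).comp ((Real.continuous_exp.tendsto _).comp ?_)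
    exact (((tendsto_const_nhds.sub hinv)).const_mul _).neg
  have hinvV2 : Tendsto (fun n => (covEnergy (ρ n) ^ 2)⁻¹) atTop (𝓝 0) := by
    simpa using hinvV.pow 2
  have herr : Tendsto (fun n : ℕ => t ^ 2 * √(4 * κ ^ 2 / covEnergy (ρ n)
          + 2 * κ ^ 2 * ((∫ x, ‖x‖ ^ 4 ∂(ρ n)) / n) / covEnergy (ρ n) ^ 2)
        + 4 * |t| ^ 3 * (√2) ^ 3 *
          √(3 * κ ^ 2 * ((∫ x, ‖x‖ ^ 4 ∂(ρ n)) / n) / covEnergy (ρ n) ^ 2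
          + (pairFourthMoment (ρ n) / n ^ 2) / covEnergy (ρ n) ^ 2)
        + t ^ 4 * (1 / n)) atTop (𝓝 0) := by
    have a1 : Tendsto (fun n : ℕ => 4 * κ ^ 2 / covEnergy (ρ n)
          + 2 * κ ^ 2 * ((∫ x, ‖x‖ ^ 4 ∂(ρ n)) / n) / covEnergy (ρ n) ^ 2) atTop (𝓝 0) := by
      simpa [div_eq_mul_inv] using
        (hinvV.const_mul (4 * κ ^ 2)).add ((hM.const_mul (2 * κ ^ 2)).mul hinvV2)
    have a2 : Tendsto (fun n : ℕ => 3 * κ ^ 2 * ((∫ x, ‖x‖ ^ 4 ∂(ρ n)) / n) / covEnergy (ρ n) ^ 2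
          + (pairFourthMoment (ρ n) / n ^ 2) / covEnergy (ρ n) ^ 2) atTop (𝓝 0) := by
      simpa [div_eq_mul_inv] using
        ((hM.const_mul (3 * κ ^ 2)).mul hinvV2).add (hK.mul hinvV2)
    simpa using ((a1.sqrt.const_mul (t ^ 2)).add
      (a2.sqrt.const_mul (4 * |t| ^ 3 * (√2) ^ 3))).add (hinv.const_mul (t ^ 4))
  rw [hlim]
  rw [tendsto_iff_norm_sub_tendsto_zero]
  have hexp' := tendsto_iff_norm_sub_tendsto_zero.1 hexp
  refine squeeze_zero' (Eventually.of_forall fun n => norm_nonneg _) ?_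
    (by simpa only [add_zero] using herr.add hexp')
  filter_upwards [eventually_gt_atTop 0, hV.eventually_gt_atTop 0] with n hn hVn
  have key := (h n).norm_charFun_scaled_pairSum_sub_le (hX n) (hind n) t hn hVn
  have e : charFun (P.map fun ω => √2 / (n * √(covEnergy (ρ n))) * pairSum (fun i => X n i ω) n) t
      = ∫ ω, Complex.exp (Complex.I *
          (t * (√2 / (n * √(covEnergy (ρ n))) * pairSum (fun i => X n i ω) n) : ℝ)) ∂P := by
    rw [charFun_apply_real, integral_map (hmeas n)
      (Continuous.aestronglyMeasurable (by fun_prop))]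
    refine integral_congr_ae (ae_of_all _ fun ω => ?_)
    simp only; congr 1; push_cast; ring
  rw [e]
  exact (norm_sub_le_norm_sub_add_norm_sub _ _ _).trans (add_le_add key le_rfl)

end QuadraticFormCLT

/-! ### Second moments of sums of i.i.d. Hilbert space valued variables. -/

section IIDSums

variable {Ω 𝓧 : Type*} [MeasurableSpace Ω] [MeasurableSpace 𝓧] {P : Measure Ω}
  [IsProbabilityMeasure P]
  {E : Type*} [NormedAddCommGroup E] [InnerProductSpace ℝ E] [CompleteSpace E]
  [MeasurableSpace E] [BorelSpace E] [SecondCountableTopology E]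

local notation "⟪" x ", " y "⟫" => inner ℝ x y

lemma integral_norm_partialSum_sq {X : ℕ → Ω → E} {ρ : Measure E} [IsProbabilityMeasure ρ]
    (hX : ∀ i, HasLaw (X i) ρ P) (hind : iIndepFun X P) (h2 : MemLp id 2 ρ)
    (hmean : ∀ s : E, ∫ x, ⟪s, x⟫ ∂ρ = 0) (n : ℕ) :
    ∫ ω, ‖partialSum (fun i => X i ω) n‖ ^ 2 ∂P = n * ∫ x, ‖x‖ ^ 2 ∂ρ := by
  have hXm : ∀ i, MemLp (X i) 2 P := fun i => by
    have := h2
    rw [← (hX i).map_eq, memLp_map_measure_iff (by fun_prop) (hX i).aemeasurable] at this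
    exact this
  have hS : ∀ k, MemLp (fun ω => partialSum (fun i => X i ω) k) 2 P := fun k =>
    memLp_finsetSum _ fun i _ => hXm i
  have hn2 : Integrable (fun x : E => ‖x‖ ^ 2) ρ := h2.norm.integrable_sq
  induction n with
  | zero => simp [partialSum_zero]
  | succ k ih =>
    have hint : Integrable (fun ω => ‖partialSum (fun i => X i ω) (k + 1)‖ ^ 2) P :=
      (hS (k + 1)).norm.integrable_sq
    have hk : Integrable (fun ω => ‖partialSum (fun i => X i ω) k‖ ^ 2) P :=
      (hS k).norm.integrable_sq
    simp only [partialSum_succ] at hint ⊢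
    rw [(indepFun_partialSum hind hX k).integral_comp_pair (hS k).1.aemeasurable (hX k)
      (g := fun s x => ‖s + x‖ ^ 2) (Continuous.stronglyMeasurable (by fun_prop)) hint]
    have key : ∀ s : E, ∫ x, ‖s + x‖ ^ 2 ∂ρ = ‖s‖ ^ 2 + ∫ x, ‖x‖ ^ 2 ∂ρ := fun s => by
      have i1 : Integrable (fun x => 2 * ⟪s, x⟫) ρ :=
        ((h2.const_inner s).integrable (by norm_num)).const_mul 2
      have i2 : Integrable (fun x => ‖s‖ ^ 2 + 2 * ⟪s, x⟫) ρ := (integrable_const _).add i1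
      simp_rw [norm_add_sq_real]
      rw [integral_add i2 hn2, integral_add (integrable_const _) i1, integral_const_mul, hmean]
      simp
    simp_rw [key]
    rw [integral_add hk (integrable_const _), ih]
    simp; ring

variable {ξ : ℕ → Ω → 𝓧} {Λ : Measure 𝓧} [IsProbabilityMeasure Λ]

lemma integral_norm_sum_sq (hξ : ∀ i, HasLaw (ξ i) Λ P) (hind : iIndepFun ξ P) {g : 𝓧 → E}
    (hg : Measurable g) (h2 : MemLp g 2 Λ) (hmean : ∀ s : E, ∫ x, ⟪s, g x⟫ ∂Λ = 0) (n : ℕ) :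
    ∫ ω, ‖∑ i ∈ Finset.range n, g (ξ i ω)‖ ^ 2 ∂P = n * ∫ x, ‖g x‖ ^ 2 ∂Λ := by
  have := Measure.isProbabilityMeasure_map (μ := Λ) hg.aemeasurable
  have hlaw : ∀ i, HasLaw (fun ω => g (ξ i ω)) (Λ.map g) P := fun i =>
    HasLaw.fun_comp ⟨hg.aemeasurable, rfl⟩ (hξ i)
  have h := integral_norm_partialSum_sq hlaw (hind.comp (fun _ => g) fun _ => hg)
    ((memLp_map_measure_iff (by fun_prop) hg.aemeasurable).2 h2)
    (fun s => by
      rw [integral_map hg.aemeasurable (Continuous.aestronglyMeasurable (by fun_prop))]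
      exact hmean s) n
  rw [integral_map hg.aemeasurable (Continuous.aestronglyMeasurable (by fun_prop))] at h
  exact h

lemma memLp_comp_of_hasLaw {F : Type*} [NormedAddCommGroup F] {p : ℝ≥0∞} {V : Ω → 𝓧}
    (hV : HasLaw V Λ P) {g : 𝓧 → F} (h : MemLp g p Λ) : MemLp (fun ω => g (V ω)) p P := by
  rw [← hV.map_eq] at h
  exact h.comp_of_map hV.aemeasurable

lemma memLp_sum_comp {F : Type*} [NormedAddCommGroup F] (hξ : ∀ i, HasLaw (ξ i) Λ P) {p : ℝ≥0∞}
    {g : 𝓧 → F} (h2 : MemLp g p Λ) (n : ℕ) :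
    MemLp (fun ω => ∑ i ∈ Finset.range n, g (ξ i ω)) p P :=
  memLp_finsetSum _ fun i _ => memLp_comp_of_hasLaw (hξ i) h2

/-- Independent centered terms are orthogonal in `L²`, and the variance of one term is at most its
second moment. -/
lemma integral_norm_sum_sub_sq_le (hξ : ∀ i, HasLaw (ξ i) Λ P) (hind : iIndepFun ξ P) {g : 𝓧 → E}
    (hg : Measurable g) (h2 : MemLp g 2 Λ) (n : ℕ) :
    ∫ ω, ‖∑ i ∈ Finset.range n, g (ξ i ω) - (n : ℝ) • ∫ x, g x ∂Λ‖ ^ 2 ∂P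
      ≤ n * ∫ x, ‖g x‖ ^ 2 ∂Λ := by
  set c := ∫ x, g x ∂Λ with hc
  have hgi : Integrable g Λ := h2.integrable (by norm_num)
  have hmean : ∀ s : E, ∫ x, ⟪s, g x - c⟫ ∂Λ = 0 := fun s => by
    have hsub : Integrable (fun x => g x - c) Λ := hgi.sub (integrable_const _)
    rw [integral_inner hsub s, integral_sub hgi (integrable_const _)]
    simp [hc]
  have h := integral_norm_sum_sq hξ hind (hg.sub_const c) (h2.sub (memLp_const c)) hmean n
  have e : ∀ ω, ∑ i ∈ Finset.range n, (g (ξ i ω) - c)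
      = ∑ i ∈ Finset.range n, g (ξ i ω) - (n : ℝ) • c := fun ω => by
    rw [Finset.sum_sub_distrib]; simp [Nat.cast_smul_eq_nsmul]
  simp only [e] at h
  rw [h]
  refine mul_le_mul_of_nonneg_left ?_ (Nat.cast_nonneg _)
  have i1 : Integrable (fun x => 2 * ⟪c, g x - c⟫) Λ :=
    (((h2.sub (memLp_const c)).const_inner c).integrable (by norm_num)).const_mul 2
  have i2 : Integrable (fun x => ‖g x - c‖ ^ 2) Λ := (h2.sub (memLp_const c)).norm.integrable_sq
  have i3 : Integrable (fun x => ‖c‖ ^ 2 + 2 * ⟪c, g x - c⟫) Λ := (integrable_const _).add i1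
  have e2 : ∀ x, ‖g x‖ ^ 2 = ‖c‖ ^ 2 + 2 * ⟪c, g x - c⟫ + ‖g x - c‖ ^ 2 := fun x => by
    rw [← norm_add_sq_real]; simp
  simp_rw [e2]
  rw [integral_add i3 i2, integral_add (integrable_const _) i1, integral_const_mul, hmean]
  simp

end IIDSums

/-! ### Rank one matrices as vectors carrying the Frobenius norm. -/

section CrossMoments

variable {ι₁ ι₂ : Type*} [Fintype ι₁] [Fintype ι₂]

local notation "⟪" x ", " y "⟫" => inner ℝ x y

/-- The matrix `p qᵗ`, as a vector of its entries. -/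
noncomputable def outerVec (p : EuclideanSpace ℝ ι₁) (q : EuclideanSpace ℝ ι₂) :
    EuclideanSpace ℝ (ι₁ × ι₂) := WithLp.toLp 2 fun a => p a.1 * q a.2

lemma norm_outerVec (p : EuclideanSpace ℝ ι₁) (q : EuclideanSpace ℝ ι₂) :
    ‖outerVec p q‖ = ‖p‖ * ‖q‖ := by
  rw [← Real.sqrt_sq (norm_nonneg (outerVec p q)), ← Real.sqrt_sq (norm_nonneg p),
    ← Real.sqrt_sq (norm_nonneg q), ← Real.sqrt_mul (sq_nonneg _)]
  congr 1
  simp only [EuclideanSpace.real_norm_sq_eq, outerVec, mul_pow, Fintype.sum_prod_type,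
    Finset.sum_mul_sum]

lemma inner_outerVec_outerVec (x p : EuclideanSpace ℝ ι₁) (y q : EuclideanSpace ℝ ι₂) :
    ⟪outerVec x y, outerVec p q⟫ = ⟪x, p⟫ * ⟪y, q⟫ := by
  simp only [PiLp.inner_apply, outerVec, Fintype.sum_prod_type, Finset.sum_mul_sum]
  refine Finset.sum_congr rfl fun i _ => Finset.sum_congr rfl fun j _ => ?_
  simp; ring

lemma measurable_outerVec {𝓧 : Type*} [MeasurableSpace 𝓧] {p : 𝓧 → EuclideanSpace ℝ ι₁}
    {q : 𝓧 → EuclideanSpace ℝ ι₂} (hp : Measurable p) (hq : Measurable q) :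
    Measurable fun x => outerVec (p x) (q x) := by
  have : Continuous fun a : EuclideanSpace ℝ ι₁ × EuclideanSpace ℝ ι₂ => outerVec a.1 a.2 := by
    unfold outerVec; fun_prop
  exact this.measurable.comp (hp.prodMk hq)

end CrossMoments

/-! ### Algebra of the replacement of errors by residuals, for a fixed sample. -/

section DeterministicRemainder

variable {E H : Type*} [NormedAddCommGroup E] [InnerProductSpace ℝ E] [CompleteSpace E]
  [NormedAddCommGroup H] [InnerProductSpace ℝ H] [CompleteSpace H]

local notation "⟪" x ", " y "⟫" => inner ℝ x y

/-- The map `v ↦ ∑ v_i F_i` is the adjoint of `x ↦ (⟨F_i, x⟩)_i`, hence has the same norm, at most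
`√β`. -/
lemma norm_sum_smul_sq_le {s : Finset ℕ} {v : ℕ → ℝ} {F : ℕ → H} {β : ℝ} (hβ : 0 ≤ β)
    (hF : ∀ x, ∑ i ∈ s, ⟪F i, x⟫ ^ 2 ≤ β * ‖x‖ ^ 2) :
    ‖∑ i ∈ s, v i • F i‖ ^ 2 ≤ β * ∑ i ∈ s, v i ^ 2 := by
  set w := ∑ i ∈ s, v i • F i with hw
  have h1 : ‖w‖ ^ 2 = ∑ i ∈ s, v i * ⟪F i, w⟫ := by
    rw [← real_inner_self_eq_norm_sq]
    nth_rewrite 1 [hw]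
    simp [sum_inner, real_inner_smul_left]
  have h2 : (‖w‖ ^ 2) ^ 2 ≤ (β * ∑ i ∈ s, v i ^ 2) * ‖w‖ ^ 2 := by
    calc (‖w‖ ^ 2) ^ 2 ≤ (∑ i ∈ s, v i ^ 2) * ∑ i ∈ s, ⟪F i, w⟫ ^ 2 := by
          rw [h1]; exact Finset.sum_mul_sq_le_sq_mul_sq _ _ _
      _ ≤ (∑ i ∈ s, v i ^ 2) * (β * ‖w‖ ^ 2) :=
          mul_le_mul_of_nonneg_left (hF w) (Finset.sum_nonneg fun _ _ => sq_nonneg _)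
      _ = _ := by ring
  have h3 : 0 ≤ ∑ i ∈ s, v i ^ 2 := Finset.sum_nonneg fun _ _ => sq_nonneg _
  rcases (sq_nonneg ‖w‖).eq_or_lt with h0 | h0
  · rw [← h0]; positivity
  · exact le_of_mul_le_mul_right (by rw [← sq]; exact h2) h0

lemma two_mul_le_sq_mul_add_sq_div {x y d : ℝ} (hd : 0 < d) :
    2 * |x * y| ≤ d ^ 2 * x ^ 2 + y ^ 2 / d ^ 2 := by
  have h := two_mul_le_add_sq (d * |x|) (|y| / d)
  have e : 2 * (d * |x|) * (|y| / d) = 2 * |x * y| := by rw [abs_mul]; field_simp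
  rw [e, mul_pow, div_pow, sq_abs, sq_abs] at h
  exact h

/-- Replacing errors by least squares residuals changes the quadratic form only by terms that are
quadratic in the sample moments. -/
lemma abs_quadratic_remainder_le {n : ℕ} (hn : 0 < n) {u r : ℕ → ℝ} {F : ℕ → H} {e : ℕ → E}
    {θ : E} {A : E →L[ℝ] H} {a : H} {B c d δ : ℝ} (hB : 0 ≤ B) (hc : 0 < c) (hd : 0 < d)
    (hF : ∀ x, ∑ i ∈ Finset.range n, ⟪F i, x⟫ ^ 2 ≤ n * B * ‖x‖ ^ 2)
    (he : ∀ x, n * c * ‖x‖ ^ 2 ≤ ∑ i ∈ Finset.range n, ⟪e i, x⟫ ^ 2)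
    (hA : ∀ x y, |∑ i ∈ Finset.range n, ⟪F i, y⟫ * ⟪e i, x⟫ - n * ⟪A x, y⟫|
      ≤ n * d * (‖x‖ * ‖y‖))
    (hr : ∀ i < n, r i ^ 2 ≤ δ)
    (hθ : ∑ i ∈ Finset.range n, (u i + r i - ⟪e i, θ⟫) • e i = 0) :
    |(n : ℝ)⁻¹ * ‖∑ i ∈ Finset.range n, (u i + r i - ⟪e i, θ⟫) • F i‖ ^ 2
        - (n : ℝ)⁻¹ * ‖∑ i ∈ Finset.range n, u i • F i‖ ^ 2|
      ≤ 1 + ⟪a, ∑ i ∈ Finset.range n, u i • F i⟫ ^ 2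
        + 2 * d ^ 2 * (‖∑ i ∈ Finset.range n, u i • F i‖ ^ 2 / n)
        + ‖∑ i ∈ Finset.range n, r i • F i - (n : ℝ) • a‖ ^ 2 / n / d ^ 2
        + ‖A.adjoint (∑ i ∈ Finset.range n, u i • F i)‖ ^ 2 / n
        + (4 / c ^ 2 + 4 * B / c) * (‖∑ i ∈ Finset.range n, u i • e i‖ ^ 2 / n)
        + (4 / c + 6 * B) * (n * δ) := by
  have hn0 : (0 : ℝ) < n := by exact_mod_cast hn
  set s := Finset.range n with hs
  set N := ∑ i ∈ s, u i • F i with hN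
  set R := ∑ i ∈ s, r i • F i - (n : ℝ) • a with hR
  set v : ℕ → ℝ := fun i => r i - ⟪e i, θ⟫ with hv
  set w := ∑ i ∈ s, v i • F i with hw
  set G := ∑ i ∈ s, ⟪e i, θ⟫ ^ 2 with hG
  set q := ‖∑ i ∈ s, u i • e i‖ ^ 2 / n with hq
  set ρ := ∑ i ∈ s, r i ^ 2 with hρ
  have hG0 : 0 ≤ G := Finset.sum_nonneg fun _ _ => sq_nonneg _
  have hρ0 : 0 ≤ ρ := Finset.sum_nonneg fun _ _ => sq_nonneg _
  have hρδ : ρ ≤ n * δ := by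
    have := Finset.sum_le_card_nsmul s (fun i => r i ^ 2) δ fun i hi =>
      hr i (Finset.mem_range.1 hi)
    simpa [hs] using this
  -- The normal equations are tested against `θ`. The two terms on the right are then each bounded
  -- by `G / 4` plus an error, so that half of `G` can be absorbed on the left.
  have hGeq : G = ⟪θ, ∑ i ∈ s, u i • e i⟫ + ∑ i ∈ s, ⟪e i, θ⟫ * r i := by
    have h := congrArg (fun x => ⟪x, θ⟫) hθ
    simp only [sum_inner, real_inner_smul_left, inner_zero_left] at h
    have h2 : ⟪θ, ∑ i ∈ s, u i • e i⟫ = ∑ i ∈ s, u i * ⟪e i, θ⟫ := by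
      rw [real_inner_comm]; simp [sum_inner, real_inner_smul_left]
    rw [h2, ← Finset.sum_add_distrib, hG, ← sub_eq_zero, ← Finset.sum_sub_distrib,
      ← neg_eq_zero, ← Finset.sum_neg_distrib, ← h]
    exact Finset.sum_congr rfl fun i _ => by ring
  have hθG : n * c * ‖θ‖ ^ 2 ≤ G := he θ
  have hG1 : ⟪θ, ∑ i ∈ s, u i • e i⟫ ≤ G / 4 + q / c := by
    have h1 : |⟪θ, ∑ i ∈ s, u i • e i⟫| ≤ ‖θ‖ * ‖∑ i ∈ s, u i • e i‖ := abs_real_inner_le_norm _ _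
    set y := ‖∑ i ∈ s, u i • e i‖ with hy
    have h2 : ‖θ‖ * y ≤ n * c * ‖θ‖ ^ 2 / 4 + y ^ 2 / (n * c) := by
      have h3 := two_mul_le_sq_mul_add_sq_div (x := ‖θ‖) (y := y) (d := √(n * c / 2))
        (by positivity)
      rw [Real.sq_sqrt (by positivity), abs_of_nonneg (by positivity)] at h3
      have e3 : y ^ 2 / (n * c / 2) = 2 * (y ^ 2 / (n * c)) := by field_simp
      rw [e3] at h3
      linarith
    have h4 : y ^ 2 / (n * c) = q / c := by rw [hq]; field_simp
    linarith [le_abs_self ⟪θ, ∑ i ∈ s, u i • e i⟫]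
  have hG2 : ∑ i ∈ s, ⟪e i, θ⟫ * r i ≤ G / 4 + ρ := by
    rw [hG, hρ, Finset.sum_div, ← Finset.sum_add_distrib]
    refine Finset.sum_le_sum fun i _ => ?_
    nlinarith [sq_nonneg (⟪e i, θ⟫ / 2 - r i)]
  have hGle : G ≤ 2 * (q / c) + 2 * (n * δ) := by linarith
  have hθle : n * ‖θ‖ ^ 2 ≤ (2 * (q / c) + 2 * (n * δ)) / c := by
    rw [le_div_iff₀ hc]; linarith
  have hv2 : ∑ i ∈ s, v i ^ 2 ≤ 2 * ρ + 2 * G := by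
    rw [hρ, hG, Finset.mul_sum, Finset.mul_sum, ← Finset.sum_add_distrib]
    refine Finset.sum_le_sum fun i _ => ?_
    simp only [hv]
    nlinarith [sq_nonneg (r i + ⟪e i, θ⟫)]
  have hw2 : ‖w‖ ^ 2 ≤ n * B * ∑ i ∈ s, v i ^ 2 := norm_sum_smul_sq_le (by positivity) hF
  have hw3 : (n : ℝ)⁻¹ * ‖w‖ ^ 2 ≤ B * (6 * (n * δ) + 4 * (q / c)) := by
    rw [inv_mul_le_iff₀ hn0]
    calc ‖w‖ ^ 2 ≤ n * B * (2 * ρ + 2 * G) := hw2.trans (by gcongr)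
      _ ≤ n * B * (6 * (n * δ) + 4 * (q / c)) :=
          mul_le_mul_of_nonneg_left (by linarith) (by positivity)
      _ = _ := by ring
  have hNw : ∑ i ∈ s, (u i + r i - ⟪e i, θ⟫) • F i = N + w := by
    rw [hN, hw, ← Finset.sum_add_distrib]
    refine Finset.sum_congr rfl fun i _ => ?_
    rw [← add_smul]; congr 1; simp only [hv]; ring
  -- The decisive splitting of the cross term: `a` and `A` stand for the means of `r F` and `F eᵗ`,
  -- and `R` and `D` for the fluctuations. Only the fluctuations are paired with the full norm of
  -- `N`.
  have hwN : ⟪N, w⟫ = n * ⟪a, N⟫ + ⟪N, R⟫ - ∑ i ∈ s, ⟪F i, N⟫ * ⟪e i, θ⟫ := by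
    have e1 : w = (n : ℝ) • a + R - ∑ i ∈ s, ⟪e i, θ⟫ • F i := by
      rw [hR, add_sub_cancel, ← Finset.sum_sub_distrib, hw]
      exact Finset.sum_congr rfl fun i _ => by rw [← sub_smul]
    rw [e1, inner_sub_right, inner_add_right, real_inner_smul_right, real_inner_comm a N]
    congr 1
    rw [inner_sum]
    refine Finset.sum_congr rfl fun i _ => ?_
    rw [real_inner_smul_right, real_inner_comm N (F i)]; ring
  set D := ∑ i ∈ s, ⟪F i, N⟫ * ⟪e i, θ⟫ - n * ⟪A θ, N⟫ with hD
  have hDle : |D| ≤ n * d * (‖θ‖ * ‖N‖) := hA θ N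
  have hAN : ⟪A θ, N⟫ = ⟪A.adjoint N, θ⟫ := by
    rw [ContinuousLinearMap.adjoint_inner_left, real_inner_comm]
  have hmain : (n : ℝ)⁻¹ * ‖∑ i ∈ s, (u i + r i - ⟪e i, θ⟫) • F i‖ ^ 2 - (n : ℝ)⁻¹ * ‖N‖ ^ 2
      = 2 * ⟪a, N⟫ + 2 * ⟪N, R⟫ / n - 2 * ⟪A.adjoint N, θ⟫ - 2 * D / n + (n : ℝ)⁻¹ * ‖w‖ ^ 2 := by
    rw [hNw, norm_add_sq_real, hwN]
    have : ∑ i ∈ s, ⟪F i, N⟫ * ⟪e i, θ⟫ = D + n * ⟪A.adjoint N, θ⟫ := by rw [hD, hAN]; ring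
    rw [this]; field_simp; ring
  have t1 : |2 * ⟪a, N⟫| ≤ 1 + ⟪a, N⟫ ^ 2 := by
    rw [abs_mul, abs_two, ← sq_abs]; nlinarith [sq_nonneg (|⟪a, N⟫| - 1)]
  -- Young's inequality with the free weight `d`, which is also the bound on the fluctuation of `F
  -- eᵗ` and is chosen later as `√(k / T)`.
  have t2 : |2 * ⟪N, R⟫ / n| ≤ d ^ 2 * (‖N‖ ^ 2 / n) + ‖R‖ ^ 2 / n / d ^ 2 := by
    have h1 := abs_real_inner_le_norm N R
    have h2 := two_mul_le_sq_mul_add_sq_div (x := ‖N‖) (y := ‖R‖) hd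
    rw [abs_of_nonneg (by positivity : 0 ≤ ‖N‖ * ‖R‖)] at h2
    rw [abs_div, abs_mul, abs_two, abs_of_pos hn0, div_le_iff₀ hn0]
    have e2 : (d ^ 2 * (‖N‖ ^ 2 / n) + ‖R‖ ^ 2 / n / d ^ 2) * n
        = d ^ 2 * ‖N‖ ^ 2 + ‖R‖ ^ 2 / d ^ 2 := by field_simp
    rw [e2]; linarith
  have t3 : |2 * ⟪A.adjoint N, θ⟫| ≤ ‖A.adjoint N‖ ^ 2 / n + n * ‖θ‖ ^ 2 := by
    have h1 := abs_real_inner_le_norm (A.adjoint N) θ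
    have h2 := two_mul_le_sq_mul_add_sq_div (x := ‖θ‖) (y := ‖A.adjoint N‖) (d := √n)
      (by positivity)
    rw [Real.sq_sqrt hn0.le, abs_of_nonneg (by positivity)] at h2
    rw [abs_mul, abs_two]; linarith
  have t4 : |2 * D / n| ≤ d ^ 2 * (‖N‖ ^ 2 / n) + n * ‖θ‖ ^ 2 := by
    have h2 := two_mul_le_sq_mul_add_sq_div (x := ‖θ‖) (y := d * ‖N‖) (d := √n) (by positivity)
    rw [Real.sq_sqrt hn0.le, abs_of_nonneg (by positivity)] at h2
    rw [abs_div, abs_mul, abs_two, abs_of_pos hn0, div_le_iff₀ hn0]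
    have e2 : (d ^ 2 * (‖N‖ ^ 2 / n) + n * ‖θ‖ ^ 2) * n
        = n * (n * ‖θ‖ ^ 2 + (d * ‖N‖) ^ 2 / n) := by field_simp; ring
    rw [e2]
    calc 2 * |D| ≤ 2 * (n * d * (‖θ‖ * ‖N‖)) := by gcongr
      _ = n * (2 * (‖θ‖ * (d * ‖N‖))) := by ring
      _ ≤ _ := by gcongr
  have t5 : |(n : ℝ)⁻¹ * ‖w‖ ^ 2| ≤ B * (6 * (n * δ) + 4 * (q / c)) := by
    rwa [abs_of_nonneg (by positivity)]
  rw [hmain]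
  have tri : ∀ x1 x2 x3 x4 x5 : ℝ, |x1 + x2 - x3 - x4 + x5| ≤ |x1| + |x2| + |x3| + |x4| + |x5| := by
    intro x1 x2 x3 x4 x5
    exact (abs_add_le _ _).trans (add_le_add ((abs_sub _ _).trans (add_le_add
      ((abs_sub _ _).trans (add_le_add (abs_add_le _ _) le_rfl)) le_rfl)) le_rfl)
  refine (tri _ _ _ _ _).trans ?_
  have e6 : 2 * ((2 * (q / c) + 2 * (n * δ)) / c) + B * (6 * (n * δ) + 4 * (q / c))
      = (4 / c ^ 2 + 4 * B / c) * q + (4 / c + 6 * B) * (n * δ) := by field_simp; ring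
  linarith

end DeterministicRemainder

/-! ### Population moments that enter the remainder. -/

section StochasticRemainder

local notation "⟪" x ", " y "⟫" => inner ℝ x y

variable {Ω 𝓧 : Type*} [MeasurableSpace Ω] [MeasurableSpace 𝓧] {P : Measure Ω}

lemma measure_le_ofReal_integral_div {f : Ω → ℝ} (h0 : ∀ ω, 0 ≤ f ω) (hf : Integrable f P)
    {c : ℝ} (hc : 0 < c) : P {ω | c ≤ f ω} ≤ ENNReal.ofReal ((∫ ω, f ω ∂P) / c) := by
  have h1 := mul_meas_ge_le_lintegral₀ (μ := P) hf.1.aemeasurable.ennreal_ofReal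
    (ENNReal.ofReal c)
  have h2 : {ω | c ≤ f ω} = {ω | ENNReal.ofReal c ≤ ENNReal.ofReal (f ω)} := by
    ext ω; simp [ENNReal.ofReal_le_ofReal_iff (h0 ω)]
  rw [← ofReal_integral_eq_lintegral_ofReal hf (ae_of_all _ h0)] at h1
  rw [h2, ENNReal.ofReal_div_of_pos hc, ENNReal.le_div_iff_mul_le (by simp [hc]) (by simp),
    mul_comm]
  exact h1

lemma measure_norm_ge_le {F : Type*} [NormedAddCommGroup F] {Y : Ω → F} (hY : MemLp Y 2 P)
    {c b : ℝ} (hc : 0 < c) (hb : ∫ ω, ‖Y ω‖ ^ 2 ∂P ≤ b) :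
    P {ω | c ≤ ‖Y ω‖} ≤ ENNReal.ofReal (b / c ^ 2) := by
  have h := measure_le_ofReal_integral_div (P := P) (f := fun ω => ‖Y ω‖ ^ 2)
    (fun _ => sq_nonneg _) hY.norm.integrable_sq (c := c ^ 2) (by positivity)
  refine (measure_mono fun ω hω => ?_).trans (h.trans (ENNReal.ofReal_le_ofReal (by gcongr)))
  exact pow_le_pow_left₀ hc.le hω 2

variable {m k : ℕ} {Λ : Measure 𝓧}

/-- The linear map with matrix `∫ F eᵗ`. -/
noncomputable def crossOperator (Λ : Measure 𝓧) (F : 𝓧 → EuclideanSpace ℝ (Fin m))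
    (e : 𝓧 → EuclideanSpace ℝ (Fin k)) :
    EuclideanSpace ℝ (Fin k) →L[ℝ] EuclideanSpace ℝ (Fin m) :=
  ∑ l, (EuclideanSpace.proj l : EuclideanSpace ℝ (Fin k) →L[ℝ] ℝ).smulRight (∫ x, e x l • F x ∂Λ)

lemma inner_crossOperator {F : 𝓧 → EuclideanSpace ℝ (Fin m)} {e : 𝓧 → EuclideanSpace ℝ (Fin k)}
    (h : ∀ l, Integrable (fun x => e x l • F x) Λ) (x : EuclideanSpace ℝ (Fin k))
    (y : EuclideanSpace ℝ (Fin m)) :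
    ⟪crossOperator Λ F e x, y⟫ = ∫ ζ, ⟪F ζ, y⟫ * ⟪e ζ, x⟫ ∂Λ := by
  have e1 : ∀ ζ, ⟪F ζ, y⟫ * ⟪e ζ, x⟫ = ∑ l, x l * ⟪y, e ζ l • F ζ⟫ := fun ζ => by
    rw [PiLp.inner_apply (e ζ) x, Finset.mul_sum]
    refine Finset.sum_congr rfl fun l _ => ?_
    rw [real_inner_smul_right, real_inner_comm y]
    simp; ring
  simp_rw [e1]
  rw [integral_finsetSum _ fun l _ => ((h l).const_inner y).const_mul _]
  simp only [crossOperator, sum_apply, ContinuousLinearMap.smulRight_apply,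
    sum_inner, real_inner_smul_left]
  refine Finset.sum_congr rfl fun l _ => ?_
  rw [integral_const_mul, integral_inner (h l), real_inner_comm]
  rfl

/-- The same duality as in `norm_sum_smul_sq_le`, with an integral in place of the sum. The bound
involves the covariance form of `F` and not its trace, so it does not grow with the dimension. -/
lemma norm_integral_smul_sq_le {E : Type*} [NormedAddCommGroup E] [InnerProductSpace ℝ E]
    [CompleteSpace E] {F : 𝓧 → E} {g : 𝓧 → ℝ} {b : ℝ} (hb : 0 ≤ b) (hF : MemLp F 2 Λ)
    (hg : MemLp g 2 Λ) (hform : ∀ a : E, ∫ x, ⟪a, F x⟫ ^ 2 ∂Λ ≤ b * ‖a‖ ^ 2) :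
    ‖∫ x, g x • F x ∂Λ‖ ^ 2 ≤ b * ∫ x, g x ^ 2 ∂Λ := by
  set a := ∫ x, g x • F x ∂Λ with ha
  have hi : Integrable (fun x => g x • F x) Λ := memLp_one_iff_integrable.1 (hF.smul hg)
  have hg0 : 0 ≤ ∫ x, g x ^ 2 ∂Λ := integral_nonneg fun _ => sq_nonneg _
  have h1 : ‖a‖ ^ 2 = ∫ x, g x * ⟪a, F x⟫ ∂Λ := by
    rw [← real_inner_self_eq_norm_sq]
    nth_rewrite 2 [ha]
    rw [← integral_inner hi]
    simp_rw [real_inner_smul_right]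
  have h2 : ‖a‖ ^ 2 ≤ √(∫ x, g x ^ 2 ∂Λ) * √(b * ‖a‖ ^ 2) := by
    rw [h1]
    refine (le_abs_self _).trans ((abs_integral_mul_le_sqrt_mul_sqrt hg (hF.const_inner a)).trans ?_)
    rw [← h1]
    gcongr
    exact hform a
  rw [← Real.sqrt_mul hg0] at h2
  have h3 : (‖a‖ ^ 2) ^ 2 ≤ (b * ∫ x, g x ^ 2 ∂Λ) * ‖a‖ ^ 2 := by
    refine (pow_le_pow_left₀ (sq_nonneg _) h2 2).trans_eq ?_
    rw [Real.sq_sqrt (by positivity)]; ring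
  rcases (sq_nonneg ‖a‖).eq_or_lt with h0 | h0
  · rw [← h0]; positivity
  · exact le_of_mul_le_mul_right (by rw [← sq]; exact h3) h0

/-- Moment bounds for the error `u`, the approximation error `r`, the instruments `F` and the
regressors `e` of a least squares regression. -/
structure RegressionBounds (Λ : Measure 𝓧) (u r : 𝓧 → ℝ) (F : 𝓧 → EuclideanSpace ℝ (Fin m))
    (e : 𝓧 → EuclideanSpace ℝ (Fin k)) (b c T δ : ℝ) : Prop where
  one_le : 1 ≤ b
  pos : 0 < c
  T_pos : 0 < T
  k_pos : 0 < k
  δ_nonneg : 0 ≤ δ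
  meas_u : Measurable u
  meas_r : Measurable r
  meas_F : Measurable F
  meas_e : Measurable e
  memLp_F : MemLp F 4 Λ
  memLp_uF : MemLp (fun x => u x • F x) 2 Λ
  memLp_ue : MemLp (fun x => u x • e x) 2 Λ
  mean_uF : ∀ s, ∫ x, ⟪s, u x • F x⟫ ∂Λ = 0
  mean_ue : ∀ s, ∫ x, ⟪s, u x • e x⟫ ∂Λ = 0
  F_four : ∫ x, ‖F x‖ ^ 4 ∂Λ ≤ b * T ^ 2
  F_two : ∫ x, ‖F x‖ ^ 2 ∂Λ ≤ b * T
  uF_two : ∫ x, ‖u x • F x‖ ^ 2 ∂Λ ≤ b * T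
  F_form : ∀ a, ∫ x, ⟪a, F x⟫ ^ 2 ∂Λ ≤ b * ‖a‖ ^ 2
  uF_form : ∀ a, ∫ x, ⟪a, u x • F x⟫ ^ 2 ∂Λ ≤ b * ‖a‖ ^ 2
  e_bound : ∀ᵐ x ∂Λ, ‖e x‖ ^ 2 ≤ b * k
  ue_two : ∫ x, ‖u x • e x‖ ^ 2 ∂Λ ≤ b * k
  r_bound : ∀ᵐ x ∂Λ, r x ^ 2 ≤ δ
  e_form : ∀ a, c * ‖a‖ ^ 2 ≤ ∫ x, ⟪e x, a⟫ ^ 2 ∂Λ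

namespace RegressionBounds

variable [IsProbabilityMeasure P] [IsProbabilityMeasure Λ]
  {u r : 𝓧 → ℝ} {F : 𝓧 → EuclideanSpace ℝ (Fin m)}
  {e : 𝓧 → EuclideanSpace ℝ (Fin k)} {b c T δ : ℝ} (h : RegressionBounds Λ u r F e b c T δ)
include h

lemma memLp_e (p : ℝ≥0∞) : MemLp e p Λ := by
  refine MemLp.of_bound h.meas_e.aestronglyMeasurable (√(b * k)) ?_
  filter_upwards [h.e_bound] with x hx
  exact Real.le_sqrt_of_sq_le hx

lemma memLp_e_apply (l : Fin k) : MemLp (fun x => e x l) 2 Λ := by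
    refine (h.memLp_e 2).mono ?_ (ae_of_all _ fun x => ?_)
    · exact ((EuclideanSpace.proj l : EuclideanSpace ℝ (Fin k) →L[ℝ] ℝ).measurable.comp
        h.meas_e).aestronglyMeasurable
    · exact PiLp.norm_apply_le (e x) l

lemma memLp_r (p : ℝ≥0∞) : MemLp r p Λ := by
  refine MemLp.of_bound h.meas_r.aestronglyMeasurable (√δ) ?_
  filter_upwards [h.r_bound] with x hx
  exact Real.le_sqrt_of_sq_le (by simpa using hx)

lemma memLp_F_two : MemLp F 2 Λ := h.memLp_F.mono_exponent (by norm_num)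

lemma memLp_rF : MemLp (fun x => r x • F x) 2 Λ := by
  have := h.memLp_F_two.smul (h.memLp_r ∞) (r := 2)
  exact this

lemma integral_rF_le : ∫ x, ‖r x • F x‖ ^ 2 ∂Λ ≤ δ * (b * T) := by
  calc _ ≤ ∫ x, δ * ‖F x‖ ^ 2 ∂Λ := by
        refine integral_mono_ae h.memLp_rF.norm.integrable_sq
          (h.memLp_F_two.norm.integrable_sq.const_mul _) ?_
        filter_upwards [h.r_bound] with x hx
        rw [norm_smul, mul_pow, Real.norm_eq_abs, sq_abs]
        gcongr
    _ ≤ _ := by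
        rw [integral_const_mul]
        exact mul_le_mul_of_nonneg_left h.F_two h.δ_nonneg

lemma integral_e_two_le : ∫ x, ‖e x‖ ^ 2 ∂Λ ≤ b * k := by
  calc _ ≤ ∫ _, b * (k : ℝ) ∂Λ :=
        integral_mono_ae (h.memLp_e 2).norm.integrable_sq (integrable_const _) h.e_bound
    _ = _ := by simp

lemma integrable_eF (l : Fin k) : Integrable (fun x => e x l • F x) Λ := by
  exact memLp_one_iff_integrable.1 (h.memLp_F_two.smul (h.memLp_e_apply l))

lemma norm_integral_rF_sq_le : ‖∫ x, r x • F x ∂Λ‖ ^ 2 ≤ b * δ := by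
  have hb := h.one_le
  refine (norm_integral_smul_sq_le (by linarith) h.memLp_F_two (h.memLp_r 2) h.F_form).trans ?_
  have : ∫ x, r x ^ 2 ∂Λ ≤ ∫ _, δ ∂Λ :=
    integral_mono_ae (h.memLp_r 2).integrable_sq (integrable_const _) h.r_bound
  simp only [integral_const, probReal_univ, one_smul] at this
  exact mul_le_mul_of_nonneg_left this (by linarith)

/-- The coordinates of `A* y` are `⟨A ε_l, y⟩` with `ε_l` the standard basis. Each has second moment
at most `b ‖A ε_l‖² ≤ b² E[e_l²]`, and summation over `l` gives `b² E‖e‖² ≤ b³ k`, without the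
factor `T` that bounds the trace. -/
lemma integral_adjoint_uF_le :
    ∫ x, ‖(crossOperator Λ F e).adjoint (u x • F x)‖ ^ 2 ∂Λ ≤ b ^ 3 * k := by
  have hb := h.one_le
  set A := crossOperator Λ F e with hA
  have hcoord : ∀ y : EuclideanSpace ℝ (Fin m),
      ‖A.adjoint y‖ ^ 2 = ∑ l, ⟪A (EuclideanSpace.single l 1), y⟫ ^ 2 := fun y => by
    rw [EuclideanSpace.real_norm_sq_eq]
    refine Finset.sum_congr rfl fun l _ => ?_
    rw [← ContinuousLinearMap.adjoint_inner_right, EuclideanSpace.inner_single_left]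
    simp
  have hAl : ∀ l, ‖A (EuclideanSpace.single l 1)‖ ^ 2 ≤ b * ∫ x, e x l ^ 2 ∂Λ := fun l => by
    have h2 : A (EuclideanSpace.single l 1) = ∫ x, e x l • F x ∂Λ := by
      refine ext_inner_right ℝ fun y => ?_
      rw [hA, inner_crossOperator h.integrable_eF, real_inner_comm,
        ← integral_inner (h.integrable_eF l)]
      refine integral_congr_ae (ae_of_all _ fun x => ?_)
      simp [real_inner_smul_right, real_inner_comm y, EuclideanSpace.inner_single_right, mul_comm]
    rw [h2]
    exact norm_integral_smul_sq_le (by linarith) h.memLp_F_two (h.memLp_e_apply l) h.F_form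
  simp_rw [hcoord]
  rw [integral_finsetSum _ fun l _ => (h.memLp_uF.const_inner _).integrable_sq]
  calc _ ≤ ∑ l, b * (b * ∫ x, e x l ^ 2 ∂Λ) := by
        refine Finset.sum_le_sum fun l _ => (h.uF_form _).trans ?_
        exact mul_le_mul_of_nonneg_left (hAl l) (by linarith)
    _ = b * (b * ∫ x, ‖e x‖ ^ 2 ∂Λ) := by
        simp_rw [EuclideanSpace.real_norm_sq_eq]
        rw [integral_finsetSum, Finset.mul_sum, Finset.mul_sum]
        intro l _
        exact (h.memLp_e_apply l).integrable_sq
    _ ≤ b * (b * (b * k)) := by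
        have := h.integral_e_two_le
        gcongr
    _ = _ := by ring

end RegressionBounds

end StochasticRemainder

/-! ### The remainder in probability. -/

section StochasticRemainderBound

local notation "⟪" x ", " y "⟫" => inner ℝ x y

variable {Ω 𝓧 : Type*} [MeasurableSpace Ω] [MeasurableSpace 𝓧] {P : Measure Ω}
  {m k : ℕ} {Λ : Measure 𝓧} [IsProbabilityMeasure P] [IsProbabilityMeasure Λ]

/-- The bilinear form of a matrix is bounded by its Frobenius norm, uniformly in `x` and `y`.
Chebyshev's inequality for the vectorized matrix `outerVec` therefore controls all directions at
once. -/
lemma measure_cross_deviation_ge_le {ι₁ ι₂ : Type*} [Fintype ι₁] [Fintype ι₂] {ξ : ℕ → Ω → 𝓧}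
    (hξ : ∀ i, HasLaw (ξ i) Λ P) (hind : iIndepFun ξ P)
    {p : 𝓧 → EuclideanSpace ℝ ι₁} {q : 𝓧 → EuclideanSpace ℝ ι₂} (hp : Measurable p)
    (hq : Measurable q) {β d : ℝ} (hi : Integrable (fun x => ‖p x‖ ^ 2 * ‖q x‖ ^ 2) Λ)
    (hβ : ∫ x, ‖p x‖ ^ 2 * ‖q x‖ ^ 2 ∂Λ ≤ β) (hd : 0 < d) {n : ℕ} (hn : 0 < n) :
    P {ω | ¬ ∀ x y, |∑ i ∈ Finset.range n, ⟪p (ξ i ω), x⟫ * ⟪q (ξ i ω), y⟫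
        - n * ∫ ζ, ⟪p ζ, x⟫ * ⟪q ζ, y⟫ ∂Λ| ≤ n * d * (‖x‖ * ‖y‖)}
      ≤ ENNReal.ofReal (β / (n * d ^ 2)) := by
  have hn0 : (0 : ℝ) < n := by exact_mod_cast hn
  have hg := measurable_outerVec hp hq
  have h2 : MemLp (fun x => outerVec (p x) (q x)) 2 Λ := by
    rw [← memLp_norm_iff hg.aestronglyMeasurable,
      memLp_two_iff_integrable_sq hg.norm.aestronglyMeasurable]
    simpa only [norm_outerVec, mul_pow] using hi
  have h := integral_norm_sum_sub_sq_le hξ hind hg h2 n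
  simp only [norm_outerVec, mul_pow] at h
  have hm := measure_norm_ge_le (P := P) ((memLp_sum_comp hξ h2 n).sub (memLp_const
    ((n : ℝ) • ∫ x, outerVec (p x) (q x) ∂Λ))) (c := n * d) (b := n * β) (by positivity)
    (h.trans (by gcongr))
  have e : n * β / (n * d) ^ 2 = β / (n * d ^ 2) := by field_simp
  rw [e] at hm
  refine (measure_mono fun ω hω => ?_).trans hm
  by_contra hlt
  simp only [Set.mem_ofPred_eq, not_le] at hlt
  refine hω fun x y => ?_
  set w := ∑ i ∈ Finset.range n, outerVec (p (ξ i ω)) (q (ξ i ω))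
    - (n : ℝ) • ∫ x, outerVec (p x) (q x) ∂Λ with hw
  have e2 : ⟪outerVec x y, w⟫ = ∑ i ∈ Finset.range n, ⟪p (ξ i ω), x⟫ * ⟪q (ξ i ω), y⟫
        - n * ∫ ζ, ⟪p ζ, x⟫ * ⟪q ζ, y⟫ ∂Λ := by
    rw [hw, inner_sub_right, inner_sum, real_inner_smul_right,
      ← integral_inner (h2.integrable (by norm_num))]
    simp only [inner_outerVec_outerVec, real_inner_comm]
  rw [← e2]
  refine (abs_real_inner_le_norm _ _).trans ?_
  rw [norm_outerVec, mul_comm]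
  exact mul_le_mul_of_nonneg_right hlt.le (by positivity)

namespace RegressionBounds

variable {u r : 𝓧 → ℝ} {F : 𝓧 → EuclideanSpace ℝ (Fin m)}
  {e : 𝓧 → EuclideanSpace ℝ (Fin k)} {b c T δ : ℝ} (h : RegressionBounds Λ u r F e b c T δ)
include h

set_option maxHeartbeats 1000000 in
/-- Replacing errors by least squares residuals changes the quadratic form by an amount of order
at most `k + n δ` in probability. -/
lemma measure_quadratic_remainder_ge_le {ξ : ℕ → Ω → 𝓧} (hξ : ∀ i, HasLaw (ξ i) Λ P)
    (hind : iIndepFun ξ P) {n : ℕ} (hn : 0 < n) (hT : T ^ 2 ≤ n)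
    {θ : Ω → EuclideanSpace ℝ (Fin k)}
    (hθ : ∀ ω, ∑ i ∈ Finset.range n,
      (u (ξ i ω) + r (ξ i ω) - ⟪e (ξ i ω), θ ω⟫) • e (ξ i ω) = 0) {η : ℝ} (hη : 0 < η) :
    P {ω | η ≤ |(n : ℝ)⁻¹ * ‖∑ i ∈ Finset.range n,
          (u (ξ i ω) + r (ξ i ω) - ⟪e (ξ i ω), θ ω⟫) • F (ξ i ω)‖ ^ 2
        - (n : ℝ)⁻¹ * ‖∑ i ∈ Finset.range n, u (ξ i ω) • F (ξ i ω)‖ ^ 2|}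
      ≤ ENNReal.ofReal (b * T ^ 2 / n) + ENNReal.ofReal (4 * b ^ 2 / c ^ 2 * (k ^ 2 / n))
        + ENNReal.ofReal (b ^ 2 * T ^ 2 / n)
        + ENNReal.ofReal ((1 + 4 * b + b ^ 2 + b ^ 3 + (16 / c ^ 2 + 8 * (b + 1) / c) * b
          + (8 / c + 6 * (b + 1))) * (k + n * δ) / η) := by
  have hn0 : (0 : ℝ) < n := by exact_mod_cast hn
  have hk0 : (0 : ℝ) < k := by exact_mod_cast h.k_pos
  have hk1 : (1 : ℝ) ≤ k := by exact_mod_cast h.k_pos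
  have hb := h.one_le
  have hb0 : 0 < b := by linarith
  have hc := h.pos
  have hTp := h.T_pos
  have hδ := h.δ_nonneg
  -- This weight balances three quantities: `d² E‖N‖² / n ≤ b k`, the probability `b² T k / (n d²) =
  -- b² T² / n` of the third exceptional event, and `E‖R‖² / (n d²) ≤ b δ T² / k ≤ b n δ`, where `T²
  -- ≤ n` is used.
  set d : ℝ := √(k / T) with hd
  have hd2 : d ^ 2 = k / T := Real.sq_sqrt (by positivity)
  have hd0 : 0 < d := Real.sqrt_pos.2 (by positivity)
  set A := crossOperator Λ F e with hA
  set a := ∫ x, r x • F x ∂Λ with ha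
  -- exceptional events
  set B1 := {ω | ¬ ∀ x y, |∑ i ∈ Finset.range n, ⟪F (ξ i ω), x⟫ * ⟪F (ξ i ω), y⟫
        - n * ∫ ζ, ⟪F ζ, x⟫ * ⟪F ζ, y⟫ ∂Λ| ≤ n * 1 * (‖x‖ * ‖y‖)} with hB1
  set B2 := {ω | ¬ ∀ x y, |∑ i ∈ Finset.range n, ⟪e (ξ i ω), x⟫ * ⟪e (ξ i ω), y⟫
        - n * ∫ ζ, ⟪e ζ, x⟫ * ⟪e ζ, y⟫ ∂Λ| ≤ n * (c / 2) * (‖x‖ * ‖y‖)} with hB2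
  set B3 := {ω | ¬ ∀ x y, |∑ i ∈ Finset.range n, ⟪F (ξ i ω), x⟫ * ⟪e (ξ i ω), y⟫
        - n * ∫ ζ, ⟪F ζ, x⟫ * ⟪e ζ, y⟫ ∂Λ| ≤ n * d * (‖x‖ * ‖y‖)} with hB3
  have hF4 := (memLp_four_iff h.memLp_F.1).1 h.memLp_F
  have hP1 : P B1 ≤ ENNReal.ofReal (b * T ^ 2 / n) := by
    have := measure_cross_deviation_ge_le hξ hind h.meas_F h.meas_F (β := b * T ^ 2) (d := 1)
      (by simpa only [← pow_add] using hF4) (by simpa only [← pow_add] using h.F_four) one_pos hn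
    exact this.trans_eq (by rw [one_pow, mul_one])
  have hee : Integrable (fun x => ‖e x‖ ^ 2 * ‖e x‖ ^ 2) Λ := by
    simpa only [← pow_add] using (memLp_four_iff (h.memLp_e 4).1).1 (h.memLp_e 4)
  have hP2 : P B2 ≤ ENNReal.ofReal (4 * b ^ 2 / c ^ 2 * (k ^ 2 / n)) := by
    have hle : ∫ x, ‖e x‖ ^ 2 * ‖e x‖ ^ 2 ∂Λ ≤ (b * k) * (b * k) := by
      calc _ ≤ ∫ _, (b * k) * (b * k : ℝ) ∂Λ := by
            refine integral_mono_ae hee (integrable_const _) ?_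
            filter_upwards [h.e_bound] with x hx
            exact mul_le_mul hx hx (by positivity) (by positivity)
        _ = _ := by simp
    refine (measure_cross_deviation_ge_le hξ hind h.meas_e h.meas_e hee hle (half_pos hc) hn).trans
      (le_of_eq ?_)
    congr 1; field_simp; norm_num
  have hFe : Integrable (fun x => ‖F x‖ ^ 2 * ‖e x‖ ^ 2) Λ := by
    refine (h.memLp_F_two.norm.integrable_sq.mul_const (b * k)).mono' ?_ ?_
    · exact ((h.meas_F.norm.pow_const 2).mul (h.meas_e.norm.pow_const 2)).aestronglyMeasurable
    · filter_upwards [h.e_bound] with x hx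
      rw [Real.norm_of_nonneg (by positivity)]
      gcongr
  have hP3 : P B3 ≤ ENNReal.ofReal (b ^ 2 * T ^ 2 / n) := by
    have hle : ∫ x, ‖F x‖ ^ 2 * ‖e x‖ ^ 2 ∂Λ ≤ (b * T) * (b * k) := by
      calc _ ≤ ∫ x, ‖F x‖ ^ 2 * (b * k : ℝ) ∂Λ := by
            refine integral_mono_ae hFe (h.memLp_F_two.norm.integrable_sq.mul_const _) ?_
            filter_upwards [h.e_bound] with x hx
            gcongr
        _ ≤ _ := by
            rw [integral_mul_const]
            exact mul_le_mul_of_nonneg_right h.F_two (by positivity)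
    refine (measure_cross_deviation_ge_le hξ hind h.meas_F h.meas_e hFe hle hd0 hn).trans
      (le_of_eq ?_)
    congr 1; rw [hd2]; field_simp
  -- the dominating variable
  set N : Ω → EuclideanSpace ℝ (Fin m) := fun ω =>
    ∑ i ∈ Finset.range n, u (ξ i ω) • F (ξ i ω) with hN
  set R : Ω → EuclideanSpace ℝ (Fin m) := fun ω =>
    ∑ i ∈ Finset.range n, r (ξ i ω) • F (ξ i ω) - (n : ℝ) • a with hR
  set q : Ω → EuclideanSpace ℝ (Fin k) := fun ω =>
    ∑ i ∈ Finset.range n, u (ξ i ω) • e (ξ i ω) with hq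
  have hNL : MemLp N 2 P := memLp_sum_comp hξ h.memLp_uF n
  have hRL : MemLp R 2 P := (memLp_sum_comp hξ h.memLp_rF n).sub (memLp_const _)
  have hqL : MemLp q 2 P := memLp_sum_comp hξ h.memLp_ue n
  have hAL : MemLp (fun ω => A.adjoint (N ω)) 2 P := A.adjoint.comp_memLp' hNL
  have huFm : Measurable fun x => u x • F x := h.meas_u.smul h.meas_F
  have eN : ∫ ω, ‖N ω‖ ^ 2 ∂P ≤ n * (b * T) := by
    rw [integral_norm_sum_sq hξ hind huFm h.memLp_uF h.mean_uF n]
    exact mul_le_mul_of_nonneg_left h.uF_two hn0.le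
  have eR : ∫ ω, ‖R ω‖ ^ 2 ∂P ≤ n * (δ * (b * T)) :=
    (integral_norm_sum_sub_sq_le hξ hind (h.meas_r.smul h.meas_F) h.memLp_rF n).trans
      (mul_le_mul_of_nonneg_left h.integral_rF_le hn0.le)
  have eq' : ∫ ω, ‖q ω‖ ^ 2 ∂P ≤ n * (b * k) := by
    have huem : Measurable fun x => u x • e x := h.meas_u.smul h.meas_e
    rw [integral_norm_sum_sq hξ hind huem h.memLp_ue h.mean_ue n]
    exact mul_le_mul_of_nonneg_left h.ue_two hn0.le
  have ea : ∫ ω, ⟪a, N ω⟫ ^ 2 ∂P ≤ n * (b * (b * δ)) := by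
    have h1 := integral_norm_sum_sq hξ hind (g := fun x => ⟪a, u x • F x⟫)
      ((measurable_const.inner huFm)) (h.memLp_uF.const_inner a)
      (fun s => by
        have : ∀ x, ⟪s, ⟪a, u x • F x⟫⟫ = s * ⟪a, u x • F x⟫ := fun x => by
          rw [real_inner_eq_re_inner]; simp [mul_comm]
        simp_rw [this]
        rw [integral_const_mul, h.mean_uF, mul_zero]) n
    have h2 : ∀ ω, ⟪a, N ω⟫ ^ 2 = ‖∑ i ∈ Finset.range n, ⟪a, u (ξ i ω) • F (ξ i ω)⟫‖ ^ 2 :=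
      fun ω => by rw [hN, inner_sum, Real.norm_eq_abs, sq_abs]
    simp_rw [h2]
    rw [h1]
    simp only [Real.norm_eq_abs, sq_abs]
    refine mul_le_mul_of_nonneg_left ((h.uF_form a).trans ?_) hn0.le
    exact mul_le_mul_of_nonneg_left h.norm_integral_rF_sq_le hb0.le
  have eA : ∫ ω, ‖A.adjoint (N ω)‖ ^ 2 ∂P ≤ n * (b ^ 3 * k) := by
    have h1 := integral_norm_sum_sq hξ hind (g := fun x => A.adjoint (u x • F x))
      (A.adjoint.continuous.measurable.comp huFm) (A.adjoint.comp_memLp' h.memLp_uF)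
      (fun s => by
        simp_rw [ContinuousLinearMap.adjoint_inner_right]
        exact h.mean_uF _) n
    have h2 : ∀ ω, A.adjoint (N ω)
        = ∑ i ∈ Finset.range n, A.adjoint (u (ξ i ω) • F (ξ i ω)) :=
      fun ω => by rw [hN, map_sum]
    simp_rw [h2]
    rw [h1]
    exact mul_le_mul_of_nonneg_left h.integral_adjoint_uF_le hn0.le
  set D : Ω → ℝ := fun ω => 1 + ⟪a, N ω⟫ ^ 2 + 2 * d ^ 2 * (‖N ω‖ ^ 2 / n)
        + ‖R ω‖ ^ 2 / n / d ^ 2 + ‖A.adjoint (N ω)‖ ^ 2 / n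
        + (4 / (c / 2) ^ 2 + 4 * (b + 1) / (c / 2)) * (‖q ω‖ ^ 2 / n)
        + (4 / (c / 2) + 6 * (b + 1)) * (n * δ) with hD
  have hD0 : ∀ ω, 0 ≤ D ω := fun ω => by positivity
  have i1 : Integrable (fun ω => ⟪a, N ω⟫ ^ 2) P := (hNL.const_inner a).integrable_sq
  have i2 : Integrable (fun ω => 2 * d ^ 2 * (‖N ω‖ ^ 2 / n)) P :=
    (hNL.norm.integrable_sq.div_const _).const_mul _
  have i3 : Integrable (fun ω => ‖R ω‖ ^ 2 / n / d ^ 2) P :=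
    (hRL.norm.integrable_sq.div_const _).div_const _
  have i4 : Integrable (fun ω => ‖A.adjoint (N ω)‖ ^ 2 / n) P :=
    hAL.norm.integrable_sq.div_const _
  have i5 : Integrable (fun ω => (4 / (c / 2) ^ 2 + 4 * (b + 1) / (c / 2)) * (‖q ω‖ ^ 2 / n)) P :=
    (hqL.norm.integrable_sq.div_const _).const_mul _
  have j1 : Integrable (fun ω => 1 + ⟪a, N ω⟫ ^ 2) P := (integrable_const _).add i1
  have j2 : Integrable (fun ω => 1 + ⟪a, N ω⟫ ^ 2 + 2 * d ^ 2 * (‖N ω‖ ^ 2 / n)) P := j1.add i2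
  have j3 : Integrable (fun ω => 1 + ⟪a, N ω⟫ ^ 2 + 2 * d ^ 2 * (‖N ω‖ ^ 2 / n)
        + ‖R ω‖ ^ 2 / n / d ^ 2) P := j2.add i3
  have j4 : Integrable (fun ω => 1 + ⟪a, N ω⟫ ^ 2 + 2 * d ^ 2 * (‖N ω‖ ^ 2 / n)
        + ‖R ω‖ ^ 2 / n / d ^ 2 + ‖A.adjoint (N ω)‖ ^ 2 / n) P := j3.add i4
  have j5 : Integrable (fun ω => 1 + ⟪a, N ω⟫ ^ 2 + 2 * d ^ 2 * (‖N ω‖ ^ 2 / n)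
        + ‖R ω‖ ^ 2 / n / d ^ 2 + ‖A.adjoint (N ω)‖ ^ 2 / n
        + (4 / (c / 2) ^ 2 + 4 * (b + 1) / (c / 2)) * (‖q ω‖ ^ 2 / n)) P := j4.add i5
  have hDi : Integrable D P := j5.add (integrable_const _)
  have hDE : ∫ ω, D ω ∂P ≤ (1 + 4 * b + b ^ 2 + b ^ 3 + (16 / c ^ 2 + 8 * (b + 1) / c) * b
          + (8 / c + 6 * (b + 1))) * (k + n * δ) := by
    have hsplit : ∫ ω, D ω ∂P = 1 + ∫ ω, ⟪a, N ω⟫ ^ 2 ∂P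
        + 2 * d ^ 2 * ((∫ ω, ‖N ω‖ ^ 2 ∂P) / n) + (∫ ω, ‖R ω‖ ^ 2 ∂P) / n / d ^ 2
        + (∫ ω, ‖A.adjoint (N ω)‖ ^ 2 ∂P) / n
        + (4 / (c / 2) ^ 2 + 4 * (b + 1) / (c / 2)) * ((∫ ω, ‖q ω‖ ^ 2 ∂P) / n)
        + (4 / (c / 2) + 6 * (b + 1)) * (n * δ) := by
      simp only [hD]
      rw [integral_add j5 (integrable_const _), integral_add j4 i5, integral_add j3 i4,
        integral_add j2 i3, integral_add j1 i2, integral_add (integrable_const _) i1]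
      simp only [integral_const_mul, integral_div, integral_const, probReal_univ, one_smul]
    rw [hsplit]
    have k2 : 2 * d ^ 2 * ((∫ ω, ‖N ω‖ ^ 2 ∂P) / n) ≤ 2 * b * k := by
      calc _ ≤ 2 * d ^ 2 * ((n * (b * T)) / n) := by gcongr
        _ = _ := by rw [hd2]; field_simp
    have k3 : (∫ ω, ‖R ω‖ ^ 2 ∂P) / n / d ^ 2 ≤ b * (n * δ) := by
      calc _ ≤ (n * (δ * (b * T))) / n / d ^ 2 := by gcongr
        _ = b * δ * (T ^ 2 / k) := by rw [hd2]; field_simp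
        _ ≤ b * δ * (n / 1) := by gcongr
        _ = _ := by ring
    have k4 : (∫ ω, ‖A.adjoint (N ω)‖ ^ 2 ∂P) / n ≤ b ^ 3 * k := by
      rw [div_le_iff₀ hn0]; linarith
    have k5 : (4 / (c / 2) ^ 2 + 4 * (b + 1) / (c / 2)) * ((∫ ω, ‖q ω‖ ^ 2 ∂P) / n)
        ≤ (16 / c ^ 2 + 8 * (b + 1) / c) * b * k := by
      have e1 : (4 / (c / 2) ^ 2 + 4 * (b + 1) / (c / 2)) = 16 / c ^ 2 + 8 * (b + 1) / c := by
        field_simp; ring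
      rw [e1, mul_assoc]
      refine mul_le_mul_of_nonneg_left ?_ (by positivity)
      rw [div_le_iff₀ hn0]; linarith
    have e7 : 4 / (c / 2) = 8 / c := by field_simp; norm_num
    rw [e7]
    have hnδ : 0 ≤ n * δ := by positivity
    set C1 := (16 / c ^ 2 + 8 * (b + 1) / c) * b with hC1
    have hC10 : 0 ≤ C1 := by positivity
    set C2 := 8 / c + 6 * (b + 1) with hC2
    have hC20 : 0 ≤ C2 := by positivity
    have f1 : 0 ≤ b * k := by positivity
    have f2 : 0 ≤ b ^ 2 * k := by positivity
    have f3 : 0 ≤ b ^ 3 * (n * δ) := by positivity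
    have f4 : 0 ≤ C1 * (n * δ) := by positivity
    have f5 : 0 ≤ C2 * k := by positivity
    have f6 : 0 ≤ b * (n * δ) := by positivity
    linarith
  have hPD := measure_le_ofReal_integral_div hD0 hDi hη
  have hmono : ∀ᵐ ω ∂P, ω ∈ {ω | η ≤ |(n : ℝ)⁻¹ * ‖∑ i ∈ Finset.range n,
          (u (ξ i ω) + r (ξ i ω) - ⟪e (ξ i ω), θ ω⟫) • F (ξ i ω)‖ ^ 2
        - (n : ℝ)⁻¹ * ‖N ω‖ ^ 2|} → ω ∈ B1 ∪ B2 ∪ B3 ∪ {ω | η ≤ D ω} := by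
    have hrae : ∀ᵐ ω ∂P, ∀ i, r (ξ i ω) ^ 2 ≤ δ := ae_all_iff.2 fun i =>
      ((hξ i).ae_iff (p := fun x => r x ^ 2 ≤ δ) ?_).2 h.r_bound
    · filter_upwards [hrae] with ω hr hω
      by_contra hnot
      simp only [Set.mem_union, not_or, hB1, hB2, hB3, Set.mem_ofPred_eq, not_not] at hnot
      obtain ⟨⟨⟨g1, g2⟩, g3⟩, g4⟩ := hnot
      refine g4 (le_trans hω ?_)
      -- Off the first event the empirical form of `F` exceeds the population bound `b` by at most
      -- 1; off the second, the empirical form of `e` keeps half of its lower bound `c`. Hence the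
      -- constants `b + 1` and `c / 2`.
      refine abs_quadratic_remainder_le (r := fun i => r (ξ i ω)) (u := fun i => u (ξ i ω))
        (e := fun i => e (ξ i ω)) (F := fun i => F (ξ i ω)) (A := A) (B := b + 1) (c := c / 2)
        (d := d) (δ := δ) hn (by linarith) (by positivity) hd0 ?_ ?_ ?_ (fun i _ => hr i) (hθ ω)
      · intro x
        have h1 := (abs_le.1 (g1 x x)).2
        have h2 := h.F_form x
        simp_rw [real_inner_comm _ x] at h2
        simp only [← sq] at h1
        have h3 : n * ∫ ζ, ⟪F ζ, x⟫ ^ 2 ∂Λ ≤ n * (b * ‖x‖ ^ 2) :=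
          mul_le_mul_of_nonneg_left h2 hn0.le
        linarith
      · intro x
        have h1 := (abs_le.1 (g2 x x)).1
        have h2 := h.e_form x
        simp only [← sq] at h1
        have h3 : n * (c * ‖x‖ ^ 2) ≤ n * ∫ ζ, ⟪e ζ, x⟫ ^ 2 ∂Λ :=
          mul_le_mul_of_nonneg_left h2 hn0.le
        linarith
      · intro x y
        have h1 := g3 y x
        rw [hA, inner_crossOperator h.integrable_eF, mul_comm ‖x‖]
        exact h1
    · exact measurableSet_setOfPred.1 (measurableSet_le (h.meas_r.pow_const 2) measurable_const)
  calc _ ≤ P (B1 ∪ B2 ∪ B3 ∪ {ω | η ≤ D ω}) := measure_mono_ae hmono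
    _ ≤ P B1 + P B2 + P B3 + P {ω | η ≤ D ω} := by
        refine (measure_union_le _ _).trans (add_le_add ?_ le_rfl)
        refine (measure_union_le _ _).trans (add_le_add ?_ le_rfl)
        exact measure_union_le _ _
    _ ≤ _ := by
        gcongr
        refine hPD.trans (ENNReal.ofReal_le_ofReal ?_)
        gcongr

end RegressionBounds

end StochasticRemainderBound

/-! ### Moments of the instruments under the reference density. -/

section ModelMoments

local notation "⟪" x ", " y "⟫" => inner ℝ x y

variable {Ω : Type*} [MeasurableSpace Ω] {P : Measure Ω}

lemma integrable_and_integral_le_of_lintegral_le {𝓧 : Type*} [MeasurableSpace 𝓧] {μ : Measure 𝓧}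
    {g : 𝓧 → ℝ} (hg : AEStronglyMeasurable g μ) (h0 : ∀ x, 0 ≤ g x) {K : ℝ} (hK : 0 ≤ K)
    (h : ∫⁻ x, ENNReal.ofReal (g x) ∂μ ≤ ENNReal.ofReal K) :
    Integrable g μ ∧ ∫ x, g x ∂μ ≤ K := by
  constructor
  · refine ⟨hg, ?_⟩
    rw [hasFiniteIntegral_iff_ofReal (ae_of_all _ h0)]
    exact h.trans_lt ENNReal.ofReal_lt_top
  · rw [integral_eq_lintegral_of_nonneg_ae (ae_of_all _ h0) hg]
    exact ENNReal.toReal_le_of_le_ofReal hK h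

lemma sum_Icc_one_eq_sum_fin {M : Type*} [AddCommMonoid M] (g : ℕ → M) (m : ℕ) :
    ∑ j ∈ Finset.Icc 1 m, g j = ∑ j : Fin m, g (j + 1) := by
  rw [Fin.sum_univ_eq_sum_range (fun j => g (j + 1)) m, Finset.range_eq_Ico,
    Finset.sum_Ico_add' g 0 m 1]
  rfl

/-- A bound on the conditional expectation given `W` transfers to weighted integrals. -/
lemma lintegral_mul_comp_le_of_condExp_le [IsProbabilityMeasure P] {d : ℕ} {V : Ω → ℝ}
    {W : Ω → Euc d} (hW : Measurable W) (hV0 : ∀ ω, 0 ≤ V ω) (hV : Integrable V P)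
    {C : ℝ} (hC : 0 ≤ C) (hc : ∀ᵐ ω ∂P, condExpGiven P V W ω ≤ C) {g : Euc d → ℝ≥0∞}
    (hg : Measurable g) :
    ∫⁻ ω, ENNReal.ofReal (V ω) * g (W ω) ∂P ≤ ENNReal.ofReal C * ∫⁻ x, g x ∂(P.map W) := by
  -- As measures, the image of `V · P` under `W` is at most `C` times the law of `W`: on events `W ∈
  -- A` the variable `V` may be replaced by its conditional expectation.
  have hle : (P.withDensity fun ω => ENNReal.ofReal (V ω)).map W
      ≤ ENNReal.ofReal C • P.map W := by
    refine Measure.le_iff.2 fun A hA => ?_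
    have hA' : MeasurableSet (W ⁻¹' A) := hW hA
    rw [Measure.map_apply hW hA, withDensity_apply _ hA', Measure.smul_apply,
      Measure.map_apply hW hA,
      ← ofReal_integral_eq_lintegral_ofReal hV.integrableOn (ae_of_all _ hV0)]
    have h1 : ∫ ω in W ⁻¹' A, V ω ∂P = ∫ ω in W ⁻¹' A, condExpGiven P V W ω ∂P :=
      (setIntegral_condExp hW.comap_le hV ⟨A, hA, rfl⟩).symm
    have h2 : ∫ ω in W ⁻¹' A, condExpGiven P V W ω ∂P ≤ ∫ _ in W ⁻¹' A, C ∂P :=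
      integral_mono_ae integrable_condExp.integrableOn (integrable_const _)
        (ae_restrict_of_ae hc)
    rw [setIntegral_const, smul_eq_mul, mul_comm] at h2
    rw [h1, smul_eq_mul]
    refine (ENNReal.ofReal_le_ofReal h2).trans ?_
    rw [ENNReal.ofReal_mul hC, measureReal_def, ENNReal.ofReal_toReal (measure_ne_top _ _)]
  calc ∫⁻ ω, ENNReal.ofReal (V ω) * g (W ω) ∂P
      = ∫⁻ x, g x ∂((P.withDensity fun ω => ENNReal.ofReal (V ω)).map W) := by
        rw [lintegral_map hg hW]
        exact (lintegral_withDensity_eq_lintegral_mul₀ hV.1.aemeasurable.ennreal_ofReal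
          (g := fun ω => g (W ω)) (hg.comp hW).aemeasurable).symm
    _ ≤ ∫⁻ x, g x ∂(ENNReal.ofReal C • P.map W) := lintegral_mono' hle le_rfl
    _ = _ := by rw [lintegral_smul_measure, smul_eq_mul]

/-- The law of `W` is dominated by a multiple of the reference measure. -/
lemma map_le_smul_densityMeasure [IsProbabilityMeasure P] {d : ℕ} {W : Ω → Euc d}
    {pW ν : Euc d → ℝ} (hWlaw : P.map W = densityMeasure pW)
    {η : ℝ} (hη : 0 ≤ η) (hpos : ∀ w ∈ (P.map W).support, 0 < ν w)
    (hle : ∀ w ∈ (P.map W).support, pW w / ν w ≤ η) :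
    P.map W ≤ ENNReal.ofReal η • densityMeasure ν := by
  refine Measure.le_iff.2 fun A hA => ?_
  set S := (P.map W).support with hS
  have hSm : MeasurableSet S := Measure.isClosed_support.measurableSet
  -- The density ratio is controlled only on the support, which carries the whole mass.
  have h1 : P.map W A = P.map W (A ∩ S) := by
    refine (measure_inter_conull ?_).symm
    exact Measure.measure_compl_support
  rw [h1, Measure.smul_apply, smul_eq_mul]
  conv_lhs => rw [hWlaw]
  rw [densityMeasure, densityMeasure, withDensity_apply _ (hA.inter hSm), withDensity_apply _ hA]
  calc ∫⁻ x in A ∩ S, ENNReal.ofReal (pW x) ≤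
        ∫⁻ x in A ∩ S, ENNReal.ofReal η * ENNReal.ofReal (ν x) := by
        refine setLIntegral_mono' (hA.inter hSm) fun x hx => ?_
        rw [← ENNReal.ofReal_mul hη]
        exact ENNReal.ofReal_le_ofReal ((div_le_iff₀ (hpos x hx.2)).1 (hle x hx.2))
    _ = ENNReal.ofReal η * ∫⁻ x in A ∩ S, ENNReal.ofReal (ν x) :=
        lintegral_const_mul' _ _ ENNReal.ofReal_ne_top
    _ ≤ _ := by gcongr; exact Set.inter_subset_left

/-- The vector `(√τ_1 f_1(w), …, √τ_m f_m(w))`. -/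
noncomputable def featureVec {d : ℕ} (τ : ℕ → ℝ) (f : ℕ → Euc d → ℝ) (m : ℕ) (w : Euc d) :
    EuclideanSpace ℝ (Fin m) := WithLp.toLp 2 fun j => √(τ (j + 1)) * f (j + 1) w

lemma measurable_featureVec {d : ℕ} {τ : ℕ → ℝ} {f : ℕ → Euc d → ℝ}
    (hf : ∀ l, 1 ≤ l → Measurable (f l)) (m : ℕ) : Measurable (featureVec τ f m) := by
  have h : Measurable fun w : Euc d => fun j : Fin m => √(τ (j + 1)) * f (j + 1) w :=
    measurable_pi_lambda _ fun j => (hf _ (by omega)).const_mul _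
  exact (PiLp.continuous_toLp 2 _).measurable.comp h

section Reference

variable {d : ℕ} {ν : Euc d → ℝ} {f : ℕ → Euc d → ℝ}

lemma IsOrthonormalBasisOfL2.memLp (hf : IsOrthonormalBasisOfL2 ν f) {l : ℕ} (hl : 1 ≤ l) :
    MemLp (f l) 2 (densityMeasure ν) := by
  obtain ⟨b, hb⟩ := hf.2
  exact (memLp_congr_ae (hb ⟨l, hl⟩)).1 (Lp.memLp _)

lemma IsOrthonormalBasisOfL2.integral_mul (hf : IsOrthonormalBasisOfL2 ν f) {j l : ℕ}
    (hj : 1 ≤ j) (hl : 1 ≤ l) :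
    ∫ w, f j w * f l w ∂(densityMeasure ν) = if j = l then 1 else 0 := by
  obtain ⟨b, hb⟩ := hf.2
  lift j to ℕ+ using hj
  lift l to ℕ+ using hl
  have h := orthonormal_iff_ite.1 b.orthonormal j l
  rw [L2.inner_def] at h
  rw [if_congr PNat.coe_inj rfl rfl, ← h]
  refine integral_congr_ae ?_
  filter_upwards [hb j, hb l] with w h1 h2
  rw [h1, h2]
  simp [mul_comm]

variable {τ : ℕ → ℝ}

lemma IsWeightSequence.le_one (hτ : IsWeightSequence τ) {j : ℕ} (hj : 1 ≤ j) : τ j ≤ 1 := by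
  rw [← hτ.one]; exact hτ.antitone 1 j le_rfl hj

/-- By orthonormality the integral is `∑ a_j² τ_j`, and `τ_j ≤ 1`. The bound is free of `m`, which
makes the covariance operators uniformly bounded. -/
lemma lintegral_inner_featureVec_sq_le (hf : IsOrthonormalBasisOfL2 ν f)
    (hτ : IsWeightSequence τ) {m : ℕ} (a : EuclideanSpace ℝ (Fin m)) :
    ∫⁻ w, ENNReal.ofReal (⟪a, featureVec τ f m w⟫ ^ 2) ∂(densityMeasure ν)
      ≤ ENNReal.ofReal (‖a‖ ^ 2) := by
  have hm : ∀ j : Fin m, MemLp (f (j + 1)) 2 (densityMeasure ν) := fun j => hf.memLp (by omega)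
  have e : ∀ w, ⟪a, featureVec τ f m w⟫ ^ 2 = ∑ j : Fin m, ∑ l : Fin m,
      (a j * √(τ (j + 1)) * (a l * √(τ (l + 1)))) * (f (j + 1) w * f (l + 1) w) := fun w => by
    rw [PiLp.inner_apply, sq, Finset.sum_mul_sum]
    refine Finset.sum_congr rfl fun j _ => Finset.sum_congr rfl fun l _ => ?_
    simp [featureVec]; ring
  have hi : ∀ j l : Fin m, Integrable (fun w => (a j * √(τ (j + 1)) * (a l * √(τ (l + 1))))
      * (f (j + 1) w * f (l + 1) w)) (densityMeasure ν) := fun j l =>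
    ((hm j).integrable_mul (hm l)).const_mul _
  have hint : Integrable (fun w => ⟪a, featureVec τ f m w⟫ ^ 2) (densityMeasure ν) := by
    simp_rw [e]
    exact integrable_finsetSum _ fun j _ => integrable_finsetSum _ fun l _ => hi j l
  rw [← ofReal_integral_eq_lintegral_ofReal hint (ae_of_all _ fun _ => sq_nonneg _)]
  refine ENNReal.ofReal_le_ofReal ?_
  simp_rw [e]
  rw [integral_finsetSum _ fun j _ => integrable_finsetSum _ fun l _ => hi j l,
    EuclideanSpace.real_norm_sq_eq]
  refine Finset.sum_le_sum fun j _ => ?_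
  rw [integral_finsetSum _ fun l _ => hi j l]
  have hterm : ∀ l : Fin m, ∫ w, (a j * √(τ (j + 1)) * (a l * √(τ (l + 1))))
      * (f (j + 1) w * f (l + 1) w) ∂(densityMeasure ν)
      = if j = l then a j ^ 2 * τ (j + 1) else 0 := fun l => by
    rw [integral_const_mul, hf.integral_mul (by omega) (by omega)]
    by_cases hjl : j = l
    · subst hjl
      have := Real.sq_sqrt (hτ.pos (j + 1) (by omega)).le
      simp only [if_true, mul_one]
      nlinarith
    · have : ((j : ℕ) + 1) ≠ (l : ℕ) + 1 := fun h => hjl (Fin.ext (by omega))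
      rw [if_neg this, if_neg hjl, mul_zero]
  simp only [hterm, Finset.sum_ite_eq, Finset.mem_univ, if_true]
  exact mul_le_of_le_one_right (sq_nonneg _) (hτ.le_one (by omega))

/-- Cauchy-Schwarz for `∑ √τ_j · (√τ_j f_j²)`. After integration both factors are of order `T = ∑
τ_j`, hence the bound `T²` on the fourth moment. -/
lemma norm_featureVec_pow_four_le (hτ : IsWeightSequence τ) (m : ℕ) (w : Euc d) :
    ‖featureVec τ f m w‖ ^ 4
      ≤ (∑ j : Fin m, τ (j + 1)) * ∑ j : Fin m, τ (j + 1) * |f (j + 1) w| ^ 4 := by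
  have h0 : ∀ j : Fin m, 0 ≤ τ (j + 1) := fun j => (hτ.pos _ (by omega)).le
  have e : ‖featureVec τ f m w‖ ^ 2
      = ∑ j : Fin m, √(τ (j + 1)) * (√(τ (j + 1)) * f (j + 1) w ^ 2) := by
    rw [EuclideanSpace.real_norm_sq_eq]
    refine Finset.sum_congr rfl fun j _ => ?_
    simp only [featureVec]; ring
  calc ‖featureVec τ f m w‖ ^ 4 = (‖featureVec τ f m w‖ ^ 2) ^ 2 := by ring
    _ ≤ (∑ j : Fin m, √(τ (j + 1)) ^ 2) *
        ∑ j : Fin m, (√(τ (j + 1)) * f (j + 1) w ^ 2) ^ 2 := by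
        rw [e]; exact Finset.sum_mul_sq_le_sq_mul_sq _ _ _
    _ = _ := by
        congr 1
        · exact Finset.sum_congr rfl fun j _ => Real.sq_sqrt (h0 j)
        · refine Finset.sum_congr rfl fun j _ => ?_
          rw [mul_pow, Real.sq_sqrt (h0 j), ← pow_mul, Even.pow_abs (by decide)]

lemma lintegral_norm_featureVec_pow_four_le (hν : IsProbDensity ν)
    (hfm : ∀ l, 1 ≤ l → Measurable (f l))
    (hτ : IsWeightSequence τ) {ηf : ℝ}
    (hf4 : ∀ l, 1 ≤ l → Integrable (fun s => |f l s| ^ 4 * ν s) ∧ ∫ s, |f l s| ^ 4 * ν s ≤ ηf)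
    (m : ℕ) :
    ∫⁻ w, ENNReal.ofReal (‖featureVec τ f m w‖ ^ 4) ∂(densityMeasure ν)
      ≤ ENNReal.ofReal (ηf * (∑ j : Fin m, τ (j + 1)) ^ 2) := by
  have h0 : ∀ j : Fin m, 0 ≤ τ (j + 1) := fun j => (hτ.pos _ (by omega)).le
  set T := ∑ j : Fin m, τ (j + 1) with hT
  have hT0 : 0 ≤ T := Finset.sum_nonneg fun j _ => h0 j
  have hone : ∀ l, 1 ≤ l → ∫⁻ w, ENNReal.ofReal (|f l w| ^ 4) ∂(densityMeasure ν)
      ≤ ENNReal.ofReal ηf := fun l hl => by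
    have h4m : Measurable fun w => ENNReal.ofReal (|f l w| ^ 4) :=
      ((hfm l hl).abs.pow_const 4).ennreal_ofReal
    rw [densityMeasure, lintegral_withDensity_eq_lintegral_mul _ hν.measurable.ennreal_ofReal h4m]
    have e : ∀ w, ((fun x => ENNReal.ofReal (ν x)) * fun w => ENNReal.ofReal (|f l w| ^ 4)) w
        = ENNReal.ofReal (|f l w| ^ 4 * ν w) := fun w => by
      rw [Pi.mul_apply, mul_comm, ENNReal.ofReal_mul (by positivity)]
    simp_rw [e]
    rw [← ofReal_integral_eq_lintegral_ofReal (hf4 l hl).1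
      (ae_of_all _ fun w => mul_nonneg (by positivity) (hν.nonneg w))]
    exact ENNReal.ofReal_le_ofReal (hf4 l hl).2
  calc _ ≤ ∫⁻ w, ENNReal.ofReal T * ∑ j : Fin m,
          ENNReal.ofReal (τ (j + 1)) * ENNReal.ofReal (|f (j + 1) w| ^ 4) ∂(densityMeasure ν) := by
        refine lintegral_mono fun w => ?_
        refine (ENNReal.ofReal_le_ofReal (norm_featureVec_pow_four_le hτ m w)).trans (le_of_eq ?_)
        rw [ENNReal.ofReal_mul hT0, ENNReal.ofReal_sum_of_nonneg
          fun j _ => mul_nonneg (h0 j) (by positivity)]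
        congr 1
        exact Finset.sum_congr rfl fun j _ => ENNReal.ofReal_mul (h0 j)
    _ = ENNReal.ofReal T * ∑ j : Fin m, ENNReal.ofReal (τ (j + 1)) *
          ∫⁻ w, ENNReal.ofReal (|f (j + 1) w| ^ 4) ∂(densityMeasure ν) := by
        have hm4 : ∀ j : Fin m, Measurable fun w => ENNReal.ofReal (|f (j + 1) w| ^ 4) := fun j =>
          ((hfm _ (by omega)).abs.pow_const 4).ennreal_ofReal
        rw [lintegral_const_mul' _ _ ENNReal.ofReal_ne_top,
          lintegral_finsetSum _ fun j _ => (hm4 j).const_mul _]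
        congr 1
        exact Finset.sum_congr rfl fun j _ => lintegral_const_mul' _ _ ENNReal.ofReal_ne_top
    _ ≤ ENNReal.ofReal T * ∑ j : Fin m, ENNReal.ofReal (τ (j + 1)) * ENNReal.ofReal ηf := by
        gcongr with j _
        exact hone _ (by omega)
    _ = _ := by
        rw [← Finset.sum_mul, ← ENNReal.ofReal_sum_of_nonneg fun j _ => h0 j, ← hT,
          ← ENNReal.ofReal_mul hT0, ← ENNReal.ofReal_mul hT0]
        congr 1; ring

end Reference

end ModelMoments

/-! ### Moments of the errors, and the population least squares form. -/

section ErrorMoments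

local notation "⟪" x ", " y "⟫" => inner ℝ x y

variable {Ω : Type*} [MeasurableSpace Ω] {P : Measure Ω} [IsProbabilityMeasure P]

/-- The bounds are first obtained on `Ω` and then transported to the law of one observation, on
whose space the i.i.d. sample is described by coordinate functions. -/
lemma RegressionBounds.map {𝓧 : Type*} [MeasurableSpace 𝓧] {m k : ℕ} {u r : 𝓧 → ℝ}
    {F : 𝓧 → EuclideanSpace ℝ (Fin m)} {e : 𝓧 → EuclideanSpace ℝ (Fin k)} {b c T δ : ℝ}
    {g : Ω → 𝓧} (hg : Measurable g) (hu : Measurable u) (hr : Measurable r) (hF : Measurable F)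
    (he : Measurable e)
    (h : RegressionBounds P (fun ω => u (g ω)) (fun ω => r (g ω)) (fun ω => F (g ω))
      (fun ω => e (g ω)) b c T δ) :
    RegressionBounds (P.map g) u r F e b c T δ := by
  have I : ∀ {q : 𝓧 → ℝ}, Measurable q → ∫ x, q x ∂(P.map g) = ∫ ω, q (g ω) ∂P := fun hq =>
    integral_map hg.aemeasurable hq.aestronglyMeasurable
  have huF : Measurable fun x => u x • F x := hu.smul hF
  have hue : Measurable fun x => u x • e x := hu.smul he
  exact
  { one_le := h.one_le
    pos := h.pos
    T_pos := h.T_pos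
    k_pos := h.k_pos
    δ_nonneg := h.δ_nonneg
    meas_u := hu
    meas_r := hr
    meas_F := hF
    meas_e := he
    memLp_F := (memLp_map_measure_iff hF.aestronglyMeasurable hg.aemeasurable).2 h.memLp_F
    memLp_uF := (memLp_map_measure_iff huF.aestronglyMeasurable hg.aemeasurable).2 h.memLp_uF
    memLp_ue := (memLp_map_measure_iff hue.aestronglyMeasurable hg.aemeasurable).2 h.memLp_ue
    mean_uF := fun s => (I (measurable_const.inner huF)).trans (h.mean_uF s)
    mean_ue := fun s => (I (measurable_const.inner hue)).trans (h.mean_ue s)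
    F_four := (I (hF.norm.pow_const 4)).trans_le h.F_four
    F_two := (I (hF.norm.pow_const 2)).trans_le h.F_two
    uF_two := (I (huF.norm.pow_const 2)).trans_le h.uF_two
    F_form := fun a => (I ((measurable_const.inner hF).pow_const 2)).trans_le (h.F_form a)
    uF_form := fun a => (I ((measurable_const.inner huF).pow_const 2)).trans_le (h.uF_form a)
    e_bound := (ae_map_iff hg.aemeasurable
      (measurableSet_le (he.norm.pow_const 2) measurable_const)).2 h.e_bound
    ue_two := (I (hue.norm.pow_const 2)).trans_le h.ue_two
    r_bound := (ae_map_iff hg.aemeasurable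
      (measurableSet_le (hr.pow_const 2) measurable_const)).2 h.r_bound
    e_form := fun a => (h.e_form a).trans_eq (I ((he.inner measurable_const).pow_const 2)).symm }

section Domination

variable {d : ℕ} {W : Ω → Euc d} {μ₀ : Measure (Euc d)} {η K : ℝ} {g : Euc d → ℝ}

lemma integral_comp_le_of_le_smul (hW : Measurable W) (hη : 0 ≤ η)
    (hdom : P.map W ≤ ENNReal.ofReal η • μ₀) (hg : Measurable g) (h0 : ∀ w, 0 ≤ g w) (hK : 0 ≤ K)
    (h : ∫⁻ w, ENNReal.ofReal (g w) ∂μ₀ ≤ ENNReal.ofReal K) :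
    Integrable (fun ω => g (W ω)) P ∧ ∫ ω, g (W ω) ∂P ≤ η * K := by
  refine integrable_and_integral_le_of_lintegral_le (g := fun ω => g (W ω))
    (hg.comp hW).aestronglyMeasurable (fun ω => h0 _) (by positivity) ?_
  rw [← lintegral_map hg.ennreal_ofReal hW, ENNReal.ofReal_mul hη]
  refine (lintegral_mono' hdom le_rfl).trans ?_
  rw [lintegral_smul_measure, smul_eq_mul]
  gcongr

lemma integral_mul_comp_le_of_le_smul (hW : Measurable W) (hη : 0 ≤ η)
    (hdom : P.map W ≤ ENNReal.ofReal η • μ₀) (hg : Measurable g) (h0 : ∀ w, 0 ≤ g w) (hK : 0 ≤ K)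
    (h : ∫⁻ w, ENNReal.ofReal (g w) ∂μ₀ ≤ ENNReal.ofReal K) {V : Ω → ℝ} (hV0 : ∀ ω, 0 ≤ V ω)
    (hV : Integrable V P) {C : ℝ} (hC : 0 ≤ C) (hc : ∀ᵐ ω ∂P, condExpGiven P V W ω ≤ C) :
    Integrable (fun ω => V ω * g (W ω)) P ∧ ∫ ω, V ω * g (W ω) ∂P ≤ C * (η * K) := by
  refine integrable_and_integral_le_of_lintegral_le (g := fun ω => V ω * g (W ω))
    (hV.1.mul (hg.comp hW).aestronglyMeasurable)
    (fun ω => mul_nonneg (hV0 _) (h0 _)) (by positivity) ?_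
  simp_rw [fun ω => ENNReal.ofReal_mul (q := g (W ω)) (hV0 ω)]
  refine (lintegral_mul_comp_le_of_condExp_le hW hV0 hV hC hc hg.ennreal_ofReal).trans ?_
  rw [ENNReal.ofReal_mul hC, ENNReal.ofReal_mul hη]
  gcongr
  refine (lintegral_mono' hdom le_rfl).trans ?_
  rw [lintegral_smul_measure, smul_eq_mul]
  gcongr

end Domination

/-- `g(V)` is pulled out of the conditional expectation given `V`, and the tower property is
applied. It serves for both moment conditions, `E[U | W] = 0` and `E[U | Z] = 0`. -/
lemma integral_mul_comp_eq_zero_of_condExp_eq_zero {d : ℕ} {U : Ω → ℝ} {V : Ω → Euc d}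
    (hV : Measurable V) (hU : Integrable U P) (h0 : condExpGiven P U V =ᵐ[P] 0) {g : Euc d → ℝ}
    (hg : Measurable g) (hi : Integrable (fun ω => U ω * g (V ω)) P) :
    ∫ ω, U ω * g (V ω) ∂P = 0 := by
  have hgm : StronglyMeasurable[MeasurableSpace.comap V inferInstance] (fun ω => g (V ω)) :=
    (hg.comp (comap_measurable V)).stronglyMeasurable
  have h := condExp_mul_of_stronglyMeasurable_right hgm hi hU
  rw [← integral_condExp hV.comap_le, integral_congr_ae (g := fun _ => (0 : ℝ)), integral_zero]
  refine h.trans ?_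
  filter_upwards [h0] with ω hω
  rw [condExpGiven] at hω
  rw [Pi.mul_apply, hω, Pi.zero_apply, zero_mul]

/-- Under exogeneity the error has conditional mean zero given the regressors. -/
lemma condExpGiven_error_eq_zero {dz dw : ℕ} {Y : Ω → ℝ} {Z : Ω → Euc dz} {W : Ω → Euc dw}
    (hZ : Measurable Z) {φ : Euc dz → ℝ} {U : Ω → ℝ} (hmodel : IsIVModel P Y Z W φ U)
    (h : (fun ω => φ (Z ω)) =ᵐ[P] condExpGiven P Y Z) : condExpGiven P U Z =ᵐ[P] 0 := by
  have hφ : Integrable (fun ω => φ (Z ω)) P := hmodel.memLp_φ.integrable (by norm_num)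
  have hY : Y = (fun ω => φ (Z ω)) + U := funext hmodel.model
  have hm : StronglyMeasurable[MeasurableSpace.comap Z inferInstance] (fun ω => φ (Z ω)) :=
    (hmodel.measurable_φ.comp (comap_measurable Z)).stronglyMeasurable
  have h1 := condExp_add hφ hmodel.integrable_U (MeasurableSpace.comap Z inferInstance)
  rw [condExp_of_stronglyMeasurable hZ.comap_le hm hφ] at h1
  rw [condExpGiven, hY] at h
  filter_upwards [h, h1] with ω h2 h3
  rw [h3] at h2
  simpa [condExpGiven] using h2

/-- The vector `(e_1(z), …, e_k(z))`. -/
noncomputable def regressorVec {d : ℕ} (e : ℕ → Euc d → ℝ) (k : ℕ) (z : Euc d) :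
    EuclideanSpace ℝ (Fin k) := WithLp.toLp 2 fun l => e (l + 1) z

lemma measurable_regressorVec {d : ℕ} {e : ℕ → Euc d → ℝ}
    (he : ∀ l, 1 ≤ l → Measurable (e l)) (k : ℕ) : Measurable (regressorVec e k) := by
  have h : Measurable fun z : Euc d => fun j : Fin k => e (j + 1) z :=
    measurable_pi_lambda _ fun j => he _ (by omega)
  exact (PiLp.continuous_toLp 2 _).measurable.comp h

lemma inner_regressorVec {d : ℕ} (e : ℕ → Euc d → ℝ) {k : ℕ} (z : Euc d) (β : Fin k → ℝ) :
    ⟪regressorVec e k z, WithLp.toLp 2 β⟫ = seriesEval e k β z := by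
  simp [regressorVec, seriesEval, PiLp.inner_apply]

lemma norm_regressorVec_sq {d : ℕ} (e : ℕ → Euc d → ℝ) (k : ℕ) (z : Euc d) :
    ‖regressorVec e k z‖ ^ 2 = ∑ l ∈ Finset.Icc 1 k, e l z ^ 2 := by
  rw [EuclideanSpace.real_norm_sq_eq, sum_Icc_one_eq_sum_fin]
  rfl

/-- A lower bound on the spectrum of the second moment matrix bounds the quadratic form. -/
lemma mul_norm_sq_le_integral_inner_regressorVec {d : ℕ} {Z : Ω → Euc d} {e : ℕ → Euc d → ℝ}
    (he : ∀ j, 1 ≤ j → MemLp (fun ω => e j (Z ω)) 2 P) {k : ℕ} {c : ℝ}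
    (hc : ∀ x ∈ spectrum ℝ (secondMoment P Z e k), c ≤ x) (a : EuclideanSpace ℝ (Fin k)) :
    c * ‖a‖ ^ 2 ≤ ∫ ω, ⟪regressorVec e k (Z ω), a⟫ ^ 2 ∂P := by
  set Q := secondMoment P Z e k with hQ
  have hH : (Q - c • (1 : Matrix (Fin k) (Fin k) ℝ)).IsHermitian := by
    refine Matrix.IsHermitian.ext fun i j => ?_
    by_cases hij : i = j
    · subst hij; simp
    · simp [hQ, secondMoment, hij, Ne.symm hij, mul_comm]
  -- Subtracting `c` times the identity shifts the spectrum by `c`, so it becomes nonnegative.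
  have hpsd : (Q - c • (1 : Matrix (Fin k) (Fin k) ℝ)).PosSemidef := by
    refine Matrix.posSemidef_iff_isHermitian_and_spectrum_nonneg.2 ⟨hH, fun x hx => ?_⟩
    rw [← Algebra.algebraMap_eq_smul_one, ← spectrum.sub_singleton_eq] at hx
    obtain ⟨y, hy, z, hz, rfl⟩ := hx
    rw [Set.mem_singleton_iff] at hz
    have := hc y hy
    show 0 ≤ y - z
    linarith
  have h := hpsd.dotProduct_mulVec_nonneg a.ofLp
  have hi : ∀ i j : Fin k, Integrable (fun ω =>
      (a i * a j) * (e (i + 1) (Z ω) * e (j + 1) (Z ω))) P := fun i j =>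
    ((he _ (by omega)).integrable_mul (he _ (by omega))).const_mul _
  have h1 : ∫ ω, ⟪regressorVec e k (Z ω), a⟫ ^ 2 ∂P = ∑ i, ∑ j, (a i * a j) * Q i j := by
    have e1 : ∀ ω, ⟪regressorVec e k (Z ω), a⟫ ^ 2
        = ∑ i : Fin k, ∑ j : Fin k, (a i * a j) * (e (i + 1) (Z ω) * e (j + 1) (Z ω)) := fun ω => by
      rw [PiLp.inner_apply, sq, Finset.sum_mul_sum]
      refine Finset.sum_congr rfl fun j _ => Finset.sum_congr rfl fun l _ => ?_
      simp [regressorVec]; ring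
    simp_rw [e1]
    rw [integral_finsetSum _ fun i _ => integrable_finsetSum _ fun j _ => hi i j]
    refine Finset.sum_congr rfl fun i _ => ?_
    rw [integral_finsetSum _ fun j _ => hi i j]
    refine Finset.sum_congr rfl fun j _ => ?_
    rw [integral_const_mul]
    rfl
  rw [h1]
  rw [Matrix.sub_mulVec, Matrix.smul_mulVec, Matrix.one_mulVec, dotProduct_sub, dotProduct_smul,
    sub_nonneg] at h
  calc c * ‖a‖ ^ 2 = c • (star a.ofLp ⬝ᵥ a.ofLp) := by
        rw [EuclideanSpace.real_norm_sq_eq, smul_eq_mul]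
        simp [dotProduct, sq]
    _ ≤ _ := h
    _ = _ := by
        simp only [dotProduct, Matrix.mulVec, Finset.mul_sum]
        refine Finset.sum_congr rfl fun i _ => Finset.sum_congr rfl fun j _ => ?_
        simp; ring

end ErrorMoments

/-! ### The model satisfies the abstract moment bounds, uniformly in `n`. -/

section ModelBounds

local notation "⟪" x ", " y "⟫" => inner ℝ x y

variable {Ω : Type*} [MeasurableSpace Ω] {P : Measure Ω} [IsProbabilityMeasure P]

lemma IsWeightSequence.one_le_sum {τ : ℕ → ℝ} (hτ : IsWeightSequence τ) {m : ℕ} (hm : 0 < m) :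
    1 ≤ ∑ j ∈ Finset.Icc 1 m, τ j := by
  rw [← hτ.one]
  exact Finset.single_le_sum (fun j hj => (hτ.pos j (Finset.mem_Icc.1 hj).1).le)
    (Finset.mem_Icc.2 ⟨le_rfl, hm⟩)

/-- From `‖g‖² ≤ ‖g‖⁴ / (2T) + T / 2`; the second half is absorbed by `b ≥ 1`. -/
lemma integral_norm_sq_le_of_four {E : Type*} [NormedAddCommGroup E] {g : Ω → E} {b T : ℝ}
    (hb : 1 ≤ b) (hT : 0 < T) (hg : MemLp g 4 P) (h : ∫ ω, ‖g ω‖ ^ 4 ∂P ≤ b * T ^ 2) :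
    ∫ ω, ‖g ω‖ ^ 2 ∂P ≤ b * T := by
  have hi := (memLp_four_iff hg.1).1 hg
  have h1 : ∫ ω, ‖g ω‖ ^ 2 ∂P ≤ ∫ ω, ((2 * T)⁻¹ * ‖g ω‖ ^ 4 + T / 2) ∂P := by
    refine integral_mono (hg.mono_exponent (by norm_num)).norm.integrable_sq
      ((hi.const_mul _).add (integrable_const _)) fun ω => ?_
    have : (2 * T)⁻¹ * ‖g ω‖ ^ 4 + T / 2 - ‖g ω‖ ^ 2 = (2 * T)⁻¹ * (‖g ω‖ ^ 2 - T) ^ 2 := by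
      field_simp; ring
    have h2 : 0 ≤ (2 * T)⁻¹ * (‖g ω‖ ^ 2 - T) ^ 2 := by positivity
    show ‖g ω‖ ^ 2 ≤ (2 * T)⁻¹ * ‖g ω‖ ^ 4 + T / 2
    linarith
  rw [integral_add (hi.const_mul _) (integrable_const _), integral_const_mul] at h1
  simp only [integral_const, probReal_univ, one_smul] at h1
  have h3 : (2 * T)⁻¹ * ∫ ω, ‖g ω‖ ^ 4 ∂P ≤ (2 * T)⁻¹ * (b * T ^ 2) := by gcongr
  have h4 : (2 * T)⁻¹ * (b * T ^ 2) = b * T / 2 := by field_simp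
  nlinarith

variable {dz dw : ℕ} {Y : Ω → ℝ} {Z : Ω → Euc dz} {W : Ω → Euc dw}
  {φ φ₀ : Euc dz → ℝ} {U : Ω → ℝ} {pW ν : Euc dw → ℝ} {f : ℕ → Euc dw → ℝ} {τ : ℕ → ℝ}
  {e : ℕ → Euc dz → ℝ} {ϖ : ℕ → ℝ} {k m : ℕ → ℕ}

lemma sq_le_pow_four_add_one (x : ℝ) : x ^ 2 ≤ x ^ 4 + 1 := by
  nlinarith [sq_nonneg (x ^ 2 - 1), sq_nonneg x]

lemma exists_error_moment_bounds (hW : Measurable W) (hmodel : IsIVModel P Y Z W φ U)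
    (hUm : Measurable U)
    (hWlaw : P.map W = densityMeasure pW) (hν : IsProbDensity ν)
    (hf : IsOrthonormalBasisOfL2 ν f) (hbounds : BasisAndDensityBounds P W f ν pW)
    (hU4 : CondFourthMomentBound P U W) (hτ : IsWeightSequence τ) :
    ∃ b : ℝ, 1 ≤ b ∧ MemLp U 4 P ∧ ∀ m : ℕ,
      (MemLp (fun ω => featureVec τ f m (W ω)) 4 P ∧
        ∫ ω, ‖featureVec τ f m (W ω)‖ ^ 4 ∂P ≤ b * (∑ j ∈ Finset.Icc 1 m, τ j) ^ 2) ∧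
      (MemLp (fun ω => U ω • featureVec τ f m (W ω)) 4 P ∧
        ∫ ω, ‖U ω • featureVec τ f m (W ω)‖ ^ 4 ∂P ≤ b * (∑ j ∈ Finset.Icc 1 m, τ j) ^ 2) ∧
      (∀ a, ∫ ω, ⟪a, featureVec τ f m (W ω)⟫ ^ 2 ∂P ≤ b * ‖a‖ ^ 2) ∧
      (∀ a, ∫ ω, ⟪a, U ω • featureVec τ f m (W ω)⟫ ^ 2 ∂P ≤ b * ‖a‖ ^ 2) ∧
      ∀ a, ∫ ω, ⟪a, U ω • featureVec τ f m (W ω)⟫ ∂P = 0 := by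
  obtain ⟨ηf, ηp, hηf, hηp, hf4, hpos, hratio⟩ := hbounds
  obtain ⟨σ, hσ, hU4i, hU4c⟩ := hU4
  have hdom := map_le_smul_densityMeasure hWlaw (by linarith) hpos hratio
  have hηp0 : 0 ≤ ηp := by linarith
  have hσ4 : 0 ≤ σ ^ 4 := by positivity
  have hηηp : ηp ≤ ηp * ηf := le_mul_of_one_le_right hηp0 hηf
  have hηη : 1 ≤ ηp * ηf := hηp.trans hηηp
  have hb1 : ηp * ηf ≤ (σ ^ 4 + 1) * (ηp * ηf) := by nlinarith
  have hb2 : σ ^ 4 * (ηp * ηf) ≤ (σ ^ 4 + 1) * (ηp * ηf) := by nlinarith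
  have hU0 : ∀ ω, 0 ≤ U ω ^ 4 := fun ω => by positivity
  have hUL : MemLp U 4 P := by
    rw [memLp_four_iff hUm.aestronglyMeasurable]
    simpa only [Real.norm_eq_abs, Even.pow_abs (show Even 4 by decide)] using hU4i
  -- One constant for all bounds: `ηp` comes from changing the law of `W` to `ν`, `ηf` from the
  -- fourth moments of the basis, `σ⁴` from the error, and the 1 from `U² ≤ U⁴ + 1`.
  refine ⟨(σ ^ 4 + 1) * (ηp * ηf), hηη.trans hb1, hUL, fun m => ?_⟩
  rw [sum_Icc_one_eq_sum_fin]
  set T := ∑ j : Fin m, τ (j + 1) with hT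
  have hFm := measurable_featureVec (τ := τ) hf.1 m
  have hFWm : Measurable fun ω => featureVec τ f m (W ω) := hFm.comp hW
  have hUFm : Measurable fun ω => U ω • featureVec τ f m (W ω) := hUm.smul hFWm
  have h4 := lintegral_norm_featureVec_pow_four_le hν hf.1 hτ hf4 m
  rw [← hT] at h4
  have h40 : 0 ≤ ηf * T ^ 2 := by positivity
  have hF4 := integral_comp_le_of_le_smul hW hηp0 hdom (hFm.norm.pow_const 4)
    (fun w => by positivity) h40 h4
  have hUF4 := integral_mul_comp_le_of_le_smul hW hηp0 hdom (hFm.norm.pow_const 4)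
    (fun w => by positivity) h40 h4 hU0 hU4i hσ4 hU4c
  have hT2 : 0 ≤ T ^ 2 := sq_nonneg T
  have eUF : ∀ ω, ‖U ω • featureVec τ f m (W ω)‖ ^ 4 = U ω ^ 4 * ‖featureVec τ f m (W ω)‖ ^ 4 :=
    fun ω => by
      rw [norm_smul, mul_pow, Real.norm_eq_abs, Even.pow_abs (by decide)]
  have hFL : MemLp (fun ω => featureVec τ f m (W ω)) 4 P :=
    (memLp_four_iff hFWm.aestronglyMeasurable).2 hF4.1
  have hUFL : MemLp (fun ω => U ω • featureVec τ f m (W ω)) 4 P :=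
    (memLp_four_iff hUFm.aestronglyMeasurable).2 (by simpa only [eUF] using hUF4.1)
  have hform := fun a : EuclideanSpace ℝ (Fin m) =>
    integral_comp_le_of_le_smul hW hηp0 hdom
      ((hFm.const_inner (𝕜 := ℝ) (c := a)).pow_const 2) (fun w => sq_nonneg _)
      (sq_nonneg _) (lintegral_inner_featureVec_sq_le hf hτ a)
  have hUform := fun a : EuclideanSpace ℝ (Fin m) =>
    integral_mul_comp_le_of_le_smul hW hηp0 hdom
      ((hFm.const_inner (𝕜 := ℝ) (c := a)).pow_const 2) (fun w => sq_nonneg _)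
      (sq_nonneg _) (lintegral_inner_featureVec_sq_le hf hτ a) hU0 hU4i hσ4 hU4c
  refine ⟨⟨hFL, hF4.2.trans ?_⟩, ⟨hUFL, ?_⟩, fun a => (hform a).2.trans ?_, fun a => ?_,
    fun a => ?_⟩
  · nlinarith
  · simp_rw [eUF]
    refine hUF4.2.trans ?_
    nlinarith
  · gcongr
    linarith
  -- The inequality `U² ≤ U⁴ + 1` reduces the second moment to the available bound on `E[U⁴ | W]`.
  · have h2 : ∫ ω, ⟪a, U ω • featureVec τ f m (W ω)⟫ ^ 2 ∂P
        ≤ ∫ ω, (U ω ^ 4 * ⟪a, featureVec τ f m (W ω)⟫ ^ 2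
          + ⟪a, featureVec τ f m (W ω)⟫ ^ 2) ∂P := by
      refine integral_mono ((hUFL.mono_exponent (by norm_num)).const_inner a).integrable_sq
        ((hUform a).1.add (hform a).1) fun ω => ?_
      show ⟪a, U ω • featureVec τ f m (W ω)⟫ ^ 2 ≤ U ω ^ 4 * ⟪a, featureVec τ f m (W ω)⟫ ^ 2
          + ⟪a, featureVec τ f m (W ω)⟫ ^ 2
      rw [real_inner_smul_right, mul_pow]
      nlinarith [sq_le_pow_four_add_one (U ω), sq_nonneg ⟪a, featureVec τ f m (W ω)⟫]
    rw [integral_add (hUform a).1 (hform a).1] at h2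
    have h3 := (hUform a).2
    have h5 := (hform a).2
    calc _ ≤ σ ^ 4 * (ηp * ‖a‖ ^ 2) + ηp * ‖a‖ ^ 2 := h2.trans (add_le_add h3 h5)
      _ = ((σ ^ 4 + 1) * ηp) * ‖a‖ ^ 2 := by ring
      _ ≤ _ := by gcongr
  · have hi := ((hUFL.mono_exponent (by norm_num)).const_inner (𝕜 := ℝ) a).integrable
      (by norm_num : (1 : ℝ≥0∞) ≤ 2)
    simp_rw [real_inner_smul_right] at hi ⊢
    exact integral_mul_comp_eq_zero_of_condExp_eq_zero hW hmodel.integrable_U hmodel.condExp_U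
      (hFm.const_inner (𝕜 := ℝ) (c := a)) hi

/-- The regression of `Y` on the first `k n` regressors satisfies the moment bounds with constants
that do not depend on `n`. -/
lemma exists_regressionBounds (hY : Measurable Y) (hZ : Measurable Z) (hW : Measurable W)
    (hmodel : IsIVModel P Y Z W φ U)
    (hWlaw : P.map W = densityMeasure pW) (hν : IsProbDensity ν)
    (hf : IsOrthonormalBasisOfL2 ν f) (hbounds : BasisAndDensityBounds P W f ν pW)
    (hU4 : CondFourthMomentBound P U W) (hτ : IsWeightSequence τ)
    (hφ₀ : (fun ω => φ₀ (Z ω)) =ᵐ[P] condExpGiven P Y Z)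
    (hk : Tendsto k atTop atTop) (hm : Tendsto m atTop atTop)
    (hseries : SeriesConditions P Z U φ₀ e ϖ k)
    (hExog : (fun ω => φ (Z ω)) =ᵐ[P] fun ω => φ₀ (Z ω)) :
    ∃ b c C : ℝ, ∃ β : (κ : ℕ) → Fin κ → ℝ, 0 ≤ C ∧ ∀ᶠ n in atTop, 1 ≤ ϖ (k n) ∧
      RegressionBounds P U (fun ω => φ (Z ω) - seriesEval e (k n) (β (k n)) (Z ω))
        (fun ω => featureVec τ f (m n) (W ω)) (fun ω => regressorVec e (k n) (Z ω)) b c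
        (∑ j ∈ Finset.Icc 1 (m n), τ j) (C / ϖ (k n)) := by
  have hUeq : U = fun ω => Y ω - φ (Z ω) := funext fun ω => by rw [hmodel.model ω]; ring
  have hUm : Measurable U := by
    rw [hUeq]; exact hY.sub (hmodel.measurable_φ.comp hZ)
  -- Exogeneity makes the error orthogonal to the regressors as well as to the instruments.
  have hUZ := condExpGiven_error_eq_zero hZ hmodel (hExog.trans hφ₀)
  obtain ⟨b₁, hb₁, hUL, hmom⟩ :=
    exists_error_moment_bounds hW hmodel hUm hWlaw hν hf hbounds hU4 hτ
  obtain ⟨ηe, hηe, he⟩ := hseries.basis_bound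
  obtain ⟨c, hc, heig⟩ := hseries.eigenvalue_bound
  obtain ⟨-, -, β, C, hC⟩ := hseries.mem_approxClass
  have hUL2 : MemLp U 2 P := hUL.mono_exponent (by norm_num)
  have hEU0 : 0 ≤ ∫ ω, U ω ^ 2 ∂P := integral_nonneg fun _ => sq_nonneg _
  -- The three summands dominate the bounds for the instruments, for `‖e‖²`, and for `E‖U e‖²`; none
  -- depends on `n`.
  set b := b₁ + ηe + ηe * ∫ ω, U ω ^ 2 ∂P with hb
  have hbU0 : 0 ≤ ηe * ∫ ω, U ω ^ 2 ∂P := by positivity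
  have hbb₁ : b₁ ≤ b := by rw [hb]; linarith
  have hbηe : ηe ≤ b := by rw [hb]; linarith
  have hbU : ηe * ∫ ω, U ω ^ 2 ∂P ≤ b := by rw [hb]; linarith
  have hb1 : 1 ≤ b := hb₁.trans hbb₁
  clear_value b
  refine ⟨b, c, max C 0, β, le_max_right _ _, ?_⟩
  have hsupp : ∀ᵐ ω ∂P, Z ω ∈ (P.map Z).support :=
    ae_of_ae_map hZ.aemeasurable Measure.support_mem_ae
  filter_upwards [eventually_ge_atTop 1, hk.eventually_ge_atTop 1, hm.eventually_ge_atTop 1, hC]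
    with n hn hkn hmn hCn
  have hϖ : 1 ≤ ϖ (k n) := by rw [← hseries.ϖ_one]; exact hseries.ϖ_mono _ _ le_rfl hkn
  obtain ⟨⟨hF4, hF4b⟩, ⟨hUF4, hUF4b⟩, hFf, hUFf, hUF0⟩ := hmom (m n)
  set T := ∑ j ∈ Finset.Icc 1 (m n), τ j with hT
  have hT0 : 0 < T := zero_lt_one.trans_le (hτ.one_le_sum hmn)
  have hF4b' : ∫ ω, ‖featureVec τ f (m n) (W ω)‖ ^ 4 ∂P ≤ b * T ^ 2 := hF4b.trans (by gcongr)
  have hUF4b' : ∫ ω, ‖U ω • featureVec τ f (m n) (W ω)‖ ^ 4 ∂P ≤ b * T ^ 2 :=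
    hUF4b.trans (by gcongr)
  have hem := measurable_regressorVec hseries.measurable_e (k n)
  have hsm : Measurable (seriesEval e (k n) (β (k n))) := by
    simp_rw [funext fun z => (inner_regressorVec e z (β (k n))).symm]
    exact hem.inner measurable_const
  have heb : ∀ᵐ ω ∂P, ‖regressorVec e (k n) (Z ω)‖ ^ 2 ≤ ηe * k n := by
    filter_upwards [hsupp] with ω hω
    rw [norm_regressorVec_sq]
    exact he n hn _ hω
  have hue : MemLp (fun ω => U ω • regressorVec e (k n) (Z ω)) 2 P := by
    have h1 : MemLp (fun ω => regressorVec e (k n) (Z ω)) ∞ P := by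
      refine MemLp.of_bound (hem.comp hZ).aestronglyMeasurable (√(ηe * k n)) ?_
      filter_upwards [heb] with ω hω
      exact Real.le_sqrt_of_sq_le hω
    have h2 := h1.smul hUL2 (r := 2)
    exact h2
  refine ⟨hϖ, ?_⟩
  exact
  { one_le := hb1
    pos := hc
    T_pos := hT0
    k_pos := hkn
    δ_nonneg := by positivity
    meas_u := hUm
    meas_r := (hmodel.measurable_φ.comp hZ).sub (hsm.comp hZ)
    meas_F := (measurable_featureVec hf.1 (m n)).comp hW
    meas_e := hem.comp hZ
    memLp_F := hF4
    memLp_uF := hUF4.mono_exponent (by norm_num)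
    memLp_ue := hue
    mean_uF := hUF0
    mean_ue := fun s => by
      have hi := (hue.const_inner (𝕜 := ℝ) s).integrable (by norm_num : (1 : ℝ≥0∞) ≤ 2)
      simp_rw [real_inner_smul_right] at hi ⊢
      exact integral_mul_comp_eq_zero_of_condExp_eq_zero hZ hmodel.integrable_U hUZ
        (hem.const_inner (𝕜 := ℝ) (c := s)) hi
    F_four := hF4b'
    F_two := integral_norm_sq_le_of_four hb1 hT0 hF4 hF4b'
    uF_two := integral_norm_sq_le_of_four hb1 hT0 hUF4 hUF4b'
    F_form := fun a => (hFf a).trans (by gcongr)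
    uF_form := fun a => (hUFf a).trans (by gcongr)
    e_bound := by
      filter_upwards [heb] with ω hω
      exact hω.trans (by gcongr)
    ue_two := by
      calc ∫ ω, ‖U ω • regressorVec e (k n) (Z ω)‖ ^ 2 ∂P
          ≤ ∫ ω, U ω ^ 2 * (ηe * k n) ∂P := by
            refine integral_mono_ae hue.norm.integrable_sq (hUL2.integrable_sq.mul_const _) ?_
            filter_upwards [heb] with ω hω
            rw [norm_smul, mul_pow, Real.norm_eq_abs, sq_abs]
            gcongr
        _ = (ηe * ∫ ω, U ω ^ 2 ∂P) * k n := by rw [integral_mul_const]; ring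
        _ ≤ _ := by gcongr
    r_bound := by
      filter_upwards [hsupp, hExog] with ω hω h1
      have h2 := hCn _ hω
      rw [h1, ← sq_abs]
      refine h2.trans ?_
      rw [div_eq_mul_inv]
      gcongr
      exact le_max_left _ _
    e_form := mul_norm_sq_le_integral_inner_regressorVec hseries.memLp_e (heig _ hkn) }

end ModelBounds

/-! ### Least squares with an arbitrary generalized inverse. -/

section LeastSquares

variable {n k : ℕ}

/-- The normal equations hold for every generalized inverse. -/
lemma normal_equations (E : Matrix (Fin n) (Fin k) ℝ) {G : Matrix (Fin k) (Fin k) ℝ}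
    (hG : IsGeneralizedInverse (Eᵀ * E) G) (y : Fin n → ℝ) :
    (Eᵀ * E) *ᵥ (G *ᵥ (Eᵀ *ᵥ y)) = Eᵀ *ᵥ y := by
  -- The defining identity of `G` is stated for `EᵗE`, while the normal equations need it with `Eᵗ`
  -- on the right. Cancellation is possible because `M EᵗE = 0` implies `M Eᵗ = 0` for real
  -- matrices.
  have h1 : (Eᵀ * E * G - 1) * (Eᴴ * E) = 0 := by
    rw [Matrix.conjTranspose_eq_transpose_of_trivial, Matrix.sub_mul, Matrix.one_mul, sub_eq_zero]
    exact hG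
  have h2 := (Matrix.mul_conjTranspose_mul_self_eq_zero _ _).1 h1
  rw [Matrix.conjTranspose_eq_transpose_of_trivial, Matrix.sub_mul, Matrix.one_mul,
    sub_eq_zero] at h2
  rw [Matrix.mulVec_mulVec, Matrix.mulVec_mulVec, h2]

lemma posDef_transpose_mul_self_add_smul (E : Matrix (Fin n) (Fin k) ℝ) {ε : ℝ} (hε : 0 < ε) :
    (Eᵀ * E + ε • (1 : Matrix (Fin k) (Fin k) ℝ)).PosDef := by
  have h1 := Matrix.posSemidef_conjTranspose_mul_self E
  rw [Matrix.conjTranspose_eq_transpose_of_trivial] at h1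
  exact Matrix.PosDef.posSemidef_add h1 (Matrix.PosDef.one.smul hε)

/-- The fitted values of a ridge regression converge to the least squares fit. -/
lemma tendsto_ridge_fit (E : Matrix (Fin n) (Fin k) ℝ) {G : Matrix (Fin k) (Fin k) ℝ}
    (hG : IsGeneralizedInverse (Eᵀ * E) G) (y : Fin n → ℝ) (i : Fin n) :
    Tendsto (fun N : ℕ => (E *ᵥ ((Eᵀ * E + (1 / ((N : ℝ) + 1)) • 1)⁻¹ *ᵥ (Eᵀ *ᵥ y))) i)
      atTop (𝓝 ((E *ᵥ (G *ᵥ (Eᵀ *ᵥ y))) i)) := by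
  set θ := G *ᵥ (Eᵀ *ᵥ y) with hθ
  have hn := normal_equations E hG y
  rw [← hθ] at hn
  -- The difference `v` between the least squares and the ridge coefficients solves `(EᵗE + ε) v = ε
  -- θ`. Testing against `v` gives `|E v|² + ε |v|² = ε ⟨v, θ⟩`, hence `|E v|² ≤ ε |θ|²`: the fit
  -- converges even when the coefficients are not unique.
  have key : ∀ ε : ℝ, 0 < ε →
      |(E *ᵥ ((Eᵀ * E + ε • 1)⁻¹ *ᵥ (Eᵀ *ᵥ y))) i - (E *ᵥ θ) i| ≤ √(ε * (θ ⬝ᵥ θ)) := by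
    intro ε hε
    set B := Eᵀ * E + ε • (1 : Matrix (Fin k) (Fin k) ℝ) with hB
    have hu : IsUnit B.det :=
      (Matrix.isUnit_iff_isUnit_det _).1 (posDef_transpose_mul_self_add_smul E hε).isUnit
    set x := B⁻¹ *ᵥ (Eᵀ *ᵥ y) with hx
    obtain ⟨v, hv⟩ : ∃ v, v = θ - x := ⟨_, rfl⟩
    have hBx : B *ᵥ x = Eᵀ *ᵥ y := by
      rw [hx, Matrix.mulVec_mulVec, Matrix.mul_nonsing_inv _ hu, Matrix.one_mulVec]
    have hBv : Eᵀ *ᵥ (E *ᵥ v) + ε • v = ε • θ := by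
      have h1 : B *ᵥ v = ε • θ := by
        rw [hv, Matrix.mulVec_sub, hBx, hB, Matrix.add_mulVec, hn, Matrix.smul_mulVec,
          Matrix.one_mulVec]
        simp
      rw [← h1, hB, Matrix.add_mulVec, Matrix.smul_mulVec, Matrix.one_mulVec, Matrix.mulVec_mulVec]
    have h2 : (E *ᵥ v) ⬝ᵥ (E *ᵥ v) + ε * (v ⬝ᵥ v) = ε * (v ⬝ᵥ θ) := by
      have := congrArg (fun w => v ⬝ᵥ w) hBv
      simp only [dotProduct_add, dotProduct_smul, smul_eq_mul] at this
      rw [← this, Matrix.dotProduct_mulVec v, Matrix.vecMul_transpose]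
    have h3 : 0 ≤ (θ - v) ⬝ᵥ (θ - v) := by
      simp only [dotProduct]
      exact Finset.sum_nonneg fun _ _ => mul_self_nonneg _
    have h4 : 0 ≤ v ⬝ᵥ v := by
      simp only [dotProduct]
      exact Finset.sum_nonneg fun _ _ => mul_self_nonneg _
    have h5 : 0 ≤ θ ⬝ᵥ θ := by
      simp only [dotProduct]
      exact Finset.sum_nonneg fun _ _ => mul_self_nonneg _
    have h6 : (E *ᵥ v) ⬝ᵥ (E *ᵥ v) ≤ ε * (θ ⬝ᵥ θ) := by
      rw [sub_dotProduct, dotProduct_sub, dotProduct_sub, dotProduct_comm θ v] at h3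
      have : ε * (2 * (v ⬝ᵥ θ)) ≤ ε * (θ ⬝ᵥ θ + v ⬝ᵥ v) :=
        mul_le_mul_of_nonneg_left (by linarith) hε.le
      have h7 : 0 ≤ ε * (v ⬝ᵥ v) := by positivity
      have h8 : 0 ≤ ε * (θ ⬝ᵥ θ) := by positivity
      linarith
    have h9 : (E *ᵥ v) i * (E *ᵥ v) i ≤ (E *ᵥ v) ⬝ᵥ (E *ᵥ v) :=
      Finset.single_le_sum (f := fun j => (E *ᵥ v) j * (E *ᵥ v) j)
        (fun _ _ => mul_self_nonneg _) (Finset.mem_univ i)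
    have h10 : (E *ᵥ x) i - (E *ᵥ θ) i = -(E *ᵥ v) i := by
      rw [hv, Matrix.mulVec_sub]; simp
    rw [h10, abs_neg]
    refine Real.le_sqrt_of_sq_le ?_
    rw [sq_abs, sq]
    exact h9.trans h6
  rw [tendsto_iff_norm_sub_tendsto_zero]
  have hlim : Tendsto (fun N : ℕ => √(1 / ((N : ℝ) + 1) * (θ ⬝ᵥ θ))) atTop (𝓝 0) := by
    have := (tendsto_one_div_add_atTop_nhds_zero_nat (𝕜 := ℝ)).mul_const (θ ⬝ᵥ θ)
    rw [zero_mul] at this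
    have h2 := (Real.continuous_sqrt.tendsto 0).comp this
    rw [Real.sqrt_zero] at h2
    exact h2
  exact squeeze_zero (fun _ => norm_nonneg _) (fun N => key _ (by positivity)) hlim

variable {Ω : Type*} [MeasurableSpace Ω] {P : Measure Ω}

/-- The choice `ω ↦ G ω` may fail to be measurable, but the fitted values are pointwise limits of
ridge fits, which are continuous functions of the data and do not involve `G`. -/
lemma aemeasurable_leastSquares_fit {x : Ω → Fin n → Fin k → ℝ} {y : Ω → Fin n → ℝ}
    (hx : AEMeasurable x P) (hy : AEMeasurable y P) {G : Ω → Matrix (Fin k) (Fin k) ℝ}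
    (hG : ∀ ω, IsGeneralizedInverse ((Matrix.of (x ω))ᵀ * Matrix.of (x ω)) (G ω)) (i : Fin n) :
    AEMeasurable
      (fun ω => (Matrix.of (x ω) *ᵥ (G ω *ᵥ ((Matrix.of (x ω))ᵀ *ᵥ y ω))) i) P := by
  have hcont : ∀ N : ℕ, Continuous fun p : (Fin n → Fin k → ℝ) × (Fin n → ℝ) =>
      (Matrix.of p.1 *ᵥ (((Matrix.of p.1)ᵀ * Matrix.of p.1 + (1 / ((N : ℝ) + 1)) • 1)⁻¹ *ᵥ
        ((Matrix.of p.1)ᵀ *ᵥ p.2))) i := fun N => by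
    have hE : Continuous fun p : (Fin n → Fin k → ℝ) × (Fin n → ℝ) =>
        (Matrix.of p.1 : Matrix (Fin n) (Fin k) ℝ) := continuous_fst
    have hA : Continuous fun p : (Fin n → Fin k → ℝ) × (Fin n → ℝ) =>
        (Matrix.of p.1)ᵀ * Matrix.of p.1
          + (1 / ((N : ℝ) + 1)) • (1 : Matrix (Fin k) (Fin k) ℝ) :=
      (hE.matrix_transpose.matrix_mul hE).add continuous_const
    have hinv : Continuous fun p : (Fin n → Fin k → ℝ) × (Fin n → ℝ) =>
        ((Matrix.of p.1)ᵀ * Matrix.of p.1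
          + (1 / ((N : ℝ) + 1)) • (1 : Matrix (Fin k) (Fin k) ℝ))⁻¹ := by
      simp only [Matrix.inv_def, Ring.inverse_eq_inv']
      refine (hA.matrix_det.inv₀ fun p => ?_).smul hA.matrix_adjugate
      exact ((Matrix.isUnit_iff_isUnit_det _).1
        (posDef_transpose_mul_self_add_smul (Matrix.of p.1) (by positivity)).isUnit).ne_zero
    exact (continuous_apply i).comp (hE.matrix_mulVec
      (hinv.matrix_mulVec (hE.matrix_transpose.matrix_mulVec continuous_snd)))
  exact aemeasurable_of_tendsto_metrizable_ae atTop
    (fun N => (hcont N).measurable.comp_aemeasurable (hx.prodMk hy))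
    (ae_of_all _ fun ω => tendsto_ridge_fit (Matrix.of (x ω)) (hG ω) (y ω) i)

lemma seriesEval_lsCoef {dz : ℕ} (e : ℕ → Euc dz → ℝ) (G : Matrix (Fin k) (Fin k) ℝ) (y : ℕ → ℝ)
    (z : ℕ → Euc dz) (i : Fin n) :
    seriesEval e k (lsCoef e n k G y z) (z i)
      = (designMatrix e n k z *ᵥ (G *ᵥ ((designMatrix e n k z)ᵀ *ᵥ fun i : Fin n => y i))) i := by
  simp only [seriesEval, lsCoef, Matrix.mulVec, dotProduct]
  exact Finset.sum_congr rfl fun l _ => mul_comm _ _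

lemma aemeasurable_exogStatistic {dz dw : ℕ} {τ : ℕ → ℝ} {f : ℕ → Euc dw → ℝ}
    {e : ℕ → Euc dz → ℝ} {Y : ℕ → Ω → ℝ} {Z : ℕ → Ω → Euc dz} {W : ℕ → Ω → Euc dw}
    (hf : ∀ l, 1 ≤ l → Measurable (f l)) (he : ∀ l, 1 ≤ l → Measurable (e l))
    (hY : ∀ i, AEMeasurable (Y i) P) (hZ : ∀ i, AEMeasurable (Z i) P)
    (hW : ∀ i, AEMeasurable (W i) P) (m : ℕ) {G : Ω → Matrix (Fin k) (Fin k) ℝ}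
    (hG : ∀ ω, IsGeneralizedInverse ((designMatrix e n k fun i => Z i ω)ᵀ *
      designMatrix e n k fun i => Z i ω) (G ω)) :
    AEMeasurable (fun ω => exogStatistic τ f e n k m (G ω) (fun i => Y i ω) (fun i => Z i ω)
      (fun i => W i ω)) P := by
  have hx : AEMeasurable (fun ω => fun (i : Fin n) (j : Fin k) => e (j + 1) (Z i ω)) P :=
    aemeasurable_pi_lambda _ fun i => aemeasurable_pi_lambda _ fun j =>
      (he _ (by omega)).comp_aemeasurable (hZ i)
  have hy : AEMeasurable (fun ω => fun i : Fin n => Y i ω) P :=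
    aemeasurable_pi_lambda _ fun i => hY i
  unfold exogStatistic
  refine Finset.aemeasurable_fun_sum _ fun j hj => ?_
  have hj1 := (Finset.mem_Icc.1 hj).1
  refine AEMeasurable.const_mul (AEMeasurable.pow_const (AEMeasurable.abs
    (AEMeasurable.const_mul (Finset.aemeasurable_fun_sum _ fun i _ => ?_) _)) 2) _
  refine ((hY i).sub ?_).mul ((hf j hj1).comp_aemeasurable (hW i))
  simp_rw [seriesEval_lsCoef]
  exact aemeasurable_leastSquares_fit hx hy hG i

end LeastSquares

/-! ### The statistic as a quadratic form; trace and Frobenius norm of its covariance. -/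

section Decomposition

local notation "⟪" x ", " y "⟫" => inner ℝ x y

variable {Ω : Type*} [MeasurableSpace Ω] {P : Measure Ω} [IsProbabilityMeasure P]

lemma norm_partialSum_sq {E : Type*} [NormedAddCommGroup E] [InnerProductSpace ℝ E] (x : ℕ → E)
    (n : ℕ) :
    ‖∑ i ∈ Finset.range n, x i‖ ^ 2 = ∑ i ∈ Finset.range n, ‖x i‖ ^ 2 + 2 * pairSum x n := by
  induction n with
  | zero => simp [pairSum]
  | succ n ih =>
    have hp : pairSum x (n + 1) = pairSum x n + ⟪x n, partialSum x n⟫ :=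
      Finset.sum_range_succ _ _
    rw [Finset.sum_range_succ, Finset.sum_range_succ, hp, norm_add_sq_real, ih,
      real_inner_comm, partialSum]
    ring

lemma mul_exogStatistic {dz dw : ℕ} {τ : ℕ → ℝ} (hτ : IsWeightSequence τ) (f : ℕ → Euc dw → ℝ)
    (e : ℕ → Euc dz → ℝ) (n k m : ℕ) (G : Matrix (Fin k) (Fin k) ℝ)
    (y : ℕ → ℝ) (z : ℕ → Euc dz) (w : ℕ → Euc dw) :
    n * exogStatistic τ f e n k m G y z w
      = (n : ℝ)⁻¹ * ‖∑ i ∈ Finset.range n,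
          (y i - seriesEval e k (lsCoef e n k G y z) (z i)) • featureVec τ f m (w i)‖ ^ 2 := by
  rw [exogStatistic, sum_Icc_one_eq_sum_fin, EuclideanSpace.real_norm_sq_eq, Finset.mul_sum,
    Finset.mul_sum]
  refine Finset.sum_congr rfl fun j _ => ?_
  have h1 : (∑ i ∈ Finset.range n,
      (y i - seriesEval e k (lsCoef e n k G y z) (z i)) • featureVec τ f m (w i)) j
      = √(τ (j + 1)) * ∑ i : Fin n,
        (y i - seriesEval e k (lsCoef e n k G y z) (z i)) * f (j + 1) (w i) := by
    rw [Fin.sum_univ_eq_sum_range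
      (fun i => (y i - seriesEval e k (lsCoef e n k G y z) (z i)) * f (j + 1) (w i)) n,
      Finset.mul_sum, WithLp.ofLp_sum, Finset.sum_apply]
    refine Finset.sum_congr rfl fun i _ => ?_
    simp only [featureVec, PiLp.smul_apply, smul_eq_mul]
    ring
  rw [h1, mul_pow, Real.sq_sqrt (hτ.pos _ (by omega)).le, sq_abs, mul_pow]
  -- For the empty sample both sides vanish by the convention `0⁻¹ = 0`.
  rcases eq_or_ne (n : ℝ) 0 with h0 | h0
  · simp [h0]
  · field_simp

/-- The residuals of least squares are orthogonal to the regressors. -/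
lemma sum_residual_smul_regressorVec {dz : ℕ} (e : ℕ → Euc dz → ℝ) (n k : ℕ)
    {G : Matrix (Fin k) (Fin k) ℝ} (y : ℕ → ℝ) (z : ℕ → Euc dz)
    (hG : IsGeneralizedInverse ((designMatrix e n k z)ᵀ * designMatrix e n k z) G) :
    ∑ i ∈ Finset.range n,
      (y i - seriesEval e k (lsCoef e n k G y z) (z i)) • regressorVec e k (z i) = 0 := by
  have h := normal_equations (designMatrix e n k z) hG fun i => y i
  ext l
  have hl := congrFun h l
  rw [← Matrix.mulVec_mulVec] at hl
  simp only [Matrix.mulVec, dotProduct, Matrix.transpose_apply] at hl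
  have h2 : ∀ i : Fin n, seriesEval e k (lsCoef e n k G y z) (z i)
      = ∑ x, designMatrix e n k z i x * ∑ x_1, G x x_1 * ∑ x, designMatrix e n k z x x_1 * y x :=
    fun i => seriesEval_lsCoef e G y z i
  simp_rw [← h2] at hl
  rw [WithLp.ofLp_sum, Finset.sum_apply, ← Fin.sum_univ_eq_sum_range
    (fun i => ((y i - seriesEval e k (lsCoef e n k G y z) (z i)) • regressorVec e k (z i)) l) n]
  simp only [PiLp.smul_apply, smul_eq_mul, sub_mul, Finset.sum_sub_distrib, PiLp.zero_apply]
  rw [sub_eq_zero]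
  refine Eq.trans ?_ (hl.symm.trans ?_)
  · exact Finset.sum_congr rfl fun i _ => mul_comm _ _
  · exact Finset.sum_congr rfl fun i _ => mul_comm _ _

/-- Integrating the quadratic form of the covariance matrix against the law itself gives the trace
of its square, which by symmetry is the sum of the squared entries. This identifies `covEnergy` with
`ς_m²`. -/
lemma IsCenteredLaw.covEnergy_eq_sum {m : ℕ} {ρ : Measure (EuclideanSpace ℝ (Fin m))}
    [IsProbabilityMeasure ρ] {κ : ℝ} (h : IsCenteredLaw ρ κ) :
    covEnergy ρ = ∑ j, ∑ l, (∫ x, x j * x l ∂ρ) ^ 2 := by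
  have hm : ∀ j, MemLp (fun x : EuclideanSpace ℝ (Fin m) => x j) 2 ρ := fun j => by
    refine h.memLp_two.mono ?_ (ae_of_all _ fun x => PiLp.norm_apply_le x j)
    exact Continuous.aestronglyMeasurable (by fun_prop)
  have hi : ∀ j l, Integrable (fun x : EuclideanSpace ℝ (Fin m) => x j * x l) ρ := fun j l =>
    (hm j).integrable_mul (hm l)
  have hq : ∀ u : EuclideanSpace ℝ (Fin m),
      ⟪covarianceOperator ρ u, u⟫ = ∑ j, ∑ l, (u j * u l) * ∫ x, x j * x l ∂ρ := fun u => by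
    have e1 : ∀ x : EuclideanSpace ℝ (Fin m),
        ⟪u, x⟫ ^ 2 = ∑ j, ∑ l, (u j * u l) * (x j * x l) := fun x => by
      rw [PiLp.inner_apply, sq, Finset.sum_mul_sum]
      refine Finset.sum_congr rfl fun j _ => Finset.sum_congr rfl fun l _ => ?_
      simp; ring
    rw [h.inner_self_eq]
    simp_rw [e1]
    rw [integral_finsetSum _ fun j _ => integrable_finsetSum _ fun l _ => (hi j l).const_mul _]
    refine Finset.sum_congr rfl fun j _ => ?_
    rw [integral_finsetSum _ fun l _ => (hi j l).const_mul _]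
    exact Finset.sum_congr rfl fun l _ => integral_const_mul _ _
  rw [covEnergy]
  simp_rw [hq]
  rw [integral_finsetSum _ fun j _ => integrable_finsetSum _ fun l _ => (hi j l).mul_const _]
  refine Finset.sum_congr rfl fun j _ => ?_
  rw [integral_finsetSum _ fun l _ => (hi j l).mul_const _]
  refine Finset.sum_congr rfl fun l _ => ?_
  rw [integral_mul_const, sq]

/-- The trace of `C²` is at most `κ` times the trace of `C`. In the main proof this gives `ς_m² =
O(T)`, hence `k_n² = o(n)`. -/
lemma IsCenteredLaw.covEnergy_le {E : Type*} [NormedAddCommGroup E] [InnerProductSpace ℝ E]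
    [CompleteSpace E] [MeasurableSpace E] [BorelSpace E] [SecondCountableTopology E]
    {ρ : Measure E} [IsProbabilityMeasure ρ] {κ : ℝ} (h : IsCenteredLaw ρ κ) :
    covEnergy ρ ≤ κ * ∫ x, ‖x‖ ^ 2 ∂ρ := by
  rw [covEnergy, ← integral_const_mul]
  exact integral_mono h.integrable_inner_self
    (h.memLp_two.norm.integrable_sq.const_mul κ) fun x => h.inner_self_le x

lemma IsCenteredLaw.pairFourthMoment_le {E : Type*} [NormedAddCommGroup E] [InnerProductSpace ℝ E]
    [CompleteSpace E] [MeasurableSpace E] [BorelSpace E] [SecondCountableTopology E]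
    {ρ : Measure E} [IsProbabilityMeasure ρ] {κ : ℝ} (h : IsCenteredLaw ρ κ) :
    pairFourthMoment ρ ≤ (∫ x, ‖x‖ ^ 4 ∂ρ) ^ 2 := by
  have h4 : Integrable (fun x => ‖x‖ ^ 4) ρ := (memLp_four_iff h.memLp.1).1 h.memLp
  rw [pairFourthMoment, sq, ← integral_mul_const]
  refine integral_mono h.integrable_integral_inner_pow (h4.mul_const _) fun y => ?_
  show ∫ x, ⟪y, x⟫ ^ 4 ∂ρ ≤ ‖y‖ ^ 4 * ∫ x, ‖x‖ ^ 4 ∂ρ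
  rw [← integral_const_mul]
  refine integral_mono ((h.memLp_inner y).integrable_pow_of_four le_rfl) (h4.const_mul _)
    fun x => ?_
  show ⟪y, x⟫ ^ 4 ≤ ‖y‖ ^ 4 * ‖x‖ ^ 4
  rw [← mul_pow, ← Even.pow_abs (by decide : Even 4) ⟪y, x⟫]
  exact pow_le_pow_left₀ (abs_nonneg _) (abs_real_inner_le_norm y x) 4

/-- The empirical second moment concentrates around its mean. -/
lemma measure_empirical_norm_sq_ge_le {E : Type*} [NormedAddCommGroup E] [MeasurableSpace E]
    [BorelSpace E] [SecondCountableTopology E]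
    {ρ : Measure E} [IsProbabilityMeasure ρ] {X : ℕ → Ω → E} (hX : ∀ i, HasLaw (X i) ρ P)
    (hind : iIndepFun X P) (h4 : MemLp id 4 ρ) {n : ℕ} (hn : 0 < n) {η : ℝ} (hη : 0 < η) :
    P {ω | η ≤ |(n : ℝ)⁻¹ * ∑ i ∈ Finset.range n, ‖X i ω‖ ^ 2 - ∫ x, ‖x‖ ^ 2 ∂ρ|}
      ≤ ENNReal.ofReal ((∫ x, ‖x‖ ^ 4 ∂ρ) / (n * η ^ 2)) := by
  have hn0 : (0 : ℝ) < n := Nat.cast_pos.2 hn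
  have h2 : MemLp (fun x : E => ‖x‖ ^ 2) 2 ρ := MemLp.norm_sq_of_four h4
  have h := integral_norm_sum_sub_sq_le hX hind (g := fun x : E => ‖x‖ ^ 2) (by fun_prop) h2 n
  have hL : MemLp (fun ω => ∑ i ∈ Finset.range n, ‖X i ω‖ ^ 2 - (n : ℝ) • ∫ x, ‖x‖ ^ 2 ∂ρ) 2 P :=
    (memLp_sum_comp hX h2 n).sub (memLp_const _)
  have hb := measure_norm_ge_le hL (c := n * η) (by positivity) h
  refine (measure_mono fun ω hω => ?_).trans (hb.trans (ENNReal.ofReal_le_ofReal (le_of_eq ?_)))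
  · simp only [Set.mem_ofPred_eq] at hω ⊢
    have e1 : ∑ i ∈ Finset.range n, ‖X i ω‖ ^ 2 - (n : ℝ) • ∫ x, ‖x‖ ^ 2 ∂ρ
        = n * ((n : ℝ)⁻¹ * ∑ i ∈ Finset.range n, ‖X i ω‖ ^ 2 - ∫ x, ‖x‖ ^ 2 ∂ρ) := by
      rw [smul_eq_mul]; field_simp
    rw [e1, norm_mul, Real.norm_eq_abs, Real.norm_eq_abs, abs_of_pos hn0]
    gcongr
  · have e2 : ∀ x : E, ‖‖x‖ ^ 2‖ ^ 2 = ‖x‖ ^ 4 := fun x => by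
      rw [Real.norm_eq_abs, sq_abs]; ring
    simp_rw [e2]
    field_simp

section ErrorLaw

variable {dw : ℕ} {W : Ω → Euc dw} {U : Ω → ℝ} {f : ℕ → Euc dw → ℝ} {τ : ℕ → ℝ} {m : ℕ}

lemma integral_mul_errorLaw (hW : Measurable W) (hU : Measurable U)
    (hf : ∀ l, 1 ≤ l → Measurable (f l)) (j l : Fin m) :
    ∫ x, x j * x l ∂(P.map fun ω => U ω • featureVec τ f m (W ω))
      = covEntry P U W τ f (j + 1) (l + 1) := by
  have hm : Measurable fun ω => U ω • featureVec τ f m (W ω) :=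
    hU.smul ((measurable_featureVec hf m).comp hW)
  rw [integral_map hm.aemeasurable (Continuous.aestronglyMeasurable (by fun_prop)), covEntry]
  refine integral_congr_ae (ae_of_all _ fun ω => ?_)
  simp only [featureVec, PiLp.smul_apply, smul_eq_mul]
  ring

lemma covFrobenius_eq (hW : Measurable W) (hU : Measurable U)
    (hf : ∀ l, 1 ≤ l → Measurable (f l)) {κ : ℝ}
    (h : IsCenteredLaw (P.map fun ω => U ω • featureVec τ f m (W ω)) κ) :
    covFrobenius P U W τ f m = √(covEnergy (P.map fun ω => U ω • featureVec τ f m (W ω))) := by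
  have hm : Measurable fun ω => U ω • featureVec τ f m (W ω) :=
    hU.smul ((measurable_featureVec hf m).comp hW)
  have := Measure.isProbabilityMeasure_map (μ := P) hm.aemeasurable
  rw [h.covEnergy_eq_sum, covFrobenius, sum_Icc_one_eq_sum_fin]
  simp_rw [sum_Icc_one_eq_sum_fin, integral_mul_errorLaw hW hU hf]

lemma covTrace_eq (hW : Measurable W) (hU : Measurable U)
    (hf : ∀ l, 1 ≤ l → Measurable (f l)) {κ : ℝ}
    (h : IsCenteredLaw (P.map fun ω => U ω • featureVec τ f m (W ω)) κ) :
    covTrace P U W τ f m = ∫ x, ‖x‖ ^ 2 ∂(P.map fun ω => U ω • featureVec τ f m (W ω)) := by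
  have hm : Measurable fun ω => U ω • featureVec τ f m (W ω) :=
    hU.smul ((measurable_featureVec hf m).comp hW)
  have := Measure.isProbabilityMeasure_map (μ := P) hm.aemeasurable
  have hL : ∀ j : Fin m, MemLp (fun x : EuclideanSpace ℝ (Fin m) => x j) 2
      (P.map fun ω => U ω • featureVec τ f m (W ω)) := fun j => by
    refine h.memLp_two.mono ?_ (ae_of_all _ fun x => PiLp.norm_apply_le x j)
    exact Continuous.aestronglyMeasurable (by fun_prop)
  simp_rw [EuclideanSpace.real_norm_sq_eq]
  rw [integral_finsetSum _ fun j _ => (hL j).integrable_sq, covTrace, sum_Icc_one_eq_sum_fin]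
  refine Finset.sum_congr rfl fun j _ => ?_
  rw [← integral_mul_errorLaw hW hU hf]
  simp only [sq]

end ErrorLaw

end Decomposition

/-! ### Normalization of the remainder and the rate conditions. -/

section Assembly

local notation "⟪" x ", " y "⟫" => inner ℝ x y

variable {Ω : Type*} [MeasurableSpace Ω] {P : Measure Ω} [IsProbabilityMeasure P]

/-- Up to a term that vanishes in probability, the normalized quadratic form of the residuals is the
normalized degenerate quadratic form of the vectors `u F`. -/
lemma RegressionBounds.measure_normalized_remainder_ge_le {𝓧 : Type*} [MeasurableSpace 𝓧]
    {Λ : Measure 𝓧} [IsProbabilityMeasure Λ] {m k : ℕ} {u r : 𝓧 → ℝ}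
    {F : 𝓧 → EuclideanSpace ℝ (Fin m)} {e : 𝓧 → EuclideanSpace ℝ (Fin k)} {b c T δ : ℝ}
    (h : RegressionBounds Λ u r F e b c T δ) {ξ : ℕ → Ω → 𝓧} (hξ : ∀ i, HasLaw (ξ i) Λ P)
    (hind : iIndepFun ξ P) {n : ℕ} (hn : 0 < n) (hT : T ^ 2 ≤ n)
    {θ : Ω → EuclideanSpace ℝ (Fin k)}
    (hθ : ∀ ω, ∑ i ∈ Finset.range n,
      (u (ξ i ω) + r (ξ i ω) - ⟪e (ξ i ω), θ ω⟫) • e (ξ i ω) = 0)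
    (h4 : MemLp (fun x => u x • F x) 4 Λ) {M : ℝ}
    (hM : ∫ x, ‖u x • F x‖ ^ 4 ∂Λ ≤ M) {s : ℝ} (hs : 0 < s) {ε : ℝ} (hε : 0 < ε) :
    P {ω | ε ≤ |(√2 * s)⁻¹ * ((n : ℝ)⁻¹ * ‖∑ i ∈ Finset.range n,
          (u (ξ i ω) + r (ξ i ω) - ⟪e (ξ i ω), θ ω⟫) • F (ξ i ω)‖ ^ 2 - ∫ x, ‖u x • F x‖ ^ 2 ∂Λ)
        - √2 / (n * s) * pairSum (fun i => u (ξ i ω) • F (ξ i ω)) n|}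
      ≤ ENNReal.ofReal (M / (n * (ε / 2 * (√2 * s)) ^ 2))
        + (ENNReal.ofReal (b * T ^ 2 / n) + ENNReal.ofReal (4 * b ^ 2 / c ^ 2 * (k ^ 2 / n))
          + ENNReal.ofReal (b ^ 2 * T ^ 2 / n)
          + ENNReal.ofReal ((1 + 4 * b + b ^ 2 + b ^ 3 + (16 / c ^ 2 + 8 * (b + 1) / c) * b
            + (8 / c + 6 * (b + 1))) * (k + n * δ) / (ε / 2 * (√2 * s)))) := by
  have hn0 : (0 : ℝ) < n := Nat.cast_pos.2 hn
  -- After normalization by `√2 s`, the diagonal part and the residual part are each allowed half of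
  -- `ε`.
  set η := ε / 2 * (√2 * s) with hη
  have hη0 : 0 < η := by positivity
  have hg : Measurable fun x => u x • F x := h.meas_u.smul h.meas_F
  have := Measure.isProbabilityMeasure_map (μ := Λ) hg.aemeasurable
  have hlaw : ∀ i, HasLaw (fun ω => u (ξ i ω) • F (ξ i ω)) (Λ.map fun x => u x • F x) P :=
    fun i => HasLaw.fun_comp (Y := fun x => u x • F x) ⟨hg.aemeasurable, rfl⟩ (hξ i)
  have hI : ∀ p : ℕ, ∫ y, ‖y‖ ^ p ∂(Λ.map fun x => u x • F x) = ∫ x, ‖u x • F x‖ ^ p ∂Λ :=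
    fun p => integral_map hg.aemeasurable (Continuous.aestronglyMeasurable (by fun_prop))
  have h4' : MemLp id 4 (Λ.map fun x => u x • F x) :=
    (memLp_map_measure_iff aestronglyMeasurable_id hg.aemeasurable).2 h4
  have h1 := measure_empirical_norm_sq_ge_le hlaw
    (hind.comp (fun _ x => u x • F x) fun _ => hg) h4' hn hη0
  rw [hI 2, hI 4] at h1
  have h2 := h.measure_quadratic_remainder_ge_le hξ hind hn hT hθ hη0
  refine (measure_mono fun ω hω => ?_).trans ((measure_union_le _ _).trans (add_le_add
    (h1.trans (ENNReal.ofReal_le_ofReal (by gcongr))) h2))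
  simp only [Set.mem_union, Set.mem_ofPred_eq] at hω ⊢
  by_contra hnot
  push Not at hnot
  obtain ⟨g1, g2⟩ := hnot
  set N := ‖∑ i ∈ Finset.range n, u (ξ i ω) • F (ξ i ω)‖ ^ 2 with hN
  set R := (n : ℝ)⁻¹ * ‖∑ i ∈ Finset.range n,
          (u (ξ i ω) + r (ξ i ω) - ⟪e (ξ i ω), θ ω⟫) • F (ξ i ω)‖ ^ 2 with hR
  have hsplit : N = _ := norm_partialSum_sq (fun i => u (ξ i ω) • F (ξ i ω)) n
  set D := ∑ i ∈ Finset.range n, ‖u (ξ i ω) • F (ξ i ω)‖ ^ 2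
  set Q := pairSum (fun i => u (ξ i ω) • F (ξ i ω)) n
  set μ := ∫ x, ‖u x • F x‖ ^ 2 ∂Λ
  have hs2 : √2 * √2 = 2 := Real.mul_self_sqrt (by norm_num)
  have e1 : (√2 * s)⁻¹ * (R - μ) - √2 / (n * s) * Q
      = (√2 * s)⁻¹ * ((R - (n : ℝ)⁻¹ * N) + ((n : ℝ)⁻¹ * D - μ)) := by
    rw [hsplit]
    have h2 : √2 / (n * s) = (√2 * s)⁻¹ * (n : ℝ)⁻¹ * (√2 * √2) := by field_simp
    rw [h2, hs2]; ring
  rw [e1, abs_mul, abs_of_pos (by positivity)] at hω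
  have h3 : |(R - (n : ℝ)⁻¹ * N) + ((n : ℝ)⁻¹ * D - μ)| < η + η :=
    (abs_add_le _ _).trans_lt (add_lt_add g2 g1)
  have h5 : (√2 * s)⁻¹ * |(R - (n : ℝ)⁻¹ * N) + ((n : ℝ)⁻¹ * D - μ)|
      < (√2 * s)⁻¹ * (η + η) := by gcongr
  have h6 : (√2 * s)⁻¹ * (η + η) = ε := by rw [hη]; field_simp; norm_num
  linarith

/-- The bounds of the normalized remainder vanish under the rate conditions. -/
lemma tendsto_remainder_bound {T s k ϖ : ℕ → ℝ} {b c C ε : ℝ} (hb : 1 ≤ b) (hε : 0 < ε)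
    (hT : Tendsto (fun n : ℕ => T n ^ 2 / n) atTop (𝓝 0)) (hs : ∀ᶠ n in atTop, 1 ≤ s n)
    (hϖ : ∀ᶠ n in atTop, 1 ≤ ϖ n)
    (hk : Tendsto (fun n => k n / s n) atTop (𝓝 0))
    (hk2 : Tendsto (fun n : ℕ => k n ^ 2 / n) atTop (𝓝 0))
    (hn : Tendsto (fun n : ℕ => n / (ϖ n * s n)) atTop (𝓝 0)) (K b' : ℝ) :
    Tendsto (fun n : ℕ =>
      ENNReal.ofReal (b * T n ^ 2 / (n * (ε / 2 * (√2 * s n)) ^ 2))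
        + (ENNReal.ofReal (b' * T n ^ 2 / n) + ENNReal.ofReal (4 * b' ^ 2 / c ^ 2 * (k n ^ 2 / n))
          + ENNReal.ofReal (b' ^ 2 * T n ^ 2 / n)
          + ENNReal.ofReal (K * (k n + n * (C / ϖ n)) / (ε / 2 * (√2 * s n))))) atTop (𝓝 0) := by
  have hz : ∀ {g : ℕ → ℝ}, Tendsto g atTop (𝓝 0) →
      Tendsto (fun n => ENNReal.ofReal (g n)) atTop (𝓝 0) := fun hg => by
    have := ENNReal.tendsto_ofReal hg
    rwa [ENNReal.ofReal_zero] at this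
  have hs2 : √2 * √2 = 2 := Real.mul_self_sqrt (by norm_num)
  have t1 : Tendsto (fun n : ℕ => b * T n ^ 2 / (n * (ε / 2 * (√2 * s n)) ^ 2)) atTop (𝓝 0) := by
    have h1 : Tendsto (fun n : ℕ => 2 * b / ε ^ 2 * (T n ^ 2 / n)) atTop (𝓝 0) := by
      simpa using hT.const_mul (2 * b / ε ^ 2)
    refine squeeze_zero' (Eventually.of_forall fun n => by positivity) ?_ h1
    filter_upwards [hs, eventually_gt_atTop 0] with n hsn hn
    have hn0 : (0 : ℝ) < n := Nat.cast_pos.2 hn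
    have e1 : b * T n ^ 2 / (n * (ε / 2 * (√2 * s n)) ^ 2)
        = 2 * b / ε ^ 2 * (T n ^ 2 / n) / s n ^ 2 := by
      have : (ε / 2 * (√2 * s n)) ^ 2 = ε ^ 2 / 2 * s n ^ 2 := by
        calc _ = ε ^ 2 / 4 * (√2 * √2) * s n ^ 2 := by ring
          _ = _ := by rw [hs2]; ring
      rw [this]; field_simp
    rw [e1]
    exact div_le_self (by positivity) (one_le_pow₀ hsn)
  have t2 : ∀ a : ℝ, Tendsto (fun n : ℕ => a * T n ^ 2 / n) atTop (𝓝 0) := fun a => by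
    simpa [mul_div_assoc] using hT.const_mul a
  have t3 : Tendsto (fun n : ℕ => 4 * b' ^ 2 / c ^ 2 * (k n ^ 2 / n)) atTop (𝓝 0) := by
    simpa using hk2.const_mul (4 * b' ^ 2 / c ^ 2)
  -- Here the two dimension conditions enter: `k / s → 0` handles the estimation error and `n / (ϖ
  -- s) → 0` the approximation bias.
  have t4 : Tendsto (fun n : ℕ => K * (k n + n * (C / ϖ n)) / (ε / 2 * (√2 * s n))) atTop
      (𝓝 0) := by
    have h1 := (hk.add (hn.const_mul C)).const_mul (K / (ε / 2 * √2))
    rw [mul_zero, add_zero, mul_zero] at h1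
    refine h1.congr' ?_
    filter_upwards [hs, hϖ] with n hsn hϖn
    field_simp
  have h := (hz t1).add ((((hz (t2 b')).add (hz t3)).add (hz (t2 (b' ^ 2)))).add (hz t4))
  simpa using h

end Assembly

end ExogTest

theorem mainTheorem5 {Ω : Type*} [MeasurableSpace Ω] (P : Measure Ω) [IsProbabilityMeasure P]
    {dz dw : ℕ}
    -- the random vector `(Y, Z, W)` and an i.i.d. sample of it
    (Y : Ω → ℝ) (Z : Ω → ExogTest.Euc dz) (W : Ω → ExogTest.Euc dw)
    (hY : Measurable Y) (hZ : Measurable Z) (hW : Measurable W)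
    (Ys : ℕ → Ω → ℝ) (Zs : ℕ → Ω → ExogTest.Euc dz) (Ws : ℕ → Ω → ExogTest.Euc dw)
    (hsample : ExogTest.IsIIDSample P Y Z W Ys Zs Ws)
    -- the model `Y = φ(Z) + U`, `E[U | W] = 0`
    (φ : ExogTest.Euc dz → ℝ) (U : Ω → ℝ) (hmodel : ExogTest.IsIVModel P Y Z W φ U)
    -- the density of `W`, the reference density `ν` and the orthonormal basis of `L²_ν`
    (pW ν : ExogTest.Euc dw → ℝ) (hpW : ExogTest.IsProbDensity pW)
    (hWlaw : P.map W = ExogTest.densityMeasure pW) (hν : ExogTest.IsProbDensity ν)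
    (f : ℕ → ExogTest.Euc dw → ℝ) (hf : ExogTest.IsOrthonormalBasisOfL2 ν f)
    (hbounds : ExogTest.BasisAndDensityBounds P W f ν pW)
    (hU4 : ExogTest.CondFourthMomentBound P U W)
    (hT : ExogTest.CondExpOperatorNonsingular P Z W)
    (τ : ℕ → ℝ) (hτ : ExogTest.IsWeightSequence τ)
    -- the regression function `φ₀(Z) = E[Y | Z]`, its series approximation, the dimensions
    (φ₀ : ExogTest.Euc dz → ℝ)
    (hφ₀ : (fun ω => φ₀ (Z ω)) =ᵐ[P] ExogTest.condExpGiven P Y Z)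
    (e : ℕ → ExogTest.Euc dz → ℝ) (ϖ : ℕ → ℝ) (k m : ℕ → ℕ)
    (hk : Tendsto k atTop atTop) (hm : Tendsto m atTop atTop)
    (hseries : ExogTest.SeriesConditions P Z U φ₀ e ϖ k)
    -- the rate conditions
    (hrate₁ : (fun n : ℕ => (n : ℝ)) =o[atTop]
      fun n => ϖ (k n) * ExogTest.covFrobenius P U W τ f (m n))
    (hrate₂ : (fun n : ℕ => (k n : ℝ)) =o[atTop]
      fun n => ExogTest.covFrobenius P U W τ f (m n))
    (hrate₃ : (fun n : ℕ => (∑ j ∈ Finset.Icc 1 (m n), τ j) ^ 3) =o[atTop]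
      fun n : ℕ => (n : ℝ))
    -- an arbitrary choice of the generalized inverse in the least squares estimator
    (G : (n : ℕ) → Ω → Matrix (Fin (k n)) (Fin (k n)) ℝ)
    (hG : ∀ n ω, ExogTest.IsGeneralizedInverse
      ((ExogTest.designMatrix e n (k n) fun i => Zs i ω)ᵀ *
        ExogTest.designMatrix e n (k n) fun i => Zs i ω) (G n ω))
    -- the hypothesis of exogeneity
    (hExog : (fun ω => φ (Z ω)) =ᵐ[P] fun ω => φ₀ (Z ω)) :
    TendstoInDistribution
      (fun (n : ℕ) (ω : Ω) => (√2 * ExogTest.covFrobenius P U W τ f (m n))⁻¹ *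
        (n * ExogTest.exogStatistic τ f e n (k n) (m n) (G n ω)
            (fun i => Ys i ω) (fun i => Zs i ω) (fun i => Ws i ω)
          - ExogTest.covTrace P U W τ f (m n)))
      atTop (id : ℝ → ℝ) (fun _ => P) (gaussianReal 0 1) := by
  have hUeq : U = fun ω => Y ω - φ (Z ω) := funext fun ω => by rw [hmodel.model ω]; ring
  have hφm := hmodel.measurable_φ
  have hUm : Measurable U := by
    rw [hUeq]; exact hY.sub (hφm.comp hZ)
  obtain ⟨b, hb1, -, hmom⟩ :=
    ExogTest.exists_error_moment_bounds hW hmodel hUm hWlaw hν hf hbounds hU4 hτ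
  obtain ⟨b', c, C, β, -, hreg⟩ := ExogTest.exists_regressionBounds hY hZ hW hmodel hWlaw hν hf
    hbounds hU4 hτ hφ₀ hk hm hseries hExog
  -- the law of the observations
  set V : Ω → ℝ × ExogTest.Euc dz × ExogTest.Euc dw := fun ω => (Y ω, Z ω, W ω)
  have hVm : Measurable V := hY.prodMk (hZ.prodMk hW)
  have := Measure.isProbabilityMeasure_map (μ := P) hVm.aemeasurable
  set ξ : ℕ → Ω → ℝ × ExogTest.Euc dz × ExogTest.Euc dw :=
    fun i ω => (Ys i ω, Zs i ω, Ws i ω) with hξdef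
  have hξ : ∀ i, HasLaw (ξ i) (P.map V) P := fun i =>
    ⟨(hsample.identDistrib i).aemeasurable_fst, (hsample.identDistrib i).map_eq⟩
  have hind : iIndepFun ξ P := hsample.indep
  -- Error, instruments and regressors become functions of one observation, so that the whole sample
  -- is described by the i.i.d. sequence `ξ`.
  set u : ℝ × ExogTest.Euc dz × ExogTest.Euc dw → ℝ := fun x => x.1 - φ x.2.1 with hu
  have hum : Measurable u := measurable_fst.sub (hφm.comp (measurable_fst.comp measurable_snd))
  set F : (n : ℕ) → ℝ × ExogTest.Euc dz × ExogTest.Euc dw → EuclideanSpace ℝ (Fin (m n)) :=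
    fun n x => ExogTest.featureVec τ f (m n) x.2.2 with hF
  have hFm : ∀ n, Measurable (F n) := fun n =>
    (ExogTest.measurable_featureVec hf.1 (m n)).comp (measurable_snd.comp measurable_snd)
  have hgm : ∀ n, Measurable fun x => u x • F n x := fun n => hum.smul (hFm n)
  set ρ : (n : ℕ) → Measure (EuclideanSpace ℝ (Fin (m n))) :=
    fun n => (P.map V).map fun x => u x • F n x with hρ
  have hρeq : ∀ n, ρ n = P.map fun ω => U ω • ExogTest.featureVec τ f (m n) (W ω) := fun n => by
    rw [hρ, hUeq]
    exact Measure.map_map (hgm n) hVm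
  have hρp : ∀ n, IsProbabilityMeasure (ρ n) := fun n =>
    Measure.isProbabilityMeasure_map (hgm n).aemeasurable
  have hUFm : ∀ n, Measurable fun ω => U ω • ExogTest.featureVec τ f (m n) (W ω) := fun n =>
    hUm.smul ((ExogTest.measurable_featureVec hf.1 (m n)).comp hW)
  have hcent : ∀ n, ExogTest.IsCenteredLaw (ρ n) b := fun n => by
    obtain ⟨-, h4, -, hform, hmean⟩ := hmom (m n)
    rw [hρeq]
    exact
    { memLp := (memLp_map_measure_iff aestronglyMeasurable_id (hUFm n).aemeasurable).2 h4.1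
      mean := fun s => by
        rw [integral_map (hUFm n).aemeasurable (Continuous.aestronglyMeasurable (by fun_prop))]
        exact hmean s
      nonneg := by linarith
      bound := fun s => by
        rw [integral_map (hUFm n).aemeasurable (Continuous.aestronglyMeasurable (by fun_prop))]
        exact hform s }
  set T : ℕ → ℝ := fun n => ∑ j ∈ Finset.Icc 1 (m n), τ j with hT
  have hM4 : ∀ n, ∫ x, ‖x‖ ^ 4 ∂(ρ n) ≤ b * T n ^ 2 := fun n => by
    rw [hρeq, integral_map (hUFm n).aemeasurable (Continuous.aestronglyMeasurable (by fun_prop))]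
    exact (hmom (m n)).2.1.2
  have hcentU : ∀ n, ExogTest.IsCenteredLaw
      (P.map fun ω => U ω • ExogTest.featureVec τ f (m n) (W ω)) b := fun n => hρeq n ▸ hcent n
  have hς : ∀ n, ExogTest.covFrobenius P U W τ f (m n) = √(ExogTest.covEnergy (ρ n)) := fun n => by
    rw [hρeq]; exact ExogTest.covFrobenius_eq hW hUm hf.1 (hcentU n)
  have hμ : ∀ n, ExogTest.covTrace P U W τ f (m n)
      = ∫ x, ‖u x • F n x‖ ^ 2 ∂(P.map V) := fun n => by
    rw [ExogTest.covTrace_eq hW hUm hf.1 (hcentU n), ← hρeq,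
      integral_map (hgm n).aemeasurable (Continuous.aestronglyMeasurable (by fun_prop))]
  set s : ℕ → ℝ := fun n => ExogTest.covFrobenius P U W τ f (m n) with hs
  have hs0 : ∀ n, 0 ≤ s n := fun n => Real.sqrt_nonneg _
  -- consequences of the rate conditions
  have hks := hrate₂.tendsto_div_nhds_zero
  have hks' : ∀ᶠ n in atTop, (k n : ℝ) ≤ s n := by
    filter_upwards [hrate₂.bound one_pos] with n hn
    rwa [Real.norm_eq_abs, Real.norm_eq_abs, abs_of_nonneg (hs0 n),
      abs_of_nonneg (Nat.cast_nonneg _), one_mul] at hn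
  -- The divergence of `ς_m` is a consequence of `k_n → ∞` and `k_n = o(ς_m)`; it supplies the
  -- condition `V → ∞` of the limit theorem.
  have hsinf : Tendsto s atTop atTop :=
    tendsto_atTop_mono' _ hks' (tendsto_natCast_atTop_atTop.comp hk)
  have hs1 : ∀ᶠ n in atTop, 1 ≤ s n := hsinf.eventually_ge_atTop 1
  have hT1 : ∀ᶠ n in atTop, 1 ≤ T n := by
    filter_upwards [hm.eventually_ge_atTop 1] with n hn using hτ.one_le_sum hn
  -- The cubic rate condition enters through `T² ≤ T³`, valid since `T ≥ τ_1 = 1`.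
  have hTn : Tendsto (fun n : ℕ => T n ^ 2 / n) atTop (𝓝 0) := by
    refine squeeze_zero' (Eventually.of_forall fun n => by positivity) ?_
      hrate₃.tendsto_div_nhds_zero
    filter_upwards [hT1] with n hn
    exact div_le_div_of_nonneg_right (pow_le_pow_right₀ hn (by norm_num)) (Nat.cast_nonneg _)
  have hV : Tendsto (fun n => ExogTest.covEnergy (ρ n)) atTop atTop := by
    refine (hsinf.atTop_mul_atTop₀ hsinf).congr fun n => ?_
    rw [show s n = _ from hς n]
    exact Real.mul_self_sqrt (hcent n).energy_nonneg
  -- The chain is `k² ≤ ς² ≤ b · b T ≤ b² T²`. The conclusion is needed for the concentration of the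
  -- empirical second moment matrix of the regressors.
  have hk2 : Tendsto (fun n : ℕ => (k n : ℝ) ^ 2 / n) atTop (𝓝 0) := by
    have h1 : Tendsto (fun n : ℕ => b * b * (T n ^ 2 / n)) atTop (𝓝 0) := by
      simpa using hTn.const_mul (b * b)
    refine squeeze_zero' (Eventually.of_forall fun n => by positivity) ?_ h1
    filter_upwards [hks', hT1] with n h2 h3
    have h4 : s n ^ 2 ≤ b * (b * T n) := by
      have h5 := (hcent n).covEnergy_le
      have h6 := ExogTest.integral_norm_sq_le_of_four (P := ρ n) (g := id) hb1 (by linarith)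
        (hcent n).memLp (hM4 n)
      rw [show s n = _ from hς n, Real.sq_sqrt (hcent n).energy_nonneg]
      exact h5.trans (mul_le_mul_of_nonneg_left h6 (by linarith))
    rw [← mul_div_assoc]
    gcongr
    calc (k n : ℝ) ^ 2 ≤ s n ^ 2 := by gcongr
      _ ≤ b * b * T n := by rw [mul_assoc]; exact h4
      _ ≤ b * b * T n ^ 2 := by
        gcongr
        nlinarith
  -- the leading term
  have hX : ∀ n i, HasLaw (fun ω => u (ξ i ω) • F n (ξ i ω)) (ρ n) P := fun n i =>
    HasLaw.fun_comp (Y := fun x => u x • F n x) ⟨(hgm n).aemeasurable, rfl⟩ (hξ i)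
  have hM : Tendsto (fun n : ℕ => (∫ x, ‖x‖ ^ 4 ∂(ρ n)) / n) atTop (𝓝 0) := by
    have h1 : Tendsto (fun n : ℕ => b * (T n ^ 2 / n)) atTop (𝓝 0) := by
      simpa using hTn.const_mul b
    refine squeeze_zero (fun n => div_nonneg (integral_nonneg fun _ => by positivity)
      (Nat.cast_nonneg _)) (fun n => ?_) h1
    rw [← mul_div_assoc]
    exact div_le_div_of_nonneg_right (hM4 n) (Nat.cast_nonneg _)
  have hK : Tendsto (fun n : ℕ => ExogTest.pairFourthMoment (ρ n) / (n : ℝ) ^ 2) atTop (𝓝 0) := by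
    have h1 := hM.mul hM
    rw [mul_zero] at h1
    refine squeeze_zero (fun n => div_nonneg ExogTest.pairFourthMoment_nonneg (sq_nonneg _))
      (fun n => ?_) h1
    rw [div_mul_div_comm, ← sq, ← sq]
    exact div_le_div_of_nonneg_right (hcent n).pairFourthMoment_le (sq_nonneg _)
  have hclt := ExogTest.tendstoInDistribution_pairSum hcent hX
    (fun n => hind.comp (fun _ x => u x • F n x) fun _ => hgm n) hV hM hK
  -- the remainder
  set stat : ℕ → Ω → ℝ := fun n ω => (√2 * ExogTest.covFrobenius P U W τ f (m n))⁻¹ *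
        (n * ExogTest.exogStatistic τ f e n (k n) (m n) (G n ω)
            (fun i => Ys i ω) (fun i => Zs i ω) (fun i => Ws i ω)
          - ExogTest.covTrace P U W τ f (m n)) with hstat
  set lead : ℕ → Ω → ℝ := fun n ω => √2 / (n * √(ExogTest.covEnergy (ρ n))) *
    ExogTest.pairSum (fun i => u (ξ i ω) • F n (ξ i ω)) n with hlead
  have hstatm : ∀ n, AEMeasurable (stat n) P := fun n => by
    refine AEMeasurable.const_mul (AEMeasurable.sub_const (AEMeasurable.const_mul
      (ExogTest.aemeasurable_exogStatistic hf.1 hseries.measurable_e (fun i => ?_) (fun i => ?_)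
        (fun i => ?_) (m n) (hG n)) _) _) _
    · exact measurable_fst.comp_aemeasurable (hξ i).aemeasurable
    · exact (measurable_fst.comp measurable_snd).comp_aemeasurable (hξ i).aemeasurable
    · exact (measurable_snd.comp measurable_snd).comp_aemeasurable (hξ i).aemeasurable
  have hremm : ∀ n, AEMeasurable (stat n - lead n) P := fun n =>
    (hstatm n).sub (hclt.forall_aemeasurable n)
  have hrem : TendstoInMeasure P (fun n => stat n - lead n) atTop fun _ => (0 : ℝ) := by
    rw [tendstoInMeasure_iff_norm]
    intro ε hε
    refine tendsto_of_tendsto_of_tendsto_of_le_of_le' tendsto_const_nhds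
      (ExogTest.tendsto_remainder_bound (T := T) (s := s) (k := fun n => k n)
        (ϖ := fun n => ϖ (k n)) (b := b) (c := c) (C := C) hb1 hε hTn hs1
        (hreg.mono fun n hn => hn.1) hks hk2 hrate₁.tendsto_div_nhds_zero
        (1 + 4 * b' + b' ^ 2 + b' ^ 3 + (16 / c ^ 2 + 8 * (b' + 1) / c) * b'
            + (8 / c + 6 * (b' + 1))) b')
      (Eventually.of_forall fun _ => zero_le) ?_
    filter_upwards [hreg, hs1, eventually_gt_atTop 0, hTn.eventually_lt_const one_pos]
      with n hregn hsn hn hTn1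
    have hn0 : (0 : ℝ) < n := Nat.cast_pos.2 hn
    rw [div_lt_one hn0] at hTn1
    have hsm : Measurable (ExogTest.seriesEval e (k n) (β (k n))) := by
      simp_rw [funext fun z => (ExogTest.inner_regressorVec e z (β (k n))).symm]
      exact (ExogTest.measurable_regressorVec hseries.measurable_e (k n)).inner measurable_const
    have hΛ := ExogTest.RegressionBounds.map (g := V) (u := u) (F := F n)
      (r := fun x => φ x.2.1 - ExogTest.seriesEval e (k n) (β (k n)) x.2.1)
      (e := fun x => ExogTest.regressorVec e (k n) x.2.1)
      hVm hum ((hφm.sub hsm).comp (measurable_fst.comp measurable_snd)) (hFm n)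
      ((ExogTest.measurable_regressorVec hseries.measurable_e (k n)).comp
        (measurable_fst.comp measurable_snd)) (by have := hregn.2; rw [hUeq] at this; exact this)
    -- The least squares coefficients minus those of the approximation of `φ₀`. With this `θ` the
    -- approximating series cancels in `u + r - ⟨e, θ⟩`, which is therefore exactly the residual.
    set θ : Ω → EuclideanSpace ℝ (Fin (k n)) := fun ω => WithLp.toLp 2
      (ExogTest.lsCoef e n (k n) (G n ω) (fun i => Ys i ω) fun i => Zs i ω)
      - WithLp.toLp 2 (β (k n)) with hθ
    have hres : ∀ i ω, u (ξ i ω) + (φ (ξ i ω).2.1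
        - ExogTest.seriesEval e (k n) (β (k n)) (ξ i ω).2.1)
        - inner ℝ (ExogTest.regressorVec e (k n) (ξ i ω).2.1) (θ ω)
        = Ys i ω - ExogTest.seriesEval e (k n)
          (ExogTest.lsCoef e n (k n) (G n ω) (fun i => Ys i ω) fun i => Zs i ω) (Zs i ω) := by
      intro i ω
      rw [hθ, inner_sub_right, ExogTest.inner_regressorVec, ExogTest.inner_regressorVec]
      simp only [hu, hξdef]
      ring
    have hb := hΛ.measure_normalized_remainder_ge_le hξ hind hn hTn1.le (θ := θ)
      (fun ω => by
        simp_rw [hres]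
        exact ExogTest.sum_residual_smul_regressorVec e n (k n) (fun i => Ys i ω)
          (fun i => Zs i ω) (hG n ω))
      ((memLp_map_measure_iff (g := fun x => u x • F n x) (hgm n).aestronglyMeasurable
        hVm.aemeasurable).2 (by have := (hmom (m n)).2.1.1; rw [hUeq] at this; exact this))
      (M := b * T n ^ 2) (by
        have h1 := hM4 n
        rwa [integral_map (hgm n).aemeasurable
          (Continuous.aestronglyMeasurable (by fun_prop))] at h1)
      (s := s n) (by linarith) hε
    simp_rw [hres, ← hμ n] at hb
    refine le_trans (le_of_eq ?_) hb
    congr 1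
    ext ω
    simp only [hstat, hlead, Set.mem_ofPred_eq, Pi.sub_apply, sub_zero, Real.norm_eq_abs,
      ExogTest.mul_exogStatistic hτ, ← hς n, hF, hs, hξdef]
  -- Slutsky's lemma: the remainder tends to zero in probability and does not affect the limit law.
  have hfinal := hclt.add_of_tendstoInMeasure_const hrem hremm
  refine hfinal.congr (fun n => ae_of_all _ fun ω => ?_) (ae_of_all _ fun x => ?_)
  · simp only [Pi.add_apply, Pi.sub_apply]
    ring
  · simp
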